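/- **Setting.** Let $d\ge 1$. For $a\in\mathcal S(\mathbb R^{d}\times\mathbb R^d)$ and $\epsilon>0$ let $u_0(x)=\int a(x,\xi)e^{i\xi\cdot x/\epsilon}\,dW(\xi)$ be the centred complex Gaussian field with $\mathbb E[u_0(x)u_0(x')]=0$ and $\mathbb E[\overline{u_0(x)}u_0(x')]=\int\overline{a(x,\xi)}a(x',\xi)e^{-i\xi\cdot(x-x')/\epsilon}d\xi$, let $W_0^\epsilon(x,v)=(2\pi)^{-d}\int \mathbb E[\overline{u_0(x+\tfrac{\epsilon y}{2})}u_0(x-\tfrac{\epsilon y}2)]e^{iv\cdot y}dy$ be its rescaled Wigner transform, and $\widehat{W_0^\epsilon}(\eta,v)=(2\pi)^{-d/2}\int W_0^\epsilon(x,v)e^{-i\eta\cdot x}dx$. The equation is $i\partial_tu+\omega(D)u=\lambda(u+\bar u)^2$, $u(0)=u_0$, with $\omega(\xi)=|\xi|^2/2$, $\lambda>0$ (that is, $m\equiv1$, $\omega_0=0$), and $u=\sum_m u^m$ is its Dyson series. A *paired graph of depth $m$*, $G\in\mathcal G^p_m$, consists of two binary planar trees (left and right), each with $m$ interaction vertices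 and $m+1$ initial vertices, joined at a root; of a parity $\sigma_v\in\{\pm1\}$ for each vertex $v$ of the two trees, equal to $-1$ at the top vertex of the left tree (which stands for the complex conjugate) and to $+1$ at the top vertex of the right tree; and of a partition $P$ of the $2m+2$ initial vertices into pairs $\{i,j\}$ with $\sigma_i=-\sigma_j$. Each vertex carries the frequency $\xi_v\in\mathbb R^d$ of the edge above it; the Kirchhoff laws say that at each interaction vertex $v$, with $l,r$ the vertices below it, $\xi_v=\xi_l+\xi_r$, and that the two frequencies at the root add up to $0$. Put $\Omega_v=\sigma_v\omega(\xi_v)-\sigma_l\omega(\xi_l)-\sigma_r\omega(\xi_r)$ for each interaction vertex. The value of $G$ at time $t\ge0$ is $$\mathcal F_t(G)=\prod_{v}\frac{-i\sigma_v\lambda}{(2\pi)^{d/2}}\;\big((2\pi)^{d/2}\epsilon^d\big)^{m+1}\int\delta\Big(\sum_i\xi_i\Big)\int\prod_{\{i,j\}\in P}\widehat{W^\epsilon_0}\Big(\xi_i+\xi_j,\tfrac\epsilon2(\sigma_i\xi_i+\sigma_j\xi_j)\Big)\prod_v e^{-i\Omega_vt_v}\,d\underline t\,d\underline\xi ,$$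 where $v$ runs over the $2m$ interaction vertices, $\underline\xi=(\xi_i)$ over the frequencies of the $2m+2$ initial vertices, and $\underline t=(t_v)$ over the interaction times with $0\le t_v\le t$ and $t_v\le t_{v'}$ whenever $v$ is below $v'$. (These are the terms of the diagrammatic series $\mathbb E\|u^m(t)\|_{L^2}^2=\sum_{G\in\mathcal G^p_m}\mathcal F_t(G)$.) The *belt* $G^*=G^*_n\in\mathcal G^p_{2n}$ is the following paired graph. The right tree is a chain $v_0,v_1,\dots,v_{2n}$, where $v_0$ is an initial vertex, $v_{2n}$ is the top vertex, and below $v_k$ lie $v_{k-1}$ (left) and an initial vertex $v_{0,k}$ (right); $v_{k}$ and $v_{0,k}$ have parity $+1$ for even $k$ and $-1$ for odd $k$. The left tree is the same with all parities reversed. In each of the two trees $v_{0,2k-1}$ is paired with $v_{0,2k}$ for $1\le k\le n$, and the two vertices $v_0$ are paired with each other. **Proposition.** Let $d\ge2$. There is a Schwartz function $a\in\mathcal S(\mathbb R^{d}\times\mathbb R^d)$ such that for every $\kappa>0$ the following hold. (i) There is $n^*=n^*(d,\kappa)$ such that for every $n\ge n^*$ there are constants $C,C'>0$ and $\epsilon_0>0$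 such that for all $0<\epsilon\le\epsilon_0$, all $\lambda>0$ and all $t$ with $\epsilon^{2-\kappa}\le t\le\epsilon^{1+\kappa}$, the number $\mathcal F_t(G^*_n)$ is real and $$C(\lambda t)^{4n}\epsilon^{2d}t^{-d}\le\mathcal F_t(G^*_n)\le C'(\lambda t)^{4n}\epsilon^{2d}t^{-d}.$$ (ii) Consequently the diagrammatic series is not absolutely convergent on the kinetic time scale $T_{kin}=\lambda^{-2}\epsilon^{-2}$, nor on slightly shorter ones, in the following sense: for every $0\le\nu<\kappa$ and every $A\in\mathbb R$ there is $n_1$ such that for every $n\ge n_1$ there is $\epsilon_0>0$ such that for all $0<\epsilon\le\epsilon_0$ and all $\lambda>0$ for which $t=\epsilon^\nu T_{kin}$ satisfies $\epsilon^{2-\kappa}\le t\le\epsilon^{1+\kappa}$, $$\sum_{G\in\mathcal G^p_{2n}}|\mathcal F_t(G)|\ge\epsilon^{-A}.$$ -/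

import Mathlib

open MeasureTheory
open scoped SchwartzMap

noncomputable section

namespace Belt

/-- The physical (and frequency) space `ℝᵈ` with its Euclidean norm. -/
abbrev E (d : ℕ) : Type := EuclideanSpace ℝ (Fin d)

/-! ### Interaction graphs -/

/-- Binary planar trees all of whose vertices carry a parity `± 1`.  `leaf σ` is an initial vertex
of parity `σ`; `node σ l r` is an interaction vertex of parity `σ` above the two trees `l` (bottom
left) and `r` (bottom right).  The parity of an edge is that of its lower vertex.  The root vertex
above the whole tree carries no data and is left implicit. -/
inductive ITree : Type
  | leaf (σ : ℤˣ) : ITree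
  | node (σ : ℤˣ) (l r : ITree) : ITree

namespace ITree

/-- The parity of the top vertex. -/
def parity : ITree → ℤˣ
  | leaf σ => σ
  | node σ _ _ => σ

/-- The depth in the sense of iterations: the number of interaction vertices. -/
def depth : ITree → ℕ
  | leaf _ => 0
  | node _ l r => l.depth + r.depth + 1

/-- The set of initial vertices. -/
def Leaf : ITree → Type
  | leaf _ => Unit
  | node _ l r => l.Leaf ⊕ r.Leaf

/-- The set of interaction vertices; `none` is the top one. -/
def Node : ITree → Type
  | leaf _ => Empty
  | node _ l r => Option (l.Node ⊕ r.Node)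

instance instFintypeLeaf : (T : ITree) → Fintype T.Leaf
  | leaf _ => inferInstanceAs (Fintype Unit)
  | node _ l r =>
    letI := instFintypeLeaf l
    letI := instFintypeLeaf r
    inferInstanceAs (Fintype (l.Leaf ⊕ r.Leaf))

instance instDecidableEqLeaf : (T : ITree) → DecidableEq T.Leaf
  | leaf _ => inferInstanceAs (DecidableEq Unit)
  | node _ l r =>
    letI := instDecidableEqLeaf l
    letI := instDecidableEqLeaf r
    inferInstanceAs (DecidableEq (l.Leaf ⊕ r.Leaf))

instance instFintypeNode : (T : ITree) → Fintype T.Node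
  | leaf _ => inferInstanceAs (Fintype Empty)
  | node _ l r =>
    letI := instFintypeNode l
    letI := instFintypeNode r
    inferInstanceAs (Fintype (Option (l.Node ⊕ r.Node)))

/-- The parity of an initial vertex. -/
def leafParity : (T : ITree) → T.Leaf → ℤˣ
  | leaf σ, _ => σ
  | node _ l r, i => Sum.elim l.leafParity r.leafParity i

/-- The parity of an interaction vertex. -/
def nodeParity : (T : ITree) → T.Node → ℤˣ
  | leaf _, v => Empty.elim v
  | node σ l r, v => Option.elim v σ (Sum.elim l.nodeParity r.nodeParity)

/-- The leftmost initial vertex. -/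
def firstLeaf : (T : ITree) → T.Leaf
  | leaf _ => ()
  | node _ l _ => Sum.inl l.firstLeaf

variable {d : ℕ}

/-- The frequency of the edge above the top vertex, as determined by the Kirchhoff laws (at each
interaction vertex the frequency above is the sum of the two frequencies below) from the
frequencies `ξ` of the edges above the initial vertices. -/
def freq : (T : ITree) → (T.Leaf → E d) → E d
  | leaf _, ξ => ξ ()
  | node _ l r, ξ => l.freq (fun i => ξ (Sum.inl i)) + r.freq (fun i => ξ (Sum.inr i))

/-- The dispersion relation `ω(ξ) = |ξ|² / 2`. -/
def omega (ξ : E d) : ℝ := ‖ξ‖ ^ 2 / 2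

/-- The resonance modulus at an interaction vertex `v`:
`Ω_v = σ_v ω(ξ_v) - σ_l ω(ξ_l) - σ_r ω(ξ_r)`, where `ξ_v` is the frequency of the edge above `v`
and `l`, `r` are the vertices below `v` on the left and on the right. -/
def resonance : (T : ITree) → (T.Leaf → E d) → T.Node → ℝ
  | leaf _, _, v => Empty.elim v
  | node σ l r, ξ, v =>
    Option.elim v
      (((σ : ℤ) : ℝ) * omega ((node σ l r).freq ξ)
        - ((l.parity : ℤ) : ℝ) * omega (l.freq fun i => ξ (Sum.inl i))
        - ((r.parity : ℤ) : ℝ) * omega (r.freq fun i => ξ (Sum.inr i)))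
      (Sum.elim (l.resonance fun i => ξ (Sum.inl i)) (r.resonance fun i => ξ (Sum.inr i)))

/-- The time constraints: the interaction times are nonnegative, that of the top vertex is at most
`t`, and that of every other interaction vertex is at most that of the vertex above it. -/
def TimeConstraint : (T : ITree) → (T.Node → ℝ) → ℝ → Prop
  | leaf _, _, _ => True
  | node _ l r, τ, t =>
    0 ≤ τ none ∧ τ none ≤ t ∧
      l.TimeConstraint (fun v => τ (some (Sum.inl v))) (τ none) ∧
      r.TimeConstraint (fun v => τ (some (Sum.inr v))) (τ none)

/-- The product over the interaction vertices of the oscillatory phases `e^{-i Ω_v t_v}`. -/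
def phase (T : ITree) (ξ : T.Leaf → E d) (τ : T.Node → ℝ) : ℂ :=
  ∏ v, Complex.exp (-Complex.I * ((T.resonance ξ v * τ v : ℝ) : ℂ))

/-- The product over the interaction vertices of the coefficients of the Duhamel formula:
`-i λ (2π)^{-d/2}` at a vertex of parity `1`, its complex conjugate at a vertex of parity `-1`. -/
def coupling (d : ℕ) (lam : ℝ) (T : ITree) : ℂ :=
  ∏ v, (-Complex.I * (((T.nodeParity v : ℤ) : ℝ) * lam * (2 * Real.pi) ^ (-(d : ℝ) / 2) : ℝ))

end ITree

/-! ### Paired graphs -/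

/-- Parities of the initial vertices of the union of a left and a right tree. -/
def pairParity (l r : ITree) : l.Leaf ⊕ r.Leaf → ℤˣ := Sum.elim l.leafParity r.leafParity

/-- Paired graphs of depth `m`: a left and a right interaction graph of depth `m`, joined at the
root, and a partition `P` of the initial vertices into pairs of vertices of opposite parities,
encoded by the involution `pair` that exchanges the two members of each pair.
The right tree has a top vertex of parity `1`.  The left tree stands for the complex conjugate, all
its parities have been flipped, and so its top vertex has parity `-1`. -/
structure PairedGraph (m : ℕ) where
  left : ITree
  right : ITree
  left_depth : left.depth = m
  right_depth : right.depth = m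
  left_parity : left.parity = -1
  right_parity : right.parity = 1
  pair : left.Leaf ⊕ right.Leaf → left.Leaf ⊕ right.Leaf
  pair_pair : ∀ i, pair (pair i) = i
  parity_pair : ∀ i, pairParity left right (pair i) = -pairParity left right i

/-! ### The random initial data -/

section Data

variable {d : ℕ}

/-- The covariance `𝔼[conj (u₀ x) * u₀ x'] = ∫ conj (a(x,ξ)) a(x',ξ) e^{-i ξ·(x-x')/ε} dξ` of the
centred complex Gaussian field `u₀(x) = ∫ a(x,ξ) e^{i ξ·x/ε} dW(ξ)`, whose law it determines
together with `𝔼[u₀ x * u₀ x'] = 0`. -/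
def covariance (a : 𝓢(E d × E d, ℂ)) (ε : ℝ) (x y : E d) : ℂ :=
  ∫ ξ : E d, starRingEnd ℂ (a (x, ξ)) * a (y, ξ) *
    Complex.exp (-Complex.I * ((inner ℝ ξ (x - y) / ε : ℝ) : ℂ))

/-- The rescaled Wigner transform of `u₀`:
`W(x,v) = (2π)^{-d} ∫ 𝔼[conj (u₀(x + εy/2)) * u₀(x - εy/2)] e^{i v·y} dy`. -/
def wigner (a : 𝓢(E d × E d, ℂ)) (ε : ℝ) (x v : E d) : ℂ :=
  (((2 * Real.pi) ^ (-(d : ℝ)) : ℝ) : ℂ) *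
    ∫ y : E d, covariance a ε (x + (ε / 2) • y) (x - (ε / 2) • y) *
      Complex.exp (Complex.I * ((inner ℝ v y : ℝ) : ℂ))

/-- The Fourier transform `(2π)^{-d/2} ∫ W(x,v) e^{-i η·x} dx` of the rescaled Wigner transform
with respect to its first variable. -/
def wignerHat (a : 𝓢(E d × E d, ℂ)) (ε : ℝ) (η v : E d) : ℂ :=
  (((2 * Real.pi) ^ (-(d : ℝ) / 2) : ℝ) : ℂ) *
    ∫ x : E d, wigner a ε x v * Complex.exp (-Complex.I * ((inner ℝ η x : ℝ) : ℂ))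

end Data

/-! ### The value of a paired graph -/

/-- The family `ξ` with prescribed values `y` away from the index `i₀` and with `∑ i, ξ i = 0`. -/
def solveSumZero {d : ℕ} {ι : Type} [Fintype ι] [DecidableEq ι] (i₀ : ι)
    (y : {i : ι // i ≠ i₀} → E d) : ι → E d :=
  fun i => if h : i = i₀ then -∑ j, y j else y ⟨i, h⟩

/-- The integral `∫ f(ξ) δ(∑ i, ξ i) dξ` over `(ℝᵈ)^ι`, the variable of index `i₀` being integrated
out against the Dirac mass (the result is independent of `i₀`). -/
def integralSumZero {d : ℕ} {ι : Type} [Fintype ι] [DecidableEq ι] (i₀ : ι)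
    (f : (ι → E d) → ℂ) : ℂ :=
  ∫ y : {i : ι // i ≠ i₀} → E d, f (solveSumZero i₀ y)

namespace PairedGraph

variable {d m : ℕ} (G : PairedGraph m)

/-- The initial vertices of both trees. -/
abbrev Leaf : Type := G.left.Leaf ⊕ G.right.Leaf

/-- The product over the pairs `{i, j}` of `Ŵ(η_{ij}, (ε/2) (σ_i ξ_i + σ_j ξ_j))` with
`η_{ij} = ξ_i + ξ_j`; each pair is listed through its member of parity `1`. -/
def pairWeight (a : 𝓢(E d × E d, ℂ)) (ε : ℝ) (ξ : G.Leaf → E d) : ℂ :=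
  ∏ i with pairParity G.left G.right i = 1,
    wignerHat a ε (ξ i + ξ (G.pair i)) ((ε / 2) • (ξ i - ξ (G.pair i)))

/-- The value `𝓕_t(G)` of a paired graph `G`.  All frequencies and slow variables `η` are expressed
by the Kirchhoff laws through the frequencies `ξ` of the edges above the initial vertices; the only
remaining Kirchhoff law is that the output frequency, the sum of all `ξ_i`, vanishes. -/
def value (a : 𝓢(E d × E d, ℂ)) (ε lam t : ℝ) : ℂ :=
  G.left.coupling d lam * G.right.coupling d lam *
    (((2 * Real.pi) ^ ((d : ℝ) / 2) * ε ^ d : ℝ) : ℂ) ^ (m + 1) *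
    integralSumZero (d := d) (Sum.inl G.left.firstLeaf : G.Leaf) fun ξ =>
      ∫ τl in {τ : G.left.Node → ℝ | G.left.TimeConstraint τ t},
        ∫ τr in {τ : G.right.Node → ℝ | G.right.TimeConstraint τ t},
          G.pairWeight a ε ξ *
            G.left.phase (fun i => ξ (Sum.inl i)) τl *
            G.right.phase (fun i => ξ (Sum.inr i)) τr

end PairedGraph

/-! ### The belt graph -/

/-- The left (`s = -1`) and right (`s = 1`) subtree of the belt.  It is a chain
`v₀, v₁, …, v_{2n}`, where `v₀` is an initial vertex, and below `v_k` lie `v_{k-1}` on the left and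
an initial vertex `v_{0,k}` on the right.  The vertices `v_{2k}` and `v_{0,2k}` have parity `s`,
the vertices `v_{2k-1}` and `v_{0,2k-1}` have parity `-s`. -/
def beltTree (s : ℤˣ) : ℕ → ITree
  | 0 => .leaf s
  | n + 1 => .node s (.node (-s) (beltTree s n) (.leaf (-s))) (.leaf s)

theorem beltTree_depth (s : ℤˣ) (n : ℕ) : (beltTree s n).depth = 2 * n := by
  induction n with
  | zero => rfl
  | succ n ih => simp only [beltTree, ITree.depth, ih]; ring

theorem beltTree_parity (s : ℤˣ) (n : ℕ) : (beltTree s n).parity = s := by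
  cases n <;> rfl

/-- The initial vertices of the two subtrees of the belt. -/
abbrev BeltLeaf (n : ℕ) : Type := (beltTree (-1) n).Leaf ⊕ (beltTree 1 n).Leaf

/-- The inclusion of the initial vertices of a belt in those of the next longer one. -/
def beltEmb (n : ℕ) : BeltLeaf n → BeltLeaf (n + 1)
  | Sum.inl x => Sum.inl (Sum.inl (Sum.inl x))
  | Sum.inr x => Sum.inr (Sum.inl (Sum.inl x))

/-- The pairing of the belt: in both subtrees `v_{0,2k-1}` is paired with `v_{0,2k}`, and the
initial vertices `v₀` of the two subtrees are paired with each other. -/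
def beltPair : (n : ℕ) → BeltLeaf n → BeltLeaf n
  | 0, Sum.inl _ => Sum.inr ()
  | 0, Sum.inr _ => Sum.inl ()
  | n + 1, Sum.inl (Sum.inl (Sum.inl x)) => beltEmb n (beltPair n (Sum.inl x))
  | _ + 1, Sum.inl (Sum.inl (Sum.inr _)) => Sum.inl (Sum.inr ())
  | _ + 1, Sum.inl (Sum.inr _) => Sum.inl (Sum.inl (Sum.inr ()))
  | n + 1, Sum.inr (Sum.inl (Sum.inl x)) => beltEmb n (beltPair n (Sum.inr x))
  | _ + 1, Sum.inr (Sum.inl (Sum.inr _)) => Sum.inr (Sum.inr ())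
  | _ + 1, Sum.inr (Sum.inr _) => Sum.inr (Sum.inl (Sum.inr ()))

theorem beltPair_emb (n : ℕ) (i : BeltLeaf n) :
    beltPair (n + 1) (beltEmb n i) = beltEmb n (beltPair n i) := by
  rcases i with x | x <;> rfl

theorem beltPair_beltPair : ∀ (n : ℕ) (i : BeltLeaf n), beltPair n (beltPair n i) = i
  | 0, Sum.inl _ => rfl
  | 0, Sum.inr _ => rfl
  | n + 1, Sum.inl (Sum.inl (Sum.inl x)) =>
    (beltPair_emb n _).trans (congrArg (beltEmb n) (beltPair_beltPair n (Sum.inl x)))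
  | _ + 1, Sum.inl (Sum.inl (Sum.inr _)) => rfl
  | _ + 1, Sum.inl (Sum.inr _) => rfl
  | n + 1, Sum.inr (Sum.inl (Sum.inl x)) =>
    (beltPair_emb n _).trans (congrArg (beltEmb n) (beltPair_beltPair n (Sum.inr x)))
  | _ + 1, Sum.inr (Sum.inl (Sum.inr _)) => rfl
  | _ + 1, Sum.inr (Sum.inr _) => rfl

theorem pairParity_beltEmb (n : ℕ) (i : BeltLeaf n) :
    pairParity (beltTree (-1) (n + 1)) (beltTree 1 (n + 1)) (beltEmb n i) =
      pairParity (beltTree (-1) n) (beltTree 1 n) i := by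
  rcases i with x | x <;> rfl

theorem parity_beltPair : ∀ (n : ℕ) (i : BeltLeaf n),
    pairParity (beltTree (-1) n) (beltTree 1 n) (beltPair n i) =
      -pairParity (beltTree (-1) n) (beltTree 1 n) i
  | 0, Sum.inl _ => rfl
  | 0, Sum.inr _ => rfl
  | n + 1, Sum.inl (Sum.inl (Sum.inl x)) =>
    (pairParity_beltEmb n _).trans (parity_beltPair n (Sum.inl x))
  | _ + 1, Sum.inl (Sum.inl (Sum.inr _)) => rfl
  | _ + 1, Sum.inl (Sum.inr _) => rfl
  | n + 1, Sum.inr (Sum.inl (Sum.inl x)) =>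
    (pairParity_beltEmb n _).trans (parity_beltPair n (Sum.inr x))
  | _ + 1, Sum.inr (Sum.inl (Sum.inr _)) => rfl
  | _ + 1, Sum.inr (Sum.inr _) => rfl

/-- The belt `G*`, a paired graph of depth `2n`. -/
def beltGraph (n : ℕ) : PairedGraph (2 * n) where
  left := beltTree (-1) n
  right := beltTree 1 n
  left_depth := beltTree_depth _ n
  right_depth := beltTree_depth _ n
  left_parity := beltTree_parity _ n
  right_parity := beltTree_parity _ n
  pair := beltPair n
  pair_pair := beltPair_beltPair n
  parity_pair := parity_beltPair n

/-- The kinetic time scale `T_kin = 1 / (λ² ε²)`. -/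
def kineticTime (ε lam : ℝ) : ℝ := 1 / (lam ^ 2 * ε ^ 2)

end Belt

end

/-! For the Gaussian profile a(x,ξ) = exp(-(|x|²+|ξ|²)/2), the Fourier transform of the Wigner
function is an explicit Gaussian in (η,v), with coefficient w = 1/(1+ε²) in front of |v|², and the
belt can be evaluated almost exactly.

A link of a chain consists of two consecutive interaction vertices and the pair (ξ₁,ξ₂) attached to
them. In the variables η = ξ₁+ξ₂ and ζ = (ξ₁-ξ₂)/2 its weight factorizes. Since the parities
alternate, the squares in the resonance moduli cancel: with p, B, q the successive frequencies of
the chain, the phase is σ B·(s₂q - s₁p), which is affine in ζ. The ζ-integral is therefore a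
Gaussian Fourier transform, equal to a constant times exp(-A²|s₂q - s₁p|²) times a phase, with A of
order 1/(2ε) (`integral_gaussian_mul_linkPhase`). A whole tree thus reduces to the recursion
`chainAmp` (`chainInt_eq`).

The pair joining the two trees is a superposition over x of products of two modulated Gaussians, one
for each tree (`pairGauss_eq_integral`). For fixed x and root frequency q the left tree contributes
the complex conjugate of the right one. The value is thus a nonnegative constant times ∫∫ exp(-|x|²)
|chainAmp|² dq dx, and no cancellation has to be controlled.

Rescaling times by t and q by ε/t gives the exact formula `value_beltGraph`: the power (λt)^{4n}
ε^{2d} t^{-d}, times a factor bounded above and below, times `beltIntegral` at (δ,γ) = (t/ε, ε²/t).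
On the given range of times both parameters are at most ε^κ, so it suffices that `beltIntegral` is
continuous and positive at (0,0). Continuity is dominated convergence: in each link the Gaussian is
integrated along a line in the direction of the frequency, which gains a factor 1/(1+|Q|)
(`norm_chainAmp_le_decay`), and the square of the product of n such gains is integrable when 2n > d.
Positivity holds because at the origin nothing oscillates (`chainAmp_zero`).

For part (ii) one belt is enough: at t = ε^ν T_kin one has λ²t = ε^{ν-2}, so (λt)² ≥ ε^{ν-κ}, and
(λt)^{4n} beats any fixed power of ε once n is large. -/

noncomputable section

namespace Belt

variable {d : ℕ}

/-! ### Gaussian integrals and the Gaussian profile -/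

/-- The Fourier transform of a Gaussian. -/
theorem integral_gaussian_mul_cexp {b : ℝ} (hb : 0 < b) (w : E d) :
    ∫ v : E d, ((Real.exp (-(b * ‖v‖ ^ 2)) : ℝ) : ℂ) *
        Complex.exp (Complex.I * ((inner ℝ w v : ℝ) : ℂ)) =
      (((Real.pi / b) ^ ((d : ℝ) / 2) * Real.exp (-(‖w‖ ^ 2 / (4 * b))) : ℝ) : ℂ) := by
  have h := GaussianFourier.integral_cexp_neg_mul_sq_norm_add (V := E d) (b := (b : ℂ))
    (by simpa using hb) Complex.I w
  have h1 : ∀ v : E d, ((Real.exp (-(b * ‖v‖ ^ 2)) : ℝ) : ℂ) *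
        Complex.exp (Complex.I * ((inner ℝ w v : ℝ) : ℂ)) =
      Complex.exp (-(b : ℂ) * (‖v‖ : ℂ) ^ 2 + Complex.I * ((inner ℝ w v : ℝ) : ℂ)) := by
    intro v
    rw [Complex.exp_add]
    push_cast
    rw [neg_mul]
  simp_rw [h1]
  rw [h]
  push_cast
  rw [Complex.ofReal_cpow (by positivity)]
  congr 1
  · simp
  · rw [Complex.I_sq]
    congr 1
    ring

theorem integrable_gaussian {b : ℝ} (hb : 0 < b) :
    Integrable fun v : E d => Real.exp (-(b * ‖v‖ ^ 2)) := by
  have h := (GaussianFourier.integrable_cexp_neg_mul_sq_norm_add (V := E d) (b := (b : ℂ))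
    (by simpa using hb) 0 0).norm
  refine h.congr (Filter.Eventually.of_forall fun v => ?_)
  simp only [Complex.norm_exp]
  congr 1
  simp [← Complex.ofReal_pow]

theorem pow_mul_exp_neg_bound (k : ℕ) :
    ∃ C : ℝ, ∀ r : ℝ, 0 ≤ r → (1 + r) ^ k * Real.exp (-(r ^ 2 / 2)) ≤ C := by
  -- 3/2 is the maximum of 1 + r - r²/2, attained at r = 1.
  refine ⟨(k.factorial : ℝ) * Real.exp (3 / 2), fun r hr => ?_⟩
  have h1 : (1 + r) ^ k ≤ (k.factorial : ℝ) * Real.exp (1 + r) := by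
    have := Real.pow_div_factorial_le_exp (1 + r) (by positivity) k
    rw [div_le_iff₀ (by positivity)] at this
    linarith
  calc (1 + r) ^ k * Real.exp (-(r ^ 2 / 2))
      ≤ (k.factorial : ℝ) * Real.exp (1 + r) * Real.exp (-(r ^ 2 / 2)) := by gcongr
    _ = (k.factorial : ℝ) * Real.exp (1 + r - r ^ 2 / 2) := by
        rw [mul_assoc, ← Real.exp_add]; ring_nf
    _ ≤ _ := by
        gcongr
        nlinarith [sq_nonneg (r - 1)]

/-- The Gaussian `exp (-(|x|² + |ξ|²) / 2)`. -/
def gaussianProfileFun (z : E d × E d) : ℂ := ((Real.exp (-(‖z.1‖ ^ 2 + ‖z.2‖ ^ 2) / 2) : ℝ) : ℂ)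

theorem contDiff_gaussianProfileFun {n : WithTop ℕ∞} :
    ContDiff ℝ n (gaussianProfileFun : E d × E d → ℂ) := by
  have h : ContDiff ℝ n fun z : E d × E d => Real.exp (-(‖z.1‖ ^ 2 + ‖z.2‖ ^ 2) / 2) := by
    have h1 : ContDiff ℝ n fun z : E d × E d => ‖z.1‖ ^ 2 := contDiff_fst.norm_sq ℝ
    have h2 : ContDiff ℝ n fun z : E d × E d => ‖z.2‖ ^ 2 := contDiff_snd.norm_sq ℝ
    exact ((h1.add h2).neg.div_const 2).exp
  exact Complex.ofRealCLM.contDiff.comp h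

/-- Every derivative of the exponential is itself, so each term of the chain rule for the
exponential of a quadratic form keeps the Gaussian as a factor. -/
theorem norm_iteratedFDeriv_ofReal_exp (i : ℕ) (r : ℝ) :
    ‖iteratedFDeriv ℝ i (fun r : ℝ => ((Real.exp r : ℝ) : ℂ)) r‖ ≤ Real.exp r := by
  have h : (fun r : ℝ => ((Real.exp r : ℝ) : ℂ)) = Complex.ofRealLI ∘ Real.exp := rfl
  rw [h, LinearIsometry.norm_iteratedFDeriv_comp_left (n := i) _
    (Real.contDiff_exp.contDiffAt (n := i)) le_rfl, norm_iteratedFDeriv_eq_norm_iteratedDeriv]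
  rw [iteratedDeriv_eq_iterate, Real.iter_deriv_exp]
  simp

theorem hasTemperateGrowth_quadratic :
    Function.HasTemperateGrowth fun z : E d × E d => -(‖z.1‖ ^ 2 + ‖z.2‖ ^ 2) / 2 := by
  have h1 : Function.HasTemperateGrowth fun z : E d × E d => ‖z.1‖ ^ 2 :=
    Function.HasTemperateGrowth.comp (g := fun x : E d => ‖x‖ ^ 2) (f := fun z : E d × E d => z.1)
      (Function.hasTemperateGrowth_norm_sq _) (ContinuousLinearMap.fst ℝ (E d) (E d)).hasTemperateGrowth
  have h2 : Function.HasTemperateGrowth fun z : E d × E d => ‖z.2‖ ^ 2 :=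
    Function.HasTemperateGrowth.comp (g := fun x : E d => ‖x‖ ^ 2) (f := fun z : E d × E d => z.2)
      (Function.hasTemperateGrowth_norm_sq _) (ContinuousLinearMap.snd ℝ (E d) (E d)).hasTemperateGrowth
  have h3 : (fun z : E d × E d => -(‖z.1‖ ^ 2 + ‖z.2‖ ^ 2) / 2) = (fun _ => (-(1 / 2) : ℝ)) *
      ((fun z : E d × E d => ‖z.1‖ ^ 2) + fun z : E d × E d => ‖z.2‖ ^ 2) := by
    funext z
    simp only [Pi.mul_apply, Pi.add_apply]
    ring
  rw [h3]
  exact (Function.HasTemperateGrowth.const (-(1 / 2) : ℝ)).mul (h1.add h2)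

/-- The Gaussian profile as a Schwartz function. -/
def gaussianProfile (d : ℕ) : 𝓢(E d × E d, ℂ) where
  toFun := gaussianProfileFun
  smooth' := contDiff_gaussianProfileFun
  decay' := by
    intro k n
    obtain ⟨m, C, hC, hb⟩ :=
      (hasTemperateGrowth_quadratic (d := d)).norm_iteratedFDeriv_le_uniform n
    obtain ⟨K, hK⟩ := pow_mul_exp_neg_bound (k + m * n)
    refine ⟨n.factorial * (C + 1) ^ n * K, fun z => ?_⟩
    have hcomp : (gaussianProfileFun : E d × E d → ℂ) =
      (fun r : ℝ => ((Real.exp r : ℝ) : ℂ)) ∘ fun z : E d × E d => -(‖z.1‖ ^ 2 + ‖z.2‖ ^ 2) / 2 :=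
      rfl
    -- The norm of the product space is the maximum, hence at most the Euclidean one.
    have hexp : Real.exp (-(‖z.1‖ ^ 2 + ‖z.2‖ ^ 2) / 2) ≤ Real.exp (-(‖z‖ ^ 2 / 2)) := by
      apply Real.exp_le_exp.2
      rcases max_choice ‖z.1‖ ‖z.2‖ with h | h <;> rw [Prod.norm_def, h] <;>
        nlinarith [sq_nonneg ‖z.1‖, sq_nonneg ‖z.2‖]
    have h1 : (1 : ℝ) ≤ (1 + ‖z‖) ^ m := one_le_pow₀ (by linarith [norm_nonneg z])
    have hder : ‖iteratedFDeriv ℝ n (gaussianProfileFun : E d × E d → ℂ) z‖ ≤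
        n.factorial * Real.exp (-(‖z.1‖ ^ 2 + ‖z.2‖ ^ 2) / 2) * ((C + 1) * (1 + ‖z‖) ^ m) ^ n := by
      rw [hcomp]
      refine norm_iteratedFDeriv_comp_le (N := n)
        (Complex.ofRealCLM.contDiff.comp Real.contDiff_exp) (hasTemperateGrowth_quadratic.1.of_le
          (by exact_mod_cast le_top)) le_rfl z (fun i _ => norm_iteratedFDeriv_ofReal_exp i _)
          fun i hi hin => ?_
      refine (hb i hin z).trans ?_
      -- The composition estimate requires the i-th derivative of the inner function to be bounded
      -- by the i-th power of a single number. Replacing C by C + 1 makes that number at least 1, so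
      -- its powers with i ≥ 1 dominate it.
      have h2 : (1 : ℝ) ≤ (C + 1) * (1 + ‖z‖) ^ m := by nlinarith
      calc C * (1 + ‖z‖) ^ m ≤ (C + 1) * (1 + ‖z‖) ^ m := by nlinarith
        _ ≤ _ := le_self_pow₀ h2 (by omega)
    calc ‖z‖ ^ k * ‖iteratedFDeriv ℝ n (gaussianProfileFun : E d × E d → ℂ) z‖
        ≤ (1 + ‖z‖) ^ k * (n.factorial * Real.exp (-(‖z‖ ^ 2 / 2)) *
          ((C + 1) * (1 + ‖z‖) ^ m) ^ n) := by
          refine mul_le_mul (by gcongr; linarith) (hder.trans ?_) (norm_nonneg _) (by positivity)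
          gcongr
      _ = n.factorial * (C + 1) ^ n * ((1 + ‖z‖) ^ (k + m * n) * Real.exp (-(‖z‖ ^ 2 / 2))) := by
          rw [mul_pow, ← pow_mul, pow_add]; ring
      _ ≤ _ := by
          gcongr
          exact hK _ (norm_nonneg _)

theorem gaussianProfile_apply (x ξ : E d) :
    gaussianProfile d (x, ξ) = ((Real.exp (-(‖x‖ ^ 2 + ‖ξ‖ ^ 2) / 2) : ℝ) : ℂ) := rfl

/-! ### The Wigner transform of the Gaussian profile -/

/-- The width parameter `1 / (1 + ε²)`. -/
def width (ε : ℝ) : ℝ := 1 / (1 + ε ^ 2)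

theorem width_pos (ε : ℝ) : 0 < width ε := by unfold width; positivity

theorem width_le_one (ε : ℝ) : width ε ≤ 1 := by
  unfold width; rw [div_le_one (by positivity)]; nlinarith [sq_nonneg ε]

/-- This converts the Gaussian in v = εζ into one in ζ, and 1 - width is positive but only of order
ε². -/
theorem width_mul_sq (ε : ℝ) : width ε * ε ^ 2 = 1 - width ε := by
  unfold width; field_simp; ring

theorem covariance_gaussianProfile (ε : ℝ) (x y : E d) :
    covariance (gaussianProfile d) ε x y =
      ((Real.pi ^ ((d : ℝ) / 2) * Real.exp (-(‖x‖ ^ 2 + ‖y‖ ^ 2) / 2) *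
        Real.exp (-(‖(1 / ε) • (x - y)‖ ^ 2 / 4)) : ℝ) : ℂ) := by
  unfold covariance
  have h : ∀ ξ : E d, starRingEnd ℂ (gaussianProfile d (x, ξ)) * gaussianProfile d (y, ξ) *
      Complex.exp (-Complex.I * ((inner ℝ ξ (x - y) / ε : ℝ) : ℂ)) =
      ((Real.exp (-(‖x‖ ^ 2 + ‖y‖ ^ 2) / 2) : ℝ) : ℂ) * (((Real.exp (-(1 * ‖ξ‖ ^ 2)) : ℝ) : ℂ) *
        Complex.exp (Complex.I * ((inner ℝ (-((1 / ε) • (x - y))) ξ : ℝ) : ℂ))) := by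
    intro ξ
    rw [gaussianProfile_apply, gaussianProfile_apply, Complex.conj_ofReal, ← mul_assoc,
      ← Complex.ofReal_mul, ← Complex.ofReal_mul, ← Real.exp_add, ← Real.exp_add]
    congr 2
    · ring_nf
    · rw [inner_neg_left, real_inner_smul_left, real_inner_comm]
      push_cast
      ring
  simp_rw [h]
  rw [integral_const_mul, integral_gaussian_mul_cexp one_pos, ← Complex.ofReal_mul]
  congr 1
  rw [norm_neg]
  ring_nf

/-- The constant in `wignerHat_gaussianProfile`. -/
def wignerConst (d : ℕ) : ℝ :=
  (2 * Real.pi) ^ (-(d : ℝ) / 2) * ((2 * Real.pi) ^ (-(d : ℝ)) *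
    (Real.pi ^ ((d : ℝ) / 2) * (4 * Real.pi) ^ ((d : ℝ) / 2))) * Real.pi ^ ((d : ℝ) / 2)

theorem wignerConst_pos (d : ℕ) : 0 < wignerConst d := by
  unfold wignerConst; positivity

theorem wigner_gaussianProfile {ε : ℝ} (hε : 0 < ε) (x v : E d) :
    wigner (gaussianProfile d) ε x v =
      (((2 * Real.pi) ^ (-(d : ℝ)) * (Real.pi ^ ((d : ℝ) / 2) * (4 * Real.pi) ^ ((d : ℝ) / 2)) *
        width ε ^ ((d : ℝ) / 2) * Real.exp (-(width ε * ‖v‖ ^ 2)) *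
          Real.exp (-(1 * ‖x‖ ^ 2)) : ℝ) : ℂ) := by
  unfold wigner
  have hb : 0 < (1 + ε ^ 2) / 4 := by positivity
  have h : ∀ y : E d, covariance (gaussianProfile d) ε (x + (ε / 2) • y) (x - (ε / 2) • y) *
      Complex.exp (Complex.I * ((inner ℝ v y : ℝ) : ℂ)) =
      ((Real.pi ^ ((d : ℝ) / 2) * Real.exp (-(1 * ‖x‖ ^ 2)) : ℝ) : ℂ) *
        (((Real.exp (-((1 + ε ^ 2) / 4 * ‖y‖ ^ 2)) : ℝ) : ℂ) *
          Complex.exp (Complex.I * ((inner ℝ v y : ℝ) : ℂ))) := by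
    intro y
    rw [covariance_gaussianProfile, ← mul_assoc, ← Complex.ofReal_mul]
    congr 2
    rw [mul_assoc, mul_assoc, ← Real.exp_add, ← Real.exp_add]
    congr 2
    have h1 : (1 / ε) • (x + (ε / 2) • y - (x - (ε / 2) • y)) = y := by
      rw [add_sub_sub_cancel, ← two_smul ℝ, smul_smul, smul_smul]
      field_simp
      simp
    rw [h1, norm_add_sq_real, norm_sub_sq_real, norm_smul, Real.norm_of_nonneg (by positivity)]
    ring
  simp_rw [h]
  rw [integral_const_mul, integral_gaussian_mul_cexp hb, ← Complex.ofReal_mul,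
    ← Complex.ofReal_mul]
  congr 1
  have h2 : Real.pi / ((1 + ε ^ 2) / 4) = 4 * Real.pi * width ε := by
    unfold width; field_simp
  have h3 : ‖v‖ ^ 2 / (4 * ((1 + ε ^ 2) / 4)) = width ε * ‖v‖ ^ 2 := by
    unfold width; field_simp
  rw [h2, h3, Real.mul_rpow (by positivity) (width_pos ε).le]
  ring

/-- The Fourier transform of the Wigner transform of the Gaussian profile is a Gaussian. -/
theorem wignerHat_gaussianProfile {ε : ℝ} (hε : 0 < ε) (η v : E d) :
    wignerHat (gaussianProfile d) ε η v =
      ((wignerConst d * width ε ^ ((d : ℝ) / 2) * Real.exp (-(‖η‖ ^ 2 / 4)) *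
        Real.exp (-(width ε * ‖v‖ ^ 2)) : ℝ) : ℂ) := by
  unfold wignerHat
  have h : ∀ x : E d, wigner (gaussianProfile d) ε x v *
      Complex.exp (-Complex.I * ((inner ℝ η x : ℝ) : ℂ)) =
      (((2 * Real.pi) ^ (-(d : ℝ)) * (Real.pi ^ ((d : ℝ) / 2) * (4 * Real.pi) ^ ((d : ℝ) / 2)) *
        width ε ^ ((d : ℝ) / 2) * Real.exp (-(width ε * ‖v‖ ^ 2)) : ℝ) : ℂ) *
        (((Real.exp (-(1 * ‖x‖ ^ 2)) : ℝ) : ℂ) *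
          Complex.exp (Complex.I * ((inner ℝ (-η) x : ℝ) : ℂ))) := by
    intro x
    rw [wigner_gaussianProfile hε, inner_neg_left]
    push_cast
    ring_nf
  simp_rw [h]
  rw [integral_const_mul, integral_gaussian_mul_cexp one_pos, ← Complex.ofReal_mul,
    ← Complex.ofReal_mul, norm_neg, wignerConst]
  congr 1
  simp only [div_one, mul_one]
  ring

/-! ### The amplitude of a chain -/

/-- Parameters `(A, μ, δ, c, y)` of a chain amplitude. -/
abbrev ChainParam (d : ℕ) : Type := ℝ × ℝ × ℝ × ℝ × E d

/-- The Gaussian and oscillatory factor of one link of a chain. -/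
def linkKernel (A μ δ : ℝ) (Q η : E d) (s₂ s₁ : ℝ) : ℂ :=
  ((Real.exp (-(A ^ 2 * ‖s₂ • Q - s₁ • (Q - δ • η)‖ ^ 2)) : ℝ) : ℂ) *
    Complex.exp (-Complex.I *
      ((μ * inner ℝ (s₂ • Q - s₁ • (Q - δ • η)) (Q - (δ / 2) • η) : ℝ) : ℂ))

/-- One link of a chain, for a fixed slow frequency `η`. -/
def linkIntegral (A μ δ : ℝ) (f : E d → ℝ → ℂ) (Q η : E d) (s : ℝ) : ℂ :=
  ∫ s₂ in (0 : ℝ)..s, ∫ s₁ in (0 : ℝ)..s₂, linkKernel A μ δ Q η s₂ s₁ * f (Q - δ • η) s₁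

/-- The amplitude of a chain of `n` links with top frequency `Q` at time `s`. -/
def chainAmp (θ : ChainParam d) : ℕ → E d → ℝ → ℂ
  | 0, Q, _ => ((Real.exp (-(θ.2.2.2.1 ^ 2 * ‖Q‖ ^ 2)) : ℝ) : ℂ)
  | n + 1, Q, s => ∫ η : E d, ((Real.exp (-(1 / 4 * ‖η‖ ^ 2)) : ℝ) : ℂ) *
      (Complex.exp (Complex.I * ((inner ℝ θ.2.2.2.2 η : ℝ) : ℂ)) *
        linkIntegral θ.1 θ.2.1 θ.2.2.1 (chainAmp θ n) Q η s)

theorem norm_cexp_I_mul (r : ℝ) : ‖Complex.exp (Complex.I * (r : ℂ))‖ = 1 := by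
  rw [mul_comm]; exact Complex.norm_exp_ofReal_mul_I r

theorem norm_cexp_neg_I_mul (r : ℝ) : ‖Complex.exp (-Complex.I * (r : ℂ))‖ = 1 := by
  rw [neg_mul, ← mul_neg, ← Complex.ofReal_neg]; exact norm_cexp_I_mul _

theorem norm_linkKernel (A μ δ : ℝ) (Q η : E d) (s₂ s₁ : ℝ) :
    ‖linkKernel A μ δ Q η s₂ s₁‖ =
      Real.exp (-(A ^ 2 * ‖s₂ • Q - s₁ • (Q - δ • η)‖ ^ 2)) := by
  rw [linkKernel, norm_mul, norm_cexp_neg_I_mul, mul_one, Complex.norm_real,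
    Real.norm_of_nonneg (Real.exp_pos _).le]

theorem norm_linkKernel_le_one (A μ δ : ℝ) (Q η : E d) (s₂ s₁ : ℝ) :
    ‖linkKernel A μ δ Q η s₂ s₁‖ ≤ 1 := by
  rw [norm_linkKernel, Real.exp_le_one_iff]
  have : 0 ≤ A ^ 2 * ‖s₂ • Q - s₁ • (Q - δ • η)‖ ^ 2 := by positivity
  linarith

theorem abs_le_abs_of_mem_uIoc {x y : ℝ} (hx : x ∈ Set.uIoc 0 y) : |x| ≤ |y| := by
  rcases Set.mem_uIoc.1 hx with h | h
  · rw [abs_of_pos h.1, abs_of_pos (h.1.trans_le h.2)]; exact h.2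
  · rw [abs_of_nonpos h.2, abs_of_neg (h.1.trans_le h.2)]; linarith [h.1]

theorem norm_doubleInterval_le {g : ℝ → ℝ → ℂ} {r C s : ℝ} (hs : |s| ≤ r)
    (hg : ∀ s₂ s₁ : ℝ, |s₁| ≤ r → ‖g s₂ s₁‖ ≤ C) :
    ‖∫ s₂ in (0 : ℝ)..s, ∫ s₁ in (0 : ℝ)..s₂, g s₂ s₁‖ ≤ C * r * r := by
  have hr : 0 ≤ r := (abs_nonneg s).trans hs
  have hC : 0 ≤ C := (norm_nonneg _).trans (hg 0 0 (by simpa using hr))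
  have h1 : ∀ s₂ ∈ Set.uIoc 0 s, ‖∫ s₁ in (0 : ℝ)..s₂, g s₂ s₁‖ ≤ C * r := by
    intro s₂ hs₂
    have h2 := abs_le_abs_of_mem_uIoc hs₂
    refine (intervalIntegral.norm_integral_le_of_norm_le_const fun s₁ hs₁ =>
      hg s₂ s₁ ((abs_le_abs_of_mem_uIoc hs₁).trans (h2.trans hs))).trans ?_
    rw [sub_zero]
    exact mul_le_mul_of_nonneg_left (h2.trans hs) hC
  refine (intervalIntegral.norm_integral_le_of_norm_le_const h1).trans ?_
  rw [sub_zero]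
  exact mul_le_mul_of_nonneg_left hs (by positivity)

theorem norm_linkIntegral_le (A μ δ : ℝ) {f : E d → ℝ → ℂ} {r C : ℝ} (Q η : E d) {s : ℝ}
    (hs : |s| ≤ r) (hf : ∀ s₁ : ℝ, |s₁| ≤ r → ‖f (Q - δ • η) s₁‖ ≤ C) :
    ‖linkIntegral A μ δ f Q η s‖ ≤ C * r * r := by
  refine norm_doubleInterval_le hs fun s₂ s₁ hs₁ => ?_
  rw [norm_mul]
  have h := hf s₁ hs₁
  have h3 := norm_linkKernel_le_one A μ δ Q η s₂ s₁
  nlinarith [norm_nonneg (f (Q - δ • η) s₁), norm_nonneg (linkKernel A μ δ Q η s₂ s₁)]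

/-- A crude bound, uniform in all parameters and without decay in Q; it serves to dominate integrals
and to justify exchanges of integrals. -/
theorem norm_chainAmp_le (n : ℕ) (r : ℝ) :
    ∃ C : ℝ, ∀ (θ : ChainParam d) (Q : E d) (s : ℝ), |s| ≤ r → ‖chainAmp θ n Q s‖ ≤ C := by
  induction n with
  | zero =>
    refine ⟨1, fun θ Q s _ => ?_⟩
    rw [chainAmp, Complex.norm_real, Real.norm_of_nonneg (Real.exp_pos _).le, Real.exp_le_one_iff]
    have : 0 ≤ θ.2.2.2.1 ^ 2 * ‖Q‖ ^ 2 := by positivity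
    linarith
  | succ n ih =>
    obtain ⟨C, hC⟩ := ih
    refine ⟨∫ η : E d, Real.exp (-(1 / 4 * ‖η‖ ^ 2)) * (C * r * r), fun θ Q s hs => ?_⟩
    refine norm_integral_le_of_norm_le ((integrable_gaussian (by norm_num)).mul_const _)
      (Filter.Eventually.of_forall fun η => ?_)
    rw [norm_mul, norm_mul, norm_cexp_I_mul, one_mul, Complex.norm_real,
      Real.norm_of_nonneg (Real.exp_pos _).le]
    gcongr
    exact norm_linkIntegral_le _ _ _ _ _ hs fun s₁ h => hC _ _ _ h

theorem continuous_linkKernel :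
    Continuous fun z : (ℝ × ℝ × ℝ) × (E d × E d) × ℝ × ℝ =>
      linkKernel z.1.1 z.1.2.1 z.1.2.2 z.2.1.1 z.2.1.2 z.2.2.1 z.2.2.2 := by
  unfold linkKernel
  fun_prop

theorem continuous_linkIntegral {X : Type*} [TopologicalSpace X] {A μ δ s : X → ℝ}
    {Q η : X → E d} {f : X → E d → ℝ → ℂ} (hA : Continuous A) (hμ : Continuous μ)
    (hδ : Continuous δ) (hs : Continuous s) (hQ : Continuous Q) (hη : Continuous η)
    (hf : Continuous fun z : X × E d × ℝ => f z.1 z.2.1 z.2.2) :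
    Continuous fun x => linkIntegral (A x) (μ x) (δ x) (f x) (Q x) (η x) (s x) := by
  unfold linkIntegral
  refine intervalIntegral.continuous_parametric_intervalIntegral_of_continuous ?_ hs
  refine intervalIntegral.continuous_parametric_intervalIntegral_of_continuous
    (X := X × ℝ) (f := fun z s₁ => linkKernel (A z.1) (μ z.1) (δ z.1) (Q z.1) (η z.1) z.2 s₁ *
      f z.1 (Q z.1 - δ z.1 • η z.1) s₁) (s := fun z => z.2) ?_ continuous_snd
  refine Continuous.mul ?_ ?_
  · exact continuous_linkKernel.comp (f := fun z : (X × ℝ) × ℝ =>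
      ((A z.1.1, μ z.1.1, δ z.1.1), (Q z.1.1, η z.1.1), z.1.2, z.2)) (by fun_prop)
  · exact hf.comp (f := fun z : (X × ℝ) × ℝ => (z.1.1, Q z.1.1 - δ z.1.1 • η z.1.1, z.2))
      (by fun_prop)

/-- Continuity has to be joint in the parameters as well, since the limit δ, γ → 0 is taken in them.
The Gaussian in η dominates, locally uniformly in the time. -/
theorem continuous_chainAmp (n : ℕ) :
    Continuous fun z : ChainParam d × E d × ℝ => chainAmp z.1 n z.2.1 z.2.2 := by
  induction n with
  | zero => simp only [chainAmp]; fun_prop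
  | succ n ih =>
    simp only [chainAmp]
    have hint : Continuous fun w : (ChainParam d × E d × ℝ) × E d =>
        linkIntegral w.1.1.1 w.1.1.2.1 w.1.1.2.2.1 (chainAmp w.1.1 n) w.1.2.1 w.2 w.1.2.2 :=
      continuous_linkIntegral (by fun_prop) (by fun_prop) (by fun_prop) (by fun_prop)
        (by fun_prop) (by fun_prop) (ih.comp
          (f := fun z : ((ChainParam d × E d × ℝ) × E d) × E d × ℝ => (z.1.1.1, z.2.1, z.2.2))
          (by fun_prop))
    have hF : Continuous fun w : (ChainParam d × E d × ℝ) × E d =>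
        ((Real.exp (-(1 / 4 * ‖w.2‖ ^ 2)) : ℝ) : ℂ) *
      (Complex.exp (Complex.I * ((inner ℝ w.1.1.2.2.2.2 w.2 : ℝ) : ℂ)) *
        linkIntegral w.1.1.1 w.1.1.2.1 w.1.1.2.2.1 (chainAmp w.1.1 n) w.1.2.1 w.2 w.1.2.2) :=
      Continuous.mul (by fun_prop) (Continuous.mul (by fun_prop) hint)
    refine continuous_iff_continuousAt.2 fun z₀ => ?_
    obtain ⟨C, hC⟩ := norm_chainAmp_le (d := d) n (|z₀.2.2| + 1)
    refine continuousAt_of_dominated (bound := fun η : E d =>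
      Real.exp (-(1 / 4 * ‖η‖ ^ 2)) * (C * (|z₀.2.2| + 1) * (|z₀.2.2| + 1))) ?_ ?_
      ((integrable_gaussian (by norm_num)).mul_const _) ?_
    · exact Filter.Eventually.of_forall fun z =>
        (hF.comp (f := fun η : E d => (z, η)) (by fun_prop)).aestronglyMeasurable
    · have hnear : ∀ᶠ z : ChainParam d × E d × ℝ in nhds z₀, |z.2.2| < |z₀.2.2| + 1 :=
        (by fun_prop : Continuous fun z : ChainParam d × E d × ℝ => |z.2.2|).continuousAt.eventually
          (gt_mem_nhds (by linarith))
      filter_upwards [hnear] with z hz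
      refine Filter.Eventually.of_forall fun η => ?_
      rw [norm_mul, norm_mul, norm_cexp_I_mul, one_mul, Complex.norm_real,
        Real.norm_of_nonneg (Real.exp_pos _).le]
      gcongr
      exact norm_linkIntegral_le _ _ _ _ _ hz.le fun s₁ h => hC _ _ _ h
    · exact Filter.Eventually.of_forall fun η =>
        (hF.comp (f := fun z => (z, η)) (by fun_prop)).continuousAt

/-! ### Decay of the chain amplitude -/

/-- The integral of a Gaussian along a line of direction `P` is `O(1 / (1 + |P|))`. -/
theorem integral_gaussian_line_le :
    ∃ K : ℝ, 0 < K ∧ ∀ (A r : ℝ) (w P : E d), 1 / 4 ≤ A ^ 2 → 0 ≤ r → r ≤ 1 →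
      ∫ s in (0 : ℝ)..r, Real.exp (-(A ^ 2 * ‖w - s • P‖ ^ 2)) ≤ K / (1 + ‖P‖) := by
  set L : ℝ := Real.sqrt (Real.pi / (1 / 4)) with hL
  have hL0 : 0 < L := by positivity
  -- The 1 is the trivial bound on an interval of length at most 1, useful for small P. L is the
  -- full Gaussian integral over the line, which bounds the product of the integral with ‖P‖.
  refine ⟨1 + L, by positivity, fun A r w P hA hr hr1 => ?_⟩
  have h1 : ∫ s in (0 : ℝ)..r, Real.exp (-(A ^ 2 * ‖w - s • P‖ ^ 2)) ≤ 1 := by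
    have := intervalIntegral.norm_integral_le_of_norm_le_const (a := 0) (b := r) (C := 1)
      (f := fun s => Real.exp (-(A ^ 2 * ‖w - s • P‖ ^ 2))) fun s _ => by
        rw [Real.norm_of_nonneg (Real.exp_pos _).le, Real.exp_le_one_iff]
        have : 0 ≤ A ^ 2 * ‖w - s • P‖ ^ 2 := by positivity
        linarith
    rw [sub_zero, abs_of_nonneg hr] at this
    linarith [Real.le_norm_self (∫ s in (0 : ℝ)..r, Real.exp (-(A ^ 2 * ‖w - s • P‖ ^ 2)))]
  have h2 : (∫ s in (0 : ℝ)..r, Real.exp (-(A ^ 2 * ‖w - s • P‖ ^ 2))) * ‖P‖ ≤ L := by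
    rcases eq_or_ne P 0 with rfl | hP
    · simpa using hL0.le
    have hP' : 0 < ‖P‖ := norm_pos_iff.2 hP
    set α : ℝ := inner ℝ w P / ‖P‖ with hα
    have hg : Integrable fun s : ℝ => Real.exp (-(1 / 4) * s ^ 2) :=
      integrable_exp_neg_mul_sq (by norm_num)
    have hg' : Integrable fun s : ℝ => Real.exp (-(1 / 4) * (α - ‖P‖ * s) ^ 2) :=
      (hg.comp_sub_left α).comp_mul_left' hP'.ne'
    have hpt : ∀ s : ℝ, Real.exp (-(A ^ 2 * ‖w - s • P‖ ^ 2)) ≤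
        Real.exp (-(1 / 4) * (α - ‖P‖ * s) ^ 2) := by
      intro s
      apply Real.exp_le_exp.2
      -- Only the component along P is kept, by Cauchy–Schwarz.
      have h3 : (α - ‖P‖ * s) ^ 2 ≤ ‖w - s • P‖ ^ 2 := by
        have h4 : (α - ‖P‖ * s) * ‖P‖ = inner ℝ (w - s • P) P := by
          rw [inner_sub_left, real_inner_smul_left, real_inner_self_eq_norm_sq, hα]
          field_simp
        have h5 := abs_real_inner_le_norm (w - s • P) P
        rw [← h4, abs_mul, abs_of_pos hP'] at h5
        have h6 := le_of_mul_le_mul_right h5 hP'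
        exact sq_le_sq' (by linarith [neg_abs_le (α - ‖P‖ * s)]) ((le_abs_self _).trans h6)
      nlinarith [sq_nonneg ‖w - s • P‖]
    have h7 : ∫ s in (0 : ℝ)..r, Real.exp (-(A ^ 2 * ‖w - s • P‖ ^ 2)) ≤
        ∫ s : ℝ, Real.exp (-(1 / 4) * (α - ‖P‖ * s) ^ 2) := by
      rw [intervalIntegral.integral_of_le hr]
      refine (setIntegral_mono_on (Continuous.integrableOn_Ioc (by fun_prop)) hg'.integrableOn
        measurableSet_Ioc fun s _ => hpt s).trans ?_
      exact setIntegral_le_integral hg' (Filter.Eventually.of_forall fun s => (Real.exp_pos _).le)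
    have h8 : ∫ s : ℝ, Real.exp (-(1 / 4) * (α - ‖P‖ * s) ^ 2) = ‖P‖⁻¹ * L := by
      rw [Measure.integral_comp_mul_left (fun s => Real.exp (-(1 / 4) * (α - s) ^ 2)),
        integral_sub_left_eq_self (fun s => Real.exp (-(1 / 4) * s ^ 2)) volume α,
        integral_gaussian, abs_of_pos (by positivity), smul_eq_mul]
    rw [h8] at h7
    calc _ ≤ ‖P‖⁻¹ * L * ‖P‖ := by gcongr
      _ = L := by field_simp
  rw [le_div_iff₀ (by positivity)]
  linarith

/-- A Peetre-type inequality: decay in Q - δη becomes decay in Q at the price of a polynomial in η,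
which the Gaussian weight in η absorbs. -/
theorem one_add_norm_le_mul (Q η : E d) {δ : ℝ} (hδ : |δ| ≤ 1) :
    1 + ‖Q‖ ≤ (1 + ‖η‖) * (1 + ‖Q - δ • η‖) := by
  have h1 : ‖Q‖ ≤ ‖Q - δ • η‖ + ‖δ • η‖ := by
    simpa using norm_add_le (Q - δ • η) (δ • η)
  have h2 : ‖δ • η‖ ≤ ‖η‖ := by
    rw [norm_smul, Real.norm_eq_abs]; nlinarith [norm_nonneg η]
  nlinarith [norm_nonneg η, norm_nonneg (Q - δ • η), mul_nonneg (norm_nonneg η)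
    (norm_nonneg (Q - δ • η))]

/-- Half of the exponent absorbs the power, the other half is integrable. -/
theorem integrable_pow_mul_gaussian (k : ℕ) :
    Integrable fun η : E d => (1 + ‖η‖) ^ k * Real.exp (-(1 / 4 * ‖η‖ ^ 2)) := by
  have hb : ∃ C : ℝ, ∀ r : ℝ, 0 ≤ r → (1 + r) ^ k * Real.exp (-(1 / 8 * r ^ 2)) ≤ C := by
    obtain ⟨C, hC⟩ := pow_mul_exp_neg_bound k
    refine ⟨2 ^ k * C, fun r hr => ?_⟩
    calc (1 + r) ^ k * Real.exp (-(1 / 8 * r ^ 2))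
        ≤ (2 * (1 + r / 2)) ^ k * Real.exp (-((r / 2) ^ 2 / 2)) := by
          have : -(1 / 8 * r ^ 2) = -((r / 2) ^ 2 / 2) := by ring
          rw [this]
          gcongr
          linarith
      _ = 2 ^ k * ((1 + r / 2) ^ k * Real.exp (-((r / 2) ^ 2 / 2))) := by rw [mul_pow]; ring
      _ ≤ _ := by
          gcongr
          exact hC _ (by positivity)
  obtain ⟨C, hC⟩ := hb
  refine ((integrable_gaussian (d := d) (b := 1 / 8) (by norm_num)).const_mul C).mono'
    (Continuous.aestronglyMeasurable (by fun_prop)) (Filter.Eventually.of_forall fun η => ?_)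
  rw [Real.norm_of_nonneg (by positivity)]
  have h : Real.exp (-(1 / 4 * ‖η‖ ^ 2)) =
      Real.exp (-(1 / 8 * ‖η‖ ^ 2)) * Real.exp (-(1 / 8 * ‖η‖ ^ 2)) := by
    rw [← Real.exp_add]; ring_nf
  rw [h, ← mul_assoc]
  gcongr
  exact hC _ (norm_nonneg _)

/-- Uniform decay of the chain amplitude in its top frequency. -/
theorem norm_chainAmp_le_decay (n : ℕ) :
    ∃ C : ℝ, 0 < C ∧ ∀ (θ : ChainParam d) (Q : E d) (s : ℝ), 1 / 4 ≤ θ.1 ^ 2 → |θ.2.2.1| ≤ 1 →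
      0 ≤ s → s ≤ 1 → ‖chainAmp θ n Q s‖ ≤ C / (1 + ‖Q‖) ^ n := by
  induction n with
  | zero =>
    refine ⟨1, one_pos, fun θ Q s _ _ _ _ => ?_⟩
    rw [chainAmp, Complex.norm_real, Real.norm_of_nonneg (Real.exp_pos _).le, pow_zero, div_one,
      Real.exp_le_one_iff]
    have : 0 ≤ θ.2.2.2.1 ^ 2 * ‖Q‖ ^ 2 := by positivity
    linarith
  | succ n ih =>
    obtain ⟨C, hC, hb⟩ := ih
    obtain ⟨K, hK, hline⟩ := integral_gaussian_line_le (d := d)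
    set J : ℝ := ∫ η : E d, (1 + ‖η‖) ^ (n + 1) * Real.exp (-(1 / 4 * ‖η‖ ^ 2)) with hJ
    have hJ0 : 0 ≤ J := integral_nonneg fun η => by positivity
    -- J + 1 in place of J makes the constant strictly positive without a proof that J is.
    refine ⟨C * K * (J + 1), by positivity, fun θ Q s hA hδ hs0 hs1 => ?_⟩
    have hlink : ∀ η : E d, ‖linkIntegral θ.1 θ.2.1 θ.2.2.1 (chainAmp θ n) Q η s‖ ≤
        C * K * (1 + ‖η‖) ^ (n + 1) / (1 + ‖Q‖) ^ (n + 1) := by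
      intro η
      set P := Q - θ.2.2.1 • η with hP
      -- For fixed s₂ the argument s₂Q - s₁P moves on a line of direction P as s₁ varies, and this
      -- gains one power of 1 + ‖P‖. The s₂-integral is only bounded by its length.
      have hinner : ∀ s₂ ∈ Set.uIoc 0 s, ‖∫ s₁ in (0 : ℝ)..s₂,
          linkKernel θ.1 θ.2.1 θ.2.2.1 Q η s₂ s₁ * chainAmp θ n P s₁‖ ≤
          C / (1 + ‖P‖) ^ n * (K / (1 + ‖P‖)) := by
        intro s₂ hs₂
        rw [Set.uIoc_of_le hs0] at hs₂
        refine (intervalIntegral.norm_integral_le_of_norm_le hs₂.1.le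
          (g := fun s₁ => C / (1 + ‖P‖) ^ n * Real.exp (-(θ.1 ^ 2 * ‖s₂ • Q - s₁ • P‖ ^ 2)))
          (Filter.Eventually.of_forall fun s₁ hs₁ => ?_)
          (Continuous.intervalIntegrable (by fun_prop) _ _)).trans ?_
        · rw [norm_mul, norm_linkKernel, mul_comm]
          gcongr
          exact hb θ P s₁ hA hδ hs₁.1.le (hs₁.2.trans (hs₂.2.trans hs1))
        · rw [intervalIntegral.integral_const_mul]
          gcongr
          exact hline _ _ _ _ hA hs₂.1.le (hs₂.2.trans hs1)
      have h1 := intervalIntegral.norm_integral_le_of_norm_le_const hinner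
      rw [sub_zero, abs_of_nonneg hs0] at h1
      refine h1.trans ?_
      calc C / (1 + ‖P‖) ^ n * (K / (1 + ‖P‖)) * s
          ≤ C / (1 + ‖P‖) ^ n * (K / (1 + ‖P‖)) * 1 := by gcongr
        _ = C * K / (1 + ‖P‖) ^ (n + 1) := by rw [pow_succ]; field_simp
        _ ≤ _ := by
          rw [div_le_div_iff₀ (by positivity) (by positivity), mul_assoc (C * K)]
          gcongr
          rw [← mul_pow]
          gcongr
          exact one_add_norm_le_mul Q η hδ
    have hbound : ‖chainAmp θ (n + 1) Q s‖ ≤ ∫ η : E d,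
        C * K / (1 + ‖Q‖) ^ (n + 1) * ((1 + ‖η‖) ^ (n + 1) * Real.exp (-(1 / 4 * ‖η‖ ^ 2))) := by
      refine norm_integral_le_of_norm_le ((integrable_pow_mul_gaussian _).const_mul _)
        (Filter.Eventually.of_forall fun η => ?_)
      rw [norm_mul, norm_mul, norm_cexp_I_mul, one_mul, Complex.norm_real,
        Real.norm_of_nonneg (Real.exp_pos _).le]
      calc _ ≤ Real.exp (-(1 / 4 * ‖η‖ ^ 2)) *
            (C * K * (1 + ‖η‖) ^ (n + 1) / (1 + ‖Q‖) ^ (n + 1)) := by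
            gcongr
            exact hlink η
        _ = _ := by ring
    rw [integral_const_mul, ← hJ] at hbound
    refine hbound.trans ?_
    rw [div_mul_eq_mul_div]
    gcongr
    linarith

/-! ### Value at the origin and scaling -/

/-- With δ = 0 and Q = 0 every frequency of the chain vanishes, so all kernels equal 1. Only nested
time integrals of monomials and Gaussian integrals in η remain, all positive. -/
theorem chainAmp_zero (A μ c : ℝ) (n : ℕ) :
    ∃ k : ℝ, 0 < k ∧ ∀ s : ℝ,
      chainAmp ((A, μ, 0, c, 0) : ChainParam d) n 0 s = ((k * s ^ (2 * n) : ℝ) : ℂ) := by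
  induction n with
  | zero => exact ⟨1, one_pos, fun s => by simp [chainAmp]⟩
  | succ n ih =>
    obtain ⟨k, hk, h⟩ := ih
    have hB : 0 < ∫ η : E d, Real.exp (-(1 / 4 * ‖η‖ ^ 2)) :=
      integral_exp_pos (integrable_gaussian (by norm_num))
    refine ⟨(∫ η : E d, Real.exp (-(1 / 4 * ‖η‖ ^ 2))) * (k / ((2 * n + 1) * (2 * n + 2))),
      by positivity, fun s => ?_⟩
    have hl : ∀ η : E d, linkIntegral A μ 0
        (chainAmp ((A, μ, 0, c, 0) : ChainParam d) n) 0 η s =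
        ((k / ((2 * n + 1) * (2 * n + 2)) * s ^ (2 * (n + 1)) : ℝ) : ℂ) := by
      intro η
      have h1 : ∀ s₂ s₁ : ℝ, linkKernel A μ 0 (0 : E d) η s₂ s₁ = 1 := by
        intro s₂ s₁; simp [linkKernel]
      unfold linkIntegral
      simp only [h1, one_mul, zero_smul, sub_zero, h]
      simp only [intervalIntegral.integral_ofReal, intervalIntegral.integral_const_mul,
        integral_pow, zero_pow (Nat.succ_ne_zero _), sub_zero,
        intervalIntegral.integral_div]
      congr 1
      push_cast
      field_simp
      ring
    simp only [chainAmp, hl, inner_zero_left, Complex.ofReal_zero, mul_zero, Complex.exp_zero,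
      one_mul]
    rw [integral_mul_const, integral_complex_ofReal, ← Complex.ofReal_mul, mul_assoc]

/-- Each link has two time integrals, whence the factor t². The kernel depends on A times time times
frequency and on μ times time times frequency squared. The variable η is not rescaled, so δ is
divided by ρ and y is unchanged. -/
theorem chainAmp_scaling (A μ δ c : ℝ) (y : E d) {ρ : ℝ} (hρ : ρ ≠ 0) (t : ℝ) (n : ℕ)
    (Q : E d) (s : ℝ) :
    chainAmp ((A, μ, δ, c, y) : ChainParam d) n (ρ • Q) (t * s) =
      ((t ^ (2 * n) : ℝ) : ℂ) *
        chainAmp ((A * (t * ρ), μ * (t * ρ ^ 2), δ / ρ, c * ρ, y) : ChainParam d) n Q s := by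
  induction n generalizing Q s with
  | zero =>
    simp only [chainAmp, mul_zero, pow_zero, Complex.ofReal_one, one_mul, norm_smul, mul_pow,
      Real.norm_eq_abs, sq_abs, mul_assoc]
  | succ n ih =>
    have hsub : ∀ η : E d, ρ • Q - δ • η = ρ • (Q - (δ / ρ) • η) := by
      intro η
      rw [smul_sub, smul_smul, mul_div_cancel₀ _ hρ]
    have hsub2 : ∀ η : E d, ρ • Q - (δ / 2) • η = ρ • (Q - (δ / ρ / 2) • η) := by
      intro η
      rw [smul_sub, smul_smul]
      congr 2
      field_simp
    have hk : ∀ (η : E d) (s₂ s₁ : ℝ), linkKernel A μ δ (ρ • Q) η (t * s₂) (t * s₁) =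
        linkKernel (A * (t * ρ)) (μ * (t * ρ ^ 2)) (δ / ρ) Q η s₂ s₁ := by
      intro η s₂ s₁
      have h1 : (t * s₂) • ρ • Q - (t * s₁) • (ρ • Q - δ • η) =
          (t * ρ) • (s₂ • Q - s₁ • (Q - (δ / ρ) • η)) := by
        rw [hsub, smul_sub (t * ρ), smul_smul, smul_smul, smul_smul, smul_smul]
        congr 2 <;> ring
      unfold linkKernel
      rw [h1, hsub2, norm_smul, real_inner_smul_left, real_inner_smul_right, mul_pow, mul_pow,
        Real.norm_eq_abs, sq_abs]
      congr 4 <;> ring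
    have hl : ∀ η : E d, linkIntegral A μ δ
        (chainAmp ((A, μ, δ, c, y) : ChainParam d) n) (ρ • Q) η (t * s) =
        ((t ^ (2 * (n + 1)) : ℝ) : ℂ) *
        linkIntegral (A * (t * ρ)) (μ * (t * ρ ^ 2)) (δ / ρ) (chainAmp
          ((A * (t * ρ), μ * (t * ρ ^ 2), δ / ρ, c * ρ, y) : ChainParam d) n) Q η s := by
      intro η
      unfold linkIntegral
      have h0 : ∀ (g : ℝ → ℂ) (r : ℝ), ∫ x in (0 : ℝ)..t * r, g x =
          (t : ℂ) * ∫ x in (0 : ℝ)..r, g (t * x) := by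
        intro g r
        have := intervalIntegral.smul_integral_comp_mul_left (a := 0) (b := r) g t
        rw [mul_zero] at this
        rw [← this, Complex.real_smul]
      rw [h0]
      simp_rw [h0]
      simp_rw [hk, hsub, ih]
      simp_rw [mul_left_comm _ ((t ^ (2 * n) : ℝ) : ℂ), intervalIntegral.integral_const_mul]
      push_cast
      ring
    simp only [chainAmp, hl]
    rw [← integral_const_mul]
    congr 1
    funext η
    ring

/-! ### The rescaled belt integral -/

/-- The chain parameters on the scale `δ = t / ε`, `γ = ε² / t`. -/
def scaledParam (δ γ : ℝ) (x : E d) : ChainParam d :=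
  (Real.sqrt (1 + (γ * δ) ^ 2) / 2, γ, δ, Real.sqrt (width (γ * δ) / 2) * γ,
    Real.sqrt (width (γ * δ)) • x)

theorem continuous_scaledParam :
    Continuous fun z : (ℝ × ℝ) × E d => scaledParam z.1.1 z.1.2 z.2 := by
  have h : Continuous width := by
    unfold width
    exact continuous_const.div (by fun_prop) fun x => by positivity
  unfold scaledParam
  have h1 : Continuous fun z : (ℝ × ℝ) × E d => width (z.1.2 * z.1.1) := h.comp (by fun_prop)
  fun_prop

/-- The integrand of `beltIntegral`. -/
def beltIntegrand (n : ℕ) (p : ℝ × ℝ) (z : E d × E d) : ℝ :=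
  Real.exp (-(1 * ‖z.1‖ ^ 2)) * ‖chainAmp (scaledParam p.1 p.2 z.1) n z.2 1‖ ^ 2

/-- The value of the belt with all powers of `ε`, `t` and `λ` scaled out. -/
def beltIntegral (d n : ℕ) (p : ℝ × ℝ) : ℝ := ∫ z : E d × E d, beltIntegrand n p z

theorem continuous_beltIntegrand (n : ℕ) :
    Continuous fun w : (ℝ × ℝ) × E d × E d => beltIntegrand n w.1 w.2 := by
  unfold beltIntegrand
  have h := (continuous_chainAmp (d := d) n).comp
    (f := fun w : (ℝ × ℝ) × E d × E d => (scaledParam w.1.1 w.1.2 w.2.1, w.2.2, (1 : ℝ)))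
    ((continuous_scaledParam.comp (f := fun w : (ℝ × ℝ) × E d × E d => (w.1, w.2.1))
      (by fun_prop)).prodMk (by fun_prop))
  exact Continuous.mul (by fun_prop) (h.norm.pow 2)

theorem beltIntegrand_nonneg (n : ℕ) (p : ℝ × ℝ) (z : E d × E d) : 0 ≤ beltIntegrand n p z := by
  unfold beltIntegrand; positivity

theorem beltIntegrand_le (n : ℕ) :
    ∃ C : ℝ, 0 < C ∧ ∀ (p : ℝ × ℝ) (z : E d × E d), |p.1| ≤ 1 →
      beltIntegrand n p z ≤
        C * (Real.exp (-(1 * ‖z.1‖ ^ 2)) * (1 + ‖z.2‖) ^ (-((2 * n : ℕ) : ℝ))) := by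
  obtain ⟨C, hC, h⟩ := norm_chainAmp_le_decay (d := d) n
  refine ⟨C ^ 2, by positivity, fun p z hp => ?_⟩
  -- After scaling A² = (1 + (γδ)²)/4, so the lower bound needed for the decay holds for all
  -- parameters.
  have hA : 1 / 4 ≤ (scaledParam p.1 p.2 z.1).1 ^ 2 := by
    simp only [scaledParam]
    rw [div_pow, Real.sq_sqrt (by positivity)]
    nlinarith [sq_nonneg (p.2 * p.1)]
  have h1 := h (scaledParam p.1 p.2 z.1) z.2 1 hA hp zero_le_one le_rfl
  have h2 : (1 + ‖z.2‖) ^ (-((2 * n : ℕ) : ℝ)) = ((1 + ‖z.2‖) ^ (2 * n))⁻¹ := by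
    rw [Real.rpow_neg (by positivity), Real.rpow_natCast]
  rw [h2, beltIntegrand]
  calc _ ≤ Real.exp (-(1 * ‖z.1‖ ^ 2)) * (C / (1 + ‖z.2‖) ^ n) ^ 2 := by gcongr
    _ = _ := by rw [div_pow, ← pow_mul, mul_comm n 2]; ring

/-- The condition d < 2n is the one for integrability of (1 + ‖Q‖)^{-2n} on ℝᵈ; this is what
requires the belt to be long. -/
theorem integrable_beltBound {n : ℕ} (hn : d < 2 * n) :
    Integrable fun z : E d × E d =>
      Real.exp (-(1 * ‖z.1‖ ^ 2)) * (1 + ‖z.2‖) ^ (-((2 * n : ℕ) : ℝ)) := by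
  refine (integrable_gaussian one_pos).mul_prod (integrable_one_add_norm ?_)
  rw [finrank_euclideanSpace_fin]
  exact_mod_cast hn

theorem integrable_beltIntegrand {n : ℕ} (hn : d < 2 * n) {p : ℝ × ℝ} (hp : |p.1| ≤ 1) :
    Integrable (beltIntegrand (d := d) n p) := by
  obtain ⟨C, -, h⟩ := beltIntegrand_le (d := d) n
  refine ((integrable_beltBound hn).const_mul C).mono' ((continuous_beltIntegrand n).comp
    (f := fun z => (p, z)) (by fun_prop)).aestronglyMeasurable
    (Filter.Eventually.of_forall fun z => ?_)
  rw [Real.norm_of_nonneg (beltIntegrand_nonneg _ _ _)]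
  exact h p z hp

/-- Dominated convergence: the bound from `beltIntegrand_le` is uniform in γ and in |δ| ≤ 1. -/
theorem continuousAt_beltIntegral {n : ℕ} (hn : d < 2 * n) :
    ContinuousAt (beltIntegral d n) (0, 0) := by
  obtain ⟨C, -, h⟩ := beltIntegrand_le (d := d) n
  refine continuousAt_of_dominated (bound := fun z : E d × E d =>
    C * (Real.exp (-(1 * ‖z.1‖ ^ 2)) * (1 + ‖z.2‖) ^ (-((2 * n : ℕ) : ℝ)))) ?_ ?_
    ((integrable_beltBound hn).const_mul C) ?_
  · exact Filter.Eventually.of_forall fun p => ((continuous_beltIntegrand n).comp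
      (f := fun z => (p, z)) (by fun_prop)).aestronglyMeasurable
  · have hnear : ∀ᶠ p : ℝ × ℝ in nhds (0, 0), |p.1| < 1 :=
      (by fun_prop : Continuous fun p : ℝ × ℝ => |p.1|).continuousAt.eventually
        (gt_mem_nhds (by simp))
    filter_upwards [hnear] with p hp
    refine Filter.Eventually.of_forall fun z => ?_
    rw [Real.norm_of_nonneg (beltIntegrand_nonneg _ _ _)]
    exact h p z hp.le
  · exact Filter.Eventually.of_forall fun z => ((continuous_beltIntegrand n).comp
      (f := fun p => (p, z)) (by fun_prop)).continuousAt

/-- The integrand is continuous and nonnegative, so it suffices that it is nonzero at the single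
point x = 0, Q = 0, which `chainAmp_zero` provides. -/
theorem beltIntegral_zero_pos {n : ℕ} (hn : d < 2 * n) : 0 < beltIntegral d n (0, 0) := by
  have hcont : Continuous (beltIntegrand (d := d) n (0, 0)) :=
    (continuous_beltIntegrand n).comp (f := fun z => ((0, 0), z)) (by fun_prop)
  refine (integral_pos_iff_support_of_nonneg (beltIntegrand_nonneg n (0, 0))
    (integrable_beltIntegrand hn (by simp))).2 (hcont.isOpen_support.measure_pos _ ⟨0, ?_⟩)
  obtain ⟨k, hk, h⟩ := chainAmp_zero (d := d) (Real.sqrt (1 + (0 * 0) ^ 2) / 2) 0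
    (Real.sqrt (width (0 * 0) / 2) * 0) n
  have h1 := h 1
  have h2 : scaledParam 0 0 (0 : E d) = (Real.sqrt (1 + (0 * 0) ^ 2) / 2, 0, 0,
    Real.sqrt (width (0 * 0) / 2) * 0, 0) := by simp [scaledParam]
  rw [Function.mem_support, beltIntegrand]
  simp only [Prod.fst_zero, Prod.snd_zero]
  rw [h2, h1]
  simp [hk.ne']

theorem exists_bounds_beltIntegral {n : ℕ} (hn : d < 2 * n) :
    ∃ C C' r : ℝ, 0 < C ∧ 0 < C' ∧ 0 < r ∧ ∀ δ γ : ℝ, |δ| < r → |γ| < r →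
      C ≤ beltIntegral d n (δ, γ) ∧ beltIntegral d n (δ, γ) ≤ C' := by
  have h0 := beltIntegral_zero_pos hn
  have h1 := (continuousAt_beltIntegral hn).eventually
    (Icc_mem_nhds (half_lt_self h0) (lt_two_mul_self h0))
  obtain ⟨r, hr, h⟩ := Metric.eventually_nhds_iff.1 h1
  refine ⟨_, _, r, half_pos h0, by positivity, hr, fun δ γ hδ hγ => h ?_⟩
  simp [Prod.dist_eq, hδ, hγ]

/-! ### Time integrals over trees -/

namespace ITree

/-- The integral of the oscillatory phases over the interaction times of a tree. -/
def timeAmp (T : ITree) (ξ : T.Leaf → E d) (t : ℝ) : ℂ :=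
  ∫ τ in {τ : T.Node → ℝ | T.TimeConstraint τ t}, T.phase ξ τ

theorem isClosed_timeConstraint :
    (T : ITree) → IsClosed {z : (T.Node → ℝ) × ℝ | T.TimeConstraint z.1 z.2}
  | leaf _ => by simp only [TimeConstraint, Set.ofPred_true]; exact isClosed_univ
  | node σ l r => by
    have hn : Continuous fun z : ((node σ l r).Node → ℝ) × ℝ => z.1 none :=
      (continuous_apply (A := fun _ : (node σ l r).Node => ℝ) none).comp continuous_fst
    have hl : Continuous fun z : ((node σ l r).Node → ℝ) × ℝ =>
        ((fun v => z.1 (some (Sum.inl v)) : l.Node → ℝ), z.1 none) :=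
      (continuous_pi fun v => (continuous_apply (A := fun _ : (node σ l r).Node => ℝ)
        (some (Sum.inl v))).comp continuous_fst).prodMk hn
    have hr : Continuous fun z : ((node σ l r).Node → ℝ) × ℝ =>
        ((fun v => z.1 (some (Sum.inr v)) : r.Node → ℝ), z.1 none) :=
      (continuous_pi fun v => (continuous_apply (A := fun _ : (node σ l r).Node => ℝ)
        (some (Sum.inr v))).comp continuous_fst).prodMk hn
    exact (isClosed_le continuous_const hn).inter ((isClosed_le hn continuous_snd).inter
      (((isClosed_timeConstraint l).preimage hl).inter ((isClosed_timeConstraint r).preimage hr)))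

theorem TimeConstraint.mem_Icc : {T : ITree} → {τ : T.Node → ℝ} → {t : ℝ} →
    T.TimeConstraint τ t → ∀ v, τ v ∈ Set.Icc 0 t
  | leaf _, _, _, _, v => Empty.elim v
  | node _ _ _, _, _, h, none => ⟨h.1, h.2.1⟩
  | node _ _ _, _, _, h, some (Sum.inl v) =>
    Set.Icc_subset_Icc_right h.2.1 (mem_Icc h.2.2.1 v)
  | node _ _ _, _, _, h, some (Sum.inr v) =>
    Set.Icc_subset_Icc_right h.2.1 (mem_Icc h.2.2.2 v)

theorem norm_phase (T : ITree) (ξ : T.Leaf → E d) (τ : T.Node → ℝ) : ‖T.phase ξ τ‖ = 1 := by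
  unfold phase
  rw [norm_prod]
  exact Finset.prod_eq_one fun v _ => norm_cexp_neg_I_mul _

theorem continuous_phase (T : ITree) (ξ : T.Leaf → E d) : Continuous (T.phase ξ) := by
  unfold phase
  fun_prop

end ITree

/-- Adding a top vertex to the family of interaction times. -/
def consTime {β : Type} (z : (β → ℝ) × ℝ) : Option (β ⊕ Empty) → ℝ :=
  fun v => Option.elim v z.2 (Sum.elim z.1 Empty.elim)

/-- `Option (β ⊕ Empty)` is the vertex set of a node whose right subtree is a single initial vertex.
Such nodes are the only ones in the belt, so times are peeled off one at a time. -/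
theorem measurePreserving_consTime {β : Type} [Fintype β] :
    MeasurePreserving (consTime (β := β)) volume volume := by
  have hm : Measurable (consTime (β := β)) := by
    refine measurable_pi_iff.2 fun v => ?_
    rcases v with _ | v | v
    · exact measurable_snd
    · exact (measurable_pi_apply v).comp measurable_fst
    · exact v.elim
  refine ⟨hm, ?_⟩
  refine (Measure.pi_eq fun s hs => ?_).symm
  rw [Measure.map_apply hm (MeasurableSet.univ_pi hs)]
  have h : consTime (β := β) ⁻¹' Set.pi Set.univ s =
      (Set.pi Set.univ fun v => s (some (Sum.inl v))) ×ˢ s none := by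
    ext z
    simp only [Set.mem_preimage, Set.mem_pi, Set.mem_univ, forall_true_left, Set.mem_prod]
    refine ⟨fun h => ⟨fun v => h (some (Sum.inl v)), h none⟩, fun h v => ?_⟩
    rcases v with _ | v | v
    · exact h.2
    · exact h.1 v
    · exact v.elim
  rw [h, Measure.volume_eq_prod, Measure.prod_prod, volume_pi, Measure.pi_pi, Fintype.prod_option,
    Fintype.prod_sum_type]
  simp [mul_comm]

theorem integral_consTime {β : Type} [Fintype β] {g : (Option (β ⊕ Empty) → ℝ) → ℂ}
    (hg : StronglyMeasurable g) : ∫ τ, g τ = ∫ z, g (consTime z) := by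
  have h := measurePreserving_consTime (β := β)
  rw [← h.map_eq, integral_map h.measurable.aemeasurable hg.aestronglyMeasurable]

theorem prod_option_sum_empty {β : Type} [Fintype β] (f : Option (β ⊕ Empty) → ℂ) :
    ∏ v, f v = f none * ∏ v, f (some (Sum.inl v)) := by
  rw [Fintype.prod_option, Fintype.prod_sum_type]
  simp

namespace ITree

theorem timeAmp_leaf (σ : ℤˣ) (ξ : (leaf σ).Leaf → E d) (t : ℝ) : (leaf σ).timeAmp ξ t = 1 := by
  have h1 : ∀ τ, (leaf σ).phase ξ τ = 1 := fun τ => by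
    unfold phase
    exact Finset.prod_of_isEmpty (ι := Empty) _
  unfold timeAmp
  simp only [h1, TimeConstraint, Set.ofPred_true, Measure.restrict_univ]
  change ∫ _ : Empty → ℝ, (1 : ℂ) = 1
  rw [volume_pi, Measure.pi_of_empty, integral_dirac]

theorem phase_node_leaf (σ σ' : ℤˣ) (l : ITree) (ξ : (node σ l (leaf σ')).Leaf → E d)
    (z : (l.Node → ℝ) × ℝ) :
    (node σ l (leaf σ')).phase ξ (consTime z) =
      Complex.exp (-Complex.I *
        (((node σ l (leaf σ')).resonance ξ none * z.2 : ℝ) : ℂ)) *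
        l.phase (fun i => ξ (Sum.inl i)) z.1 := by
  unfold phase
  exact (prod_option_sum_empty _).trans rfl

theorem timeConstraint_node_leaf (σ σ' : ℤˣ) (l : ITree) (z : (l.Node → ℝ) × ℝ) (t : ℝ) :
    (node σ l (leaf σ')).TimeConstraint (consTime z) t ↔
      z.2 ∈ Set.Icc 0 t ∧ l.TimeConstraint z.1 z.2 :=
  ⟨fun h => ⟨⟨h.1, h.2.1⟩, h.2.2.1⟩, fun h => ⟨h.1.1, h.1.2, h.2, trivial⟩⟩

/-- Fubini with the time of the top vertex outermost: for a fixed top time x, the constraints below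
are those of the left subtree with final time x. Integrability is free, the phase having modulus 1
on a bounded region. -/
theorem timeAmp_node_leaf (σ σ' : ℤˣ) (l : ITree) (ξ : (node σ l (leaf σ')).Leaf → E d)
    {t : ℝ} (ht : 0 ≤ t) :
    (node σ l (leaf σ')).timeAmp ξ t =
      ∫ x in (0 : ℝ)..t, Complex.exp (-Complex.I *
        (((node σ l (leaf σ')).resonance ξ none * x : ℝ) : ℂ)) *
        l.timeAmp (fun i => ξ (Sum.inl i)) x := by
  set R : ℝ := (node σ l (leaf σ')).resonance ξ none with hR
  set ph : ((l.Node → ℝ) × ℝ) → ℂ := fun z =>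
    Complex.exp (-Complex.I * ((R * z.2 : ℝ) : ℂ)) * l.phase (fun i => ξ (Sum.inl i)) z.1 with hph
  have hphc : Continuous ph :=
    Continuous.mul (by fun_prop) ((continuous_phase l _).comp continuous_fst)
  set S : Set ((l.Node → ℝ) × ℝ) :=
    {z | z.2 ∈ Set.Icc 0 t ∧ l.TimeConstraint z.1 z.2} with hS
  have hSm : MeasurableSet S :=
    (((isClosed_Icc (a := (0 : ℝ)) (b := t)).preimage continuous_snd).inter
      l.isClosed_timeConstraint).measurableSet
  have hSsub : S ⊆ (Set.pi Set.univ fun _ => Set.Icc 0 t) ×ˢ Set.Icc 0 t := fun z hz =>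
    ⟨fun v _ => Set.Icc_subset_Icc_right hz.1.2 (hz.2.mem_Icc v), hz.1⟩
  have hSfin : volume S < ⊤ := (measure_mono hSsub).trans_lt
    ((isCompact_univ_pi fun _ => isCompact_Icc).prod isCompact_Icc).measure_lt_top
  have hclosed : IsClosed {τ : (node σ l (leaf σ')).Node → ℝ |
      (node σ l (leaf σ')).TimeConstraint τ t} :=
    (node σ l (leaf σ')).isClosed_timeConstraint.preimage (continuous_id.prodMk continuous_const)
  have h1 : (node σ l (leaf σ')).timeAmp ξ t = ∫ z, S.indicator ph z := by
    unfold timeAmp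
    rw [← integral_indicator hclosed.measurableSet]
    refine (integral_consTime ((continuous_phase _ _).stronglyMeasurable.indicator
      hclosed.measurableSet)).trans ?_
    refine integral_congr_ae (Filter.Eventually.of_forall fun z => ?_)
    by_cases hz : z ∈ S
    · have hz' := (timeConstraint_node_leaf σ σ' l z t).2 hz
      simp only [Set.indicator_of_mem hz]
      exact (Set.indicator_of_mem (a := consTime z)
        (s := {τ : (node σ l (leaf σ')).Node → ℝ | (node σ l (leaf σ')).TimeConstraint τ t})
        hz' _).trans (phase_node_leaf σ σ' l ξ z)
    · have hz' := fun h => hz ((timeConstraint_node_leaf σ σ' l z t).1 h)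
      simp only [Set.indicator_of_notMem hz]
      exact Set.indicator_of_notMem (a := consTime z)
        (s := {τ : (node σ l (leaf σ')).Node → ℝ | (node σ l (leaf σ')).TimeConstraint τ t})
        hz' _
  have hint : Integrable (S.indicator ph) := by
    rw [integrable_indicator_iff hSm]
    refine Measure.integrableOn_of_bounded (M := 1) hSfin.ne hphc.aestronglyMeasurable
      (Filter.Eventually.of_forall fun z => ?_)
    rw [hph, norm_mul, norm_phase, norm_cexp_neg_I_mul, one_mul]
  rw [h1, Measure.volume_eq_prod, integral_prod_symm _ hint,
    intervalIntegral.integral_of_le ht, ← integral_Icc_eq_integral_Ioc,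
    ← integral_indicator measurableSet_Icc]
  congr 1
  funext x
  by_cases hx : x ∈ Set.Icc 0 t
  · have hcl : IsClosed {τ : l.Node → ℝ | l.TimeConstraint τ x} :=
      l.isClosed_timeConstraint.preimage (continuous_id.prodMk continuous_const)
    rw [Set.indicator_of_mem hx, timeAmp, ← integral_indicator hcl.measurableSet,
      ← integral_const_mul]
    congr 1
    funext τ
    by_cases hτ : l.TimeConstraint τ x
    · rw [Set.indicator_of_mem (show (τ, x) ∈ S from ⟨hx, hτ⟩), Set.indicator_of_mem
        (show τ ∈ {τ : l.Node → ℝ | l.TimeConstraint τ x} from hτ)]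
    · rw [Set.indicator_of_notMem (fun h : (τ, x) ∈ S => hτ h.2), Set.indicator_of_notMem
        (show τ ∉ {τ : l.Node → ℝ | l.TimeConstraint τ x} from hτ),
        mul_zero]
  · rw [Set.indicator_of_notMem hx]
    have : ∀ τ, S.indicator ph (τ, x) = 0 := fun τ =>
      Set.indicator_of_notMem (fun h : (τ, x) ∈ S => hx h.1) _
    simp [this]

end ITree

/-! ### The time integral and the couplings of the belt -/

/-- The oscillatory phase of two consecutive interaction vertices of the belt. -/
def linkPhase (σ : ℝ) (p ξ₁ ξ₂ : E d) (s₂ s₁ : ℝ) : ℝ :=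
  σ * ((ITree.omega (p + ξ₁ + ξ₂) + ITree.omega (p + ξ₁) - ITree.omega ξ₂) * s₂
    - (ITree.omega (p + ξ₁) + ITree.omega p - ITree.omega ξ₁) * s₁)

/-- The time integral of a belt tree, as an iterated integral. -/
def beltTime (s : ℤˣ) : (n : ℕ) → ((beltTree s n).Leaf → E d) → ℝ → ℂ
  | 0, _, _ => 1
  | n + 1, ξ, t => ∫ s₂ in (0 : ℝ)..t, ∫ s₁ in (0 : ℝ)..s₂,
      Complex.exp (-Complex.I * ((linkPhase ((s : ℤ) : ℝ)
        ((beltTree s n).freq fun i => ξ (Sum.inl (Sum.inl i))) (ξ (Sum.inl (Sum.inr ())))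
        (ξ (Sum.inr ())) s₂ s₁ : ℝ) : ℂ)) *
      beltTime s n (fun i => ξ (Sum.inl (Sum.inl i))) s₁

/-- Two vertices are peeled off per link. The sign of t matters: for t < 0 and n > 0 the constraint
set is empty, while the interval integrals continue to negative times, which keeps `beltTime`
continuous on the whole line. -/
theorem timeAmp_beltTree (s : ℤˣ) (n : ℕ) (ξ : (beltTree s n).Leaf → E d) {t : ℝ} (ht : 0 ≤ t) :
    (beltTree s n).timeAmp ξ t = beltTime s n ξ t := by
  induction n generalizing t with
  | zero => exact ITree.timeAmp_leaf s ξ t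
  | succ n ih =>
    refine (ITree.timeAmp_node_leaf s s (.node (-s) (beltTree s n) (.leaf (-s))) ξ ht).trans ?_
    rw [beltTime]
    refine intervalIntegral.integral_congr fun s₂ hs₂ => ?_
    rw [Set.uIcc_of_le ht] at hs₂
    rw [ITree.timeAmp_node_leaf _ _ _ _ hs₂.1, ← intervalIntegral.integral_const_mul]
    refine intervalIntegral.integral_congr fun s₁ hs₁ => ?_
    rw [Set.uIcc_of_le hs₂.1] at hs₁
    rw [ih _ hs₁.1, ← mul_assoc, ← Complex.exp_add, ← mul_add, ← Complex.ofReal_add]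
    congr 5
    simp only [ITree.resonance, Option.elim, ITree.freq, beltTree_parity,
      ITree.parity.eq_1, ITree.parity.eq_2, linkPhase]
    push_cast
    ring

/-- The two vertices of a link have opposite parities, and (-iσ)(iσ) = 1: all factors of i disappear
and the coupling is nonnegative. -/
theorem coupling_beltTree (lam : ℝ) (s : ℤˣ) (n : ℕ) :
    (beltTree s n).coupling d lam =
      (((lam * (2 * Real.pi) ^ (-(d : ℝ) / 2)) ^ (2 * n) : ℝ) : ℂ) := by
  induction n with
  | zero =>
    unfold ITree.coupling
    simp only [mul_zero, pow_zero, Complex.ofReal_one]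
    exact Finset.prod_of_isEmpty (ι := Empty) _
  | succ n ih =>
    have h : (beltTree s (n + 1)).coupling d lam =
        (-Complex.I * (((s : ℤ) : ℝ) * lam * (2 * Real.pi) ^ (-(d : ℝ) / 2) : ℝ)) *
        ((-Complex.I * ((((-s : ℤˣ) : ℤ) : ℝ) * lam * (2 * Real.pi) ^ (-(d : ℝ) / 2) : ℝ)) *
          (beltTree s n).coupling d lam) := by
      unfold ITree.coupling
      refine (prod_option_sum_empty (β := Option ((beltTree s n).Node ⊕ Empty)) _).trans ?_
      congr 1
      exact (prod_option_sum_empty _).trans rfl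
    rw [h, ih]
    have hs : ((s : ℤ) : ℂ) * ((s : ℤ) : ℂ) = 1 := by
      rcases Int.units_eq_one_or s with rfl | rfl <;> simp
    generalize ((2 * Real.pi) ^ (-(d : ℝ) / 2) : ℝ) = k
    push_cast
    have : 2 * (n + 1) = 2 * n + 2 := by ring
    rw [this, pow_add _ (2 * n) 2]
    linear_combination (lam * k : ℂ) ^ (2 * n) * (-Complex.I ^ 2 * (lam : ℂ) ^ 2 * (k : ℂ) ^ 2) * hs -
      (lam * k : ℂ) ^ (2 * n) * (lam : ℂ) ^ 2 * (k : ℂ) ^ 2 * Complex.I_sq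

theorem continuous_freq : (T : ITree) → Continuous (T.freq : (T.Leaf → E d) → E d)
  | .leaf _ => continuous_apply (A := fun _ : Unit => E d) ()
  | .node σ l r =>
    ((continuous_freq l).comp (continuous_pi fun i =>
      continuous_apply (A := fun _ : (ITree.node σ l r).Leaf => E d) (Sum.inl i))).add
    ((continuous_freq r).comp (continuous_pi fun i =>
      continuous_apply (A := fun _ : (ITree.node σ l r).Leaf => E d) (Sum.inr i)))

theorem freq_eq_sum : (T : ITree) → (ξ : T.Leaf → E d) → T.freq ξ = ∑ i, ξ i
  | .leaf _, ξ => (Fintype.sum_unique (ι := Unit) ξ).symm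
  | .node σ l r, ξ => by
    rw [ITree.freq, freq_eq_sum l, freq_eq_sum r]
    exact (Fintype.sum_sum_type (α₁ := l.Leaf) (α₂ := r.Leaf) ξ).symm

theorem continuous_linkPhase (σ : ℝ) : Continuous fun z : (E d × E d × E d) × ℝ × ℝ =>
    linkPhase σ z.1.1 z.1.2.1 z.1.2.2 z.2.1 z.2.2 := by
  unfold linkPhase ITree.omega
  fun_prop

theorem continuous_beltTime (s : ℤˣ) (n : ℕ) :
    Continuous fun z : ((beltTree s n).Leaf → E d) × ℝ => beltTime s n z.1 z.2 := by
  induction n with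
  | zero => exact continuous_const
  | succ n ih =>
    have ha : ∀ i, Continuous fun ξ : (beltTree s (n + 1)).Leaf → E d => ξ i := fun i =>
      continuous_apply (A := fun _ : (beltTree s (n + 1)).Leaf => E d) i
    have hr : Continuous fun ξ : (beltTree s (n + 1)).Leaf → E d =>
        (fun i => ξ (Sum.inl (Sum.inl i)) : (beltTree s n).Leaf → E d) :=
      continuous_pi fun i => ha _
    have hf := (continuous_freq (d := d) (beltTree s n)).comp hr
    simp only [beltTime]
    refine intervalIntegral.continuous_parametric_intervalIntegral_of_continuous ?_ continuous_snd
    refine intervalIntegral.continuous_parametric_intervalIntegral_of_continuous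
      (X := (((beltTree s (n + 1)).Leaf → E d) × ℝ) × ℝ) (f := fun z s₁ =>
        Complex.exp (-Complex.I * ((linkPhase ((s : ℤ) : ℝ)
        ((beltTree s n).freq fun i => z.1.1 (Sum.inl (Sum.inl i))) (z.1.1 (Sum.inl (Sum.inr ())))
        (z.1.1 (Sum.inr ())) z.2 s₁ : ℝ) : ℂ)) *
      beltTime s n (fun i => z.1.1 (Sum.inl (Sum.inl i))) s₁) (s := fun z => z.2) ?_ continuous_snd
    have hz : Continuous fun z : ((((beltTree s (n + 1)).Leaf → E d) × ℝ) × ℝ) × ℝ => z.1.1.1 := by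
      fun_prop
    refine Continuous.mul ?_ (ih.comp ((hr.comp hz).prodMk continuous_snd))
    have h := (continuous_linkPhase (d := d) ((s : ℤ) : ℝ)).comp
      (f := fun z : ((((beltTree s (n + 1)).Leaf → E d) × ℝ) × ℝ) × ℝ =>
        (((beltTree s n).freq fun i => z.1.1.1 (Sum.inl (Sum.inl i)),
          z.1.1.1 (Sum.inl (Sum.inr ())), z.1.1.1 (Sum.inr ())), z.1.2, z.2))
      (((hf.comp hz).prodMk (((ha _).comp hz).prodMk ((ha _).comp hz))).prodMk (by fun_prop))
    exact Complex.continuous_exp.comp (continuous_const.mul (Complex.continuous_ofReal.comp h))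

/-! ### The pair weights of the belt -/

/-- The weight of one pair of initial vertices for the Gaussian profile. -/
def pairGauss (ε : ℝ) (η v : E d) : ℝ :=
  wignerConst d * width ε ^ ((d : ℝ) / 2) * Real.exp (-(‖η‖ ^ 2 / 4)) *
    Real.exp (-(width ε * ‖v‖ ^ 2))

/-- The weight of the pairs inside one tree of the belt. -/
def beltWeight (ε : ℝ) (s : ℤˣ) : (n : ℕ) → ((beltTree s n).Leaf → E d) → ℝ
  | 0, _ => 1
  | n + 1, ξ => beltWeight ε s n (fun i => ξ (Sum.inl (Sum.inl i))) *
      pairGauss ε (ξ (Sum.inl (Sum.inr ())) + ξ (Sum.inr ()))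
        ((ε / 2) • (ξ (Sum.inl (Sum.inr ())) - ξ (Sum.inr ())))

/-- Evenness in v makes it irrelevant through which of its two members a pair is listed, although
the positive member sits differently in the left and right trees. -/
theorem pairGauss_neg (ε : ℝ) (η v : E d) : pairGauss ε η (-v) = pairGauss ε η v := by
  simp [pairGauss]

theorem pairGauss_nonneg (ε : ℝ) (η v : E d) : 0 ≤ pairGauss ε η v := by
  have := wignerConst_pos d
  have := width_pos ε
  unfold pairGauss; positivity

theorem continuous_pairGauss (ε : ℝ) : Continuous fun z : E d × E d => pairGauss ε z.1 z.2 := by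
  unfold pairGauss; fun_prop

/-- A new link adds two initial vertices to each tree. Exactly one of them has parity 1: the lower
one on the left and the upper one on the right. -/
theorem prod_beltLeaf_succ (n : ℕ) (f : BeltLeaf (n + 1) → ℂ) :
    ∏ i with pairParity (beltTree (-1) (n + 1)) (beltTree 1 (n + 1)) i = 1, f i =
      (∏ i with pairParity (beltTree (-1) n) (beltTree 1 n) i = 1, f (beltEmb n i)) *
        f (Sum.inl (Sum.inl (Sum.inr ()))) * f (Sum.inr (Sum.inr ())) := by
  rw [Finset.prod_filter, Finset.prod_filter]
  set g : BeltLeaf (n + 1) → ℂ := fun i =>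
    if pairParity (beltTree (-1) (n + 1)) (beltTree 1 (n + 1)) i = 1 then f i else 1 with hg
  have h : ∀ s : ℤˣ, ∀ k : (beltTree s (n + 1)).Leaf → ℂ, ∏ i, k i =
      (∏ i, k (Sum.inl (Sum.inl i))) * k (Sum.inl (Sum.inr ())) * k (Sum.inr ()) := by
    intro s k
    refine (Fintype.prod_sum_type (α₁ := (beltTree s n).Leaf ⊕ Unit) (α₂ := Unit) k).trans ?_
    refine congrArg₂ (· * ·) ((Fintype.prod_sum_type (α₁ := (beltTree s n).Leaf) (α₂ := Unit)
      fun i => k (Sum.inl i)).trans ?_) (Fintype.prod_unique _)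
    exact congrArg₂ (· * ·) rfl (Fintype.prod_unique _)
  have h1 : ∏ i, g i = (∏ i, g (Sum.inl i)) * ∏ i, g (Sum.inr i) := Fintype.prod_sum_type g
  have h2 : (∏ i : BeltLeaf n, if pairParity (beltTree (-1) n) (beltTree 1 n) i = 1 then
      f (beltEmb n i) else 1) = (∏ i, g (Sum.inl (Sum.inl (Sum.inl i)))) *
        ∏ i, g (Sum.inr (Sum.inl (Sum.inl i))) := by
    refine (Finset.prod_congr rfl fun i _ => ?_).trans
      (Fintype.prod_sum_type fun i : BeltLeaf n => g (beltEmb n i))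
    rw [hg]
    simp only [pairParity_beltEmb]
  have h3 : g (Sum.inl (Sum.inl (Sum.inr ()))) = f (Sum.inl (Sum.inl (Sum.inr ()))) :=
    if_pos (neg_neg (1 : ℤˣ))
  have h4 : g (Sum.inl (Sum.inr ())) = 1 := if_neg (by decide : ¬ (-1 : ℤˣ) = 1)
  have h5 : g (Sum.inr (Sum.inl (Sum.inr ()))) = 1 := if_neg (by decide : ¬ (-1 : ℤˣ) = 1)
  have h6 : g (Sum.inr (Sum.inr ())) = f (Sum.inr (Sum.inr ())) := if_pos rfl
  rw [h2, h1, h, h, h3, h4, h5, h6]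
  ring

theorem prod_pairGauss_beltLeaf (ε : ℝ) (n : ℕ) (ξ : BeltLeaf n → E d) :
    ∏ i with pairParity (beltTree (-1) n) (beltTree 1 n) i = 1,
      ((pairGauss ε (ξ i + ξ (beltPair n i)) ((ε / 2) • (ξ i - ξ (beltPair n i))) : ℝ) : ℂ) =
      ((beltWeight ε (-1) n (fun i => ξ (Sum.inl i)) * beltWeight ε 1 n (fun i => ξ (Sum.inr i)) *
        pairGauss ε (ξ (Sum.inl (beltTree (-1) n).firstLeaf) +
            ξ (Sum.inr (beltTree 1 n).firstLeaf))
          ((ε / 2) • (ξ (Sum.inl (beltTree (-1) n).firstLeaf) -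
            ξ (Sum.inr (beltTree 1 n).firstLeaf))) : ℝ) : ℂ) := by
  induction n with
  | zero =>
    rw [Finset.prod_filter]
    refine (Fintype.prod_sum_type (α₁ := Unit) (α₂ := Unit) _).trans ?_
    rw [Fintype.prod_unique, Fintype.prod_unique]
    refine (congrArg₂ (· * ·) (if_neg (by decide : ¬ (-1 : ℤˣ) = 1)) (if_pos rfl)).trans ?_
    simp only [beltWeight, one_mul]
    congr 1
    rw [← pairGauss_neg, ← smul_neg, neg_sub, add_comm]
    rfl
  | succ n ih =>
    rw [prod_beltLeaf_succ]
    simp only [beltPair_emb]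
    rw [ih fun i => ξ (beltEmb n i)]
    simp only [beltWeight]
    have h : pairGauss ε (ξ (Sum.inr (Sum.inr ())) + ξ (beltPair (n + 1) (Sum.inr (Sum.inr ()))))
        ((ε / 2) • (ξ (Sum.inr (Sum.inr ())) - ξ (beltPair (n + 1) (Sum.inr (Sum.inr ()))))) =
        pairGauss ε (ξ (Sum.inr (Sum.inl (Sum.inr ()))) + ξ (Sum.inr (Sum.inr ())))
        ((ε / 2) • (ξ (Sum.inr (Sum.inl (Sum.inr ()))) - ξ (Sum.inr (Sum.inr ())))) := by
      rw [← pairGauss_neg, ← smul_neg, neg_sub, add_comm]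
      rfl
    rw [h, ← Complex.ofReal_mul, ← Complex.ofReal_mul]
    congr 1
    have key : ∀ a b c e f : ℝ, a * b * c * e * f = a * e * (b * f) * c := by
      intros; ring
    exact key _ _ _ _ _

theorem pairWeight_beltGraph {ε : ℝ} (hε : 0 < ε) (n : ℕ) (ξ : BeltLeaf n → E d) :
    (beltGraph n).pairWeight (gaussianProfile d) ε ξ =
      ((beltWeight ε (-1) n (fun i => ξ (Sum.inl i)) * beltWeight ε 1 n (fun i => ξ (Sum.inr i)) *
        pairGauss ε (ξ (Sum.inl (beltTree (-1) n).firstLeaf) +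
            ξ (Sum.inr (beltTree 1 n).firstLeaf))
          ((ε / 2) • (ξ (Sum.inl (beltTree (-1) n).firstLeaf) -
            ξ (Sum.inr (beltTree 1 n).firstLeaf))) : ℝ) : ℂ) := by
  rw [← prod_pairGauss_beltLeaf]
  unfold PairedGraph.pairWeight
  simp only [wignerHat_gaussianProfile hε]
  rfl

theorem beltWeight_nonneg (ε : ℝ) (s : ℤˣ) (n : ℕ) (ξ : (beltTree s n).Leaf → E d) :
    0 ≤ beltWeight ε s n ξ := by
  induction n with
  | zero => exact zero_le_one
  | succ n ih => exact mul_nonneg (ih _) (pairGauss_nonneg _ _ _)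

theorem continuous_beltWeight (ε : ℝ) (s : ℤˣ) (n : ℕ) :
    Continuous (beltWeight (d := d) ε s n) := by
  induction n with
  | zero => exact continuous_const
  | succ n ih =>
    have ha : ∀ i, Continuous fun ξ : (beltTree s (n + 1)).Leaf → E d => ξ i := fun i =>
      continuous_apply (A := fun _ : (beltTree s (n + 1)).Leaf => E d) i
    have hr : Continuous fun ξ : (beltTree s (n + 1)).Leaf → E d =>
        (fun i => ξ (Sum.inl (Sum.inl i)) : (beltTree s n).Leaf → E d) :=
      continuous_pi fun i => ha _
    have h1 := ha (Sum.inl (Sum.inr ()))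
    have h2 := ha (Sum.inr ())
    have hp : Continuous fun ξ : (beltTree s (n + 1)).Leaf → E d =>
        (ξ (Sum.inl (Sum.inr ())) + ξ (Sum.inr ()),
          (ε / 2) • (ξ (Sum.inl (Sum.inr ())) - ξ (Sum.inr ()))) :=
      (h1.add h2).prodMk ((continuous_const_smul (ε / 2)).comp (h1.sub h2))
    have h3 : Continuous fun ξ : (beltTree s (n + 1)).Leaf → E d =>
        beltWeight ε s n (fun i => ξ (Sum.inl (Sum.inl i))) := ih.comp hr
    have h4 := (continuous_pairGauss (d := d) ε).comp hp
    have h5 := h3.mul h4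
    exact h5.congr fun ξ => rfl

/-- The leftmost initial vertex is paired with the other tree, so its frequency does not enter the
weight. This is why it is the one to be solved for in the Kirchhoff law. -/
theorem beltWeight_congr (ε : ℝ) (s : ℤˣ) (n : ℕ) {ξ ξ' : (beltTree s n).Leaf → E d}
    (h : ∀ i, i ≠ (beltTree s n).firstLeaf → ξ i = ξ' i) :
    beltWeight ε s n ξ = beltWeight ε s n ξ' := by
  induction n with
  | zero => rfl
  | succ n ih =>
    have h1 : ξ (Sum.inl (Sum.inr ())) = ξ' (Sum.inl (Sum.inr ())) := h _ fun h => by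
      cases Sum.inl_injective h
    have h2 : ξ (Sum.inr ()) = ξ' (Sum.inr ()) := h _ fun h => by cases h
    rw [beltWeight, beltWeight, h1, h2]
    exact congrArg₂ (· * ·)
      (ih fun i hi => h _ fun h => hi (Sum.inl_injective (Sum.inl_injective h))) rfl

/-! ### Solving the Kirchhoff laws -/

section Solve

variable {ι : Type} [Fintype ι] [DecidableEq ι]

/-- The indices different from `i₀`. -/
abbrev Rest (i₀ : ι) : Type := {i : ι // i ≠ i₀}

/-- The family with prescribed values `y` away from the index `i₀` and with sum `q`. -/
def solveSum (i₀ : ι) (q : E d) (y : Rest i₀ → E d) : ι → E d :=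
  fun i => if h : i = i₀ then q - ∑ j, y j else y ⟨i, h⟩

theorem solveSumZero_eq (i₀ : ι) (y : Rest i₀ → E d) : solveSumZero i₀ y = solveSum i₀ 0 y := by
  funext i
  simp [solveSumZero, solveSum]

theorem solveSum_self (i₀ : ι) (q : E d) (y : Rest i₀ → E d) :
    solveSum i₀ q y i₀ = q - ∑ j, y j := by simp [solveSum]

theorem solveSum_of_ne (i₀ : ι) (q : E d) (y : Rest i₀ → E d) {i : ι} (h : i ≠ i₀) :
    solveSum i₀ q y i = y ⟨i, h⟩ := by simp [solveSum, h]

theorem prod_eq_mul_prod_rest {M : Type*} [CommMonoid M] (i₀ : ι) (g : ι → M) :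
    ∏ i, g i = g i₀ * ∏ i : Rest i₀, g i := by
  rw [← Finset.mul_prod_erase Finset.univ g (Finset.mem_univ i₀)]
  congr 1
  exact Finset.prod_subtype _ (fun i => by simp) g

theorem sum_solveSum (i₀ : ι) (q : E d) (y : Rest i₀ → E d) : ∑ i, solveSum i₀ q y i = q := by
  -- The additive splitting is the multiplicative one read in `Multiplicative (E d)`.
  have h := prod_eq_mul_prod_rest (M := Multiplicative (E d)) i₀
    fun i => Multiplicative.ofAdd (solveSum i₀ q y i)
  rw [← ofAdd_sum, ← ofAdd_sum, ← ofAdd_add, Multiplicative.ofAdd.injective.eq_iff] at h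
  rw [h, solveSum_self]
  have : ∀ i : Rest i₀, solveSum i₀ q y i = y i := fun i => solveSum_of_ne i₀ q y i.2
  simp [this]

theorem continuous_solveSum (i₀ : ι) :
    Continuous fun z : E d × (Rest i₀ → E d) => solveSum i₀ z.1 z.2 := by
  refine continuous_pi fun i => ?_
  by_cases h : i = i₀
  · subst h
    simp only [solveSum_self]
    fun_prop
  · simp only [solveSum_of_ne i₀ _ _ h]
    fun_prop

/-- For fixed y the solved coordinate q - ∑ y is a translate of q, so the map is a shear followed by
the insertion of a coordinate. Integrating over q therefore undoes the Dirac mass. -/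
theorem measurePreserving_solveSum (i₀ : ι) :
    MeasurePreserving (fun z : E d × (Rest i₀ → E d) => solveSum i₀ z.1 z.2) volume volume := by
  have h1 : MeasurePreserving (fun z : (Rest i₀ → E d) × E d => (z.1, z.2 - ∑ j, z.1 j))
      (volume.prod volume) (volume.prod volume) :=
    (MeasurePreserving.id volume).skew_product 
      (g := fun (y : Rest i₀ → E d) (q : E d) => q - ∑ j, y j)
      (by simp only [Function.uncurry_def]; fun_prop)
      (Filter.Eventually.of_forall fun y => (measurePreserving_sub_right volume _).map_eq)
  have h2 : MeasurePreserving (fun z : (Rest i₀ → E d) × E d =>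
      (fun i => if h : i = i₀ then z.2 else z.1 ⟨i, h⟩ : ι → E d))
      (volume.prod volume) volume := by
    have hm : Measurable (fun z : (Rest i₀ → E d) × E d =>
        (fun i => if h : i = i₀ then z.2 else z.1 ⟨i, h⟩ : ι → E d)) := by
      refine measurable_pi_iff.2 fun i => ?_
      by_cases h : i = i₀
      · simp only [h, dite_true]; exact measurable_snd
      · simp only [h, dite_false]; exact (measurable_pi_apply _).comp measurable_fst
    refine ⟨hm, (Measure.pi_eq fun s hs => ?_).symm⟩
    rw [Measure.map_apply hm (MeasurableSet.univ_pi hs)]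
    have h : (fun z : (Rest i₀ → E d) × E d =>
        (fun i => if h : i = i₀ then z.2 else z.1 ⟨i, h⟩ : ι → E d)) ⁻¹' Set.pi Set.univ s =
        (Set.pi Set.univ fun i : Rest i₀ => s i) ×ˢ s i₀ := by
      ext z
      simp only [Set.mem_preimage, Set.mem_pi, Set.mem_univ, forall_true_left, Set.mem_prod]
      refine ⟨fun h => ⟨fun i => by simpa [i.2] using h i, by simpa using h i₀⟩, fun h i => ?_⟩
      by_cases hi : i = i₀
      · subst hi; simpa using h.2
      · simpa [hi] using h.1 ⟨i, hi⟩
    rw [h, Measure.prod_prod, volume_pi, Measure.pi_pi, prod_eq_mul_prod_rest i₀, mul_comm]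
  exact (h2.comp h1).comp (Measure.measurePreserving_swap (μ := volume) (ν := volume))

end Solve

section Split

variable {ι κ : Type}

/-- Adding a second family to a family deprived of the index `i₀`. -/
def splitMap (i₀ : ι) (z : (Rest i₀ → E d) × (κ → E d)) : Rest (Sum.inl i₀ : ι ⊕ κ) → E d
  | ⟨Sum.inl a, h⟩ => z.1 ⟨a, fun h' => h (congrArg Sum.inl h')⟩
  | ⟨Sum.inr b, _⟩ => z.2 b

theorem inl_ne_inl {i₀ a : ι} (h : a ≠ i₀) : (Sum.inl a : ι ⊕ κ) ≠ Sum.inl i₀ :=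
  fun h' => h (Sum.inl_injective h')

theorem continuous_splitMap (i₀ : ι) :
    Continuous (splitMap (d := d) (κ := κ) i₀) := by
  refine continuous_pi fun i => ?_
  rcases i with ⟨a | b, h⟩
  · exact (continuous_apply _).comp continuous_fst
  · exact (continuous_apply _).comp continuous_snd

/-- Adding two indices to a family deprived of the index `i₀`. -/
def linkMap (i₀ : ι) (z : (Rest i₀ → E d) × E d × E d) :
    Rest (Sum.inl (Sum.inl i₀) : (ι ⊕ Unit) ⊕ Unit) → E d :=
  splitMap (Sum.inl i₀) (splitMap i₀ (z.1, fun _ => z.2.1), fun _ => z.2.2)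

theorem continuous_linkMap (i₀ : ι) : Continuous (linkMap (d := d) i₀) :=
  (continuous_splitMap _).comp (((continuous_splitMap i₀).comp (continuous_fst.prodMk
    (continuous_pi fun _ => continuous_snd.fst))).prodMk (continuous_pi fun _ => continuous_snd.snd))

variable [Fintype ι] [DecidableEq ι] [Fintype κ] [DecidableEq κ]

theorem prod_rest_inl {M : Type*} [CommMonoid M] (i₀ : ι)
    (g : Rest (Sum.inl i₀ : ι ⊕ κ) → M) :
    ∏ i, g i = (∏ a : Rest i₀, g ⟨Sum.inl a.1, inl_ne_inl a.2⟩) *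
      ∏ b : κ, g ⟨Sum.inr b, Sum.inr_ne_inl⟩ := by
  set e : Rest i₀ ⊕ κ → Rest (Sum.inl i₀ : ι ⊕ κ) := Sum.elim
    (fun a => ⟨Sum.inl a.1, inl_ne_inl a.2⟩) (fun b => ⟨Sum.inr b, Sum.inr_ne_inl⟩) with he
  have hbij : Function.Bijective e := by
    refine ⟨?_, ?_⟩
    · rintro (a | a) (b | b) h
      · have := Sum.inl_injective (Subtype.ext_iff.1 h)
        rw [Subtype.ext this]
      · cases Subtype.ext_iff.1 h
      · cases Subtype.ext_iff.1 h
      · have := Sum.inr_injective (Subtype.ext_iff.1 h)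
        rw [this]
    · rintro ⟨a | b, h⟩
      · exact ⟨Sum.inl ⟨a, fun h' => h (congrArg Sum.inl h')⟩, rfl⟩
      · exact ⟨Sum.inr b, rfl⟩
  rw [← Fintype.prod_bijective e hbij (fun i => g (e i)) g fun _ => rfl, Fintype.prod_sum_type]
  rfl

theorem measurePreserving_splitMap (i₀ : ι) :
    MeasurePreserving (splitMap (d := d) (κ := κ) i₀) volume volume := by
  have hm : Measurable (splitMap (d := d) (κ := κ) i₀) := (continuous_splitMap i₀).measurable
  refine ⟨hm, (Measure.pi_eq fun s hs => ?_).symm⟩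
  rw [Measure.map_apply hm (MeasurableSet.univ_pi hs)]
  have h : splitMap (d := d) (κ := κ) i₀ ⁻¹' Set.pi Set.univ s =
      (Set.pi Set.univ fun a : Rest i₀ => s ⟨Sum.inl a.1, inl_ne_inl a.2⟩) ×ˢ
        Set.pi Set.univ fun b => s ⟨Sum.inr b, Sum.inr_ne_inl⟩ := by
    ext z
    simp only [Set.mem_preimage, Set.mem_pi, Set.mem_univ, forall_true_left, Set.mem_prod]
    refine ⟨fun h => ⟨fun a => h ⟨Sum.inl a.1, inl_ne_inl a.2⟩,
      fun b => h ⟨Sum.inr b, Sum.inr_ne_inl⟩⟩, fun h i => ?_⟩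
    rcases i with ⟨a | b, hi⟩
    · exact h.1 ⟨a, fun h' => hi (congrArg Sum.inl h')⟩
    · exact h.2 b
  rw [h, Measure.volume_eq_prod, Measure.prod_prod, volume_pi, volume_pi, Measure.pi_pi,
    Measure.pi_pi, prod_rest_inl]

/-- The Kirchhoff law passes to the first family with its prescribed sum lowered by the sum of the
second one. -/
theorem solveSum_splitMap (i₀ : ι) (q : E d) (z : (Rest i₀ → E d) × (κ → E d)) :
    solveSum (Sum.inl i₀ : ι ⊕ κ) q (splitMap i₀ z) =
      Sum.elim (solveSum i₀ (q - ∑ b, z.2 b) z.1) z.2 := by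
  have hsum : ∑ j, splitMap i₀ z j = ∑ a, z.1 a + ∑ b, z.2 b := by
    have h := prod_rest_inl (M := Multiplicative (E d)) (κ := κ) i₀
      fun i => Multiplicative.ofAdd (splitMap i₀ z i)
    rw [← ofAdd_sum, ← ofAdd_sum, ← ofAdd_sum, ← ofAdd_add,
      Multiplicative.ofAdd.injective.eq_iff] at h
    exact h
  funext i
  rcases i with a | b
  · by_cases h : a = i₀
    · subst h
      rw [solveSum_self, Sum.elim_inl, solveSum_self, hsum]
      abel
    · rw [solveSum_of_ne _ _ _ (inl_ne_inl h), Sum.elim_inl, solveSum_of_ne _ _ _ h]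
      rfl
  · rw [solveSum_of_ne _ _ _ Sum.inr_ne_inl]
    rfl

theorem measurePreserving_linkMap (i₀ : ι) :
    MeasurePreserving (linkMap (d := d) i₀) volume volume := by
  have hu : MeasurePreserving (fun x : E d => (fun _ : Unit => x)) volume volume :=
    (volume_preserving_funUnique Unit (E d)).symm
  have h1 := (measurePreserving_splitMap (d := d) (κ := Unit) i₀).comp
    ((MeasurePreserving.id volume).prod hu)
  have h2 := (measurePreserving_splitMap (d := d) (κ := Unit) (Sum.inl i₀ : ι ⊕ Unit)).comp
    (h1.prod hu)
  exact h2.comp (measurePreserving_prodAssoc volume volume volume).symm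

theorem integral_linkMap (i₀ : ι) {g : (Rest (Sum.inl (Sum.inl i₀) : (ι ⊕ Unit) ⊕ Unit) → E d) → ℂ}
    (hg : Continuous g) : ∫ Y, g Y = ∫ z, g (linkMap i₀ z) := by
  have h := measurePreserving_linkMap (d := d) i₀
  rw [← h.map_eq, integral_map h.measurable.aemeasurable hg.aestronglyMeasurable]

theorem solveSum_linkMap (i₀ : ι) (q : E d) (z : (Rest i₀ → E d) × E d × E d) :
    solveSum (Sum.inl (Sum.inl i₀) : (ι ⊕ Unit) ⊕ Unit) q (linkMap i₀ z) =
      Sum.elim (Sum.elim (solveSum i₀ (q - (z.2.1 + z.2.2)) z.1) fun _ => z.2.1)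
        fun _ => z.2.2 := by
  rw [linkMap, solveSum_splitMap, solveSum_splitMap]
  congr 3
  simp
  abel

end Split

/-! ### The frequency integral over one tree of the belt -/

/-- The change from (η,ζ) to (ξ₁,ξ₂) is composed of two shears and a swap, hence has Jacobian of
modulus 1. -/
theorem measurePreserving_halfSumDiff :
    MeasurePreserving (fun z : E d × E d => (z.2 + (1 / 2 : ℝ) • z.1, (1 / 2 : ℝ) • z.1 - z.2))
      volume volume := by
  have h1 : MeasurePreserving (fun z : E d × E d => (z.1, z.2 + (1 / 2 : ℝ) • z.1))
      (volume.prod volume) (volume.prod volume) :=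
    (MeasurePreserving.id volume).skew_product (g := fun η ζ : E d => ζ + (1 / 2 : ℝ) • η)
      (by simp only [Function.uncurry_def]; fun_prop)
      (Filter.Eventually.of_forall fun y => (measurePreserving_add_right volume _).map_eq)
  have h2 : MeasurePreserving (fun z : E d × E d => (z.1, z.2 - z.1))
      (volume.prod volume) (volume.prod volume) :=
    (MeasurePreserving.id volume).skew_product (g := fun a η : E d => η - a)
      (by simp only [Function.uncurry_def]; fun_prop)
      (Filter.Eventually.of_forall fun y => (measurePreserving_sub_right volume _).map_eq)
  have h3 := (h2.comp (Measure.measurePreserving_swap (μ := volume) (ν := volume))).comp h1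
  have he : (fun z : E d × E d => (z.2 + (1 / 2 : ℝ) • z.1, (1 / 2 : ℝ) • z.1 - z.2)) =
      ((fun z => (z.1, z.2 - z.1)) ∘ Prod.swap) ∘ fun z => (z.1, z.2 + (1 / 2 : ℝ) • z.1) := by
    funext z
    simp only [Function.comp_apply, Prod.swap_prod_mk, Prod.mk.injEq, true_and]
    module
  rw [he]
  exact h3

theorem pairGauss_halfSumDiff (ε : ℝ) (η ζ : E d) :
    pairGauss ε (ζ + (1 / 2 : ℝ) • η + ((1 / 2 : ℝ) • η - ζ))
      ((ε / 2) • (ζ + (1 / 2 : ℝ) • η - ((1 / 2 : ℝ) • η - ζ))) =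
      wignerConst d * width ε ^ ((d : ℝ) / 2) * Real.exp (-(1 / 4 * ‖η‖ ^ 2)) *
        Real.exp (-((1 - width ε) * ‖ζ‖ ^ 2)) := by
  have h1 : ζ + (1 / 2 : ℝ) • η + ((1 / 2 : ℝ) • η - ζ) = η := by module
  have h2 : (ε / 2) • (ζ + (1 / 2 : ℝ) • η - ((1 / 2 : ℝ) • η - ζ)) = ε • ζ := by module
  rw [h1, h2, pairGauss, norm_smul, mul_pow, Real.norm_eq_abs, sq_abs, ← mul_assoc,
    width_mul_sq]
  congr 4
  ring

theorem width_lt_one {ε : ℝ} (hε : 0 < ε) : width ε < 1 := by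
  unfold width; rw [div_lt_one (by positivity)]; nlinarith [sq_pos_of_pos hε]

theorem integrable_pairGauss {ε : ℝ} (hε : 0 < ε) :
    Integrable fun z : E d × E d => pairGauss ε (z.1 + z.2) ((ε / 2) • (z.1 - z.2)) := by
  have hc : Continuous fun z : E d × E d => pairGauss ε (z.1 + z.2) ((ε / 2) • (z.1 - z.2)) :=
    (continuous_pairGauss ε).comp (f := fun z : E d × E d =>
      (z.1 + z.2, (ε / 2) • (z.1 - z.2))) (by fun_prop)
  rw [← measurePreserving_halfSumDiff.integrable_comp hc.aestronglyMeasurable]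
  simp only [Function.comp_def, pairGauss_halfSumDiff]
  exact ((integrable_gaussian (by norm_num : (0 : ℝ) < 1 / 4)).const_mul _).mul_prod
    (integrable_gaussian (by linarith [width_lt_one hε]))

theorem norm_beltTime_le (s : ℤˣ) (n : ℕ) (r : ℝ) :
    ∃ C : ℝ, ∀ (ξ : (beltTree s n).Leaf → E d) (t : ℝ), |t| ≤ r → ‖beltTime s n ξ t‖ ≤ C := by
  induction n with
  | zero => exact ⟨1, fun ξ t _ => by simp [beltTime]⟩
  | succ n ih =>
    obtain ⟨C, hC⟩ := ih
    refine ⟨C * r * r, fun ξ t ht => norm_doubleInterval_le ht fun s₂ s₁ hs₁ => ?_⟩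
    rw [norm_mul, norm_cexp_neg_I_mul, one_mul]
    exact hC _ _ hs₁

section Swap

variable {Y : Type*} [TopologicalSpace Y] [MeasurableSpace Y] [BorelSpace Y]
  {μ : Measure Y} [SFinite μ]

theorem integral_interval_swap {w : Y → ℝ} {h : Y → ℝ → ℂ} {s : ℝ} (hw : Integrable w μ)
    (hh : Continuous fun z : Y × ℝ => h z.1 z.2)
    (hb : ∀ y, ∀ x ∈ Set.uIoc 0 s, ‖h y x‖ ≤ w y) :
    ∫ y, (∫ x in (0 : ℝ)..s, h y x) ∂μ = ∫ x in (0 : ℝ)..s, ∫ y, h y x ∂μ := by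
  simp only [intervalIntegral.intervalIntegral_eq_integral_uIoc]
  rw [integral_smul]
  congr 1
  refine integral_integral_swap ?_
  have : IsFiniteMeasure (volume.restrict (Set.uIoc 0 s)) :=
    isFiniteMeasure_restrict.2 (by simp [Set.uIoc])
  have hd : Integrable (fun z : Y × ℝ => w z.1 * (1 : ℝ))
      (μ.prod (volume.restrict (Set.uIoc 0 s))) :=
    hw.mul_prod (integrable_const (1 : ℝ))
  refine hd.mono' hh.aestronglyMeasurable ?_
  have h1 : ∀ᵐ z ∂(μ.prod (volume.restrict (Set.uIoc 0 s))), z.2 ∈ Set.uIoc 0 s :=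
    Measure.quasiMeasurePreserving_snd.ae (ae_restrict_mem measurableSet_uIoc)
  filter_upwards [h1] with z hz
  rw [mul_one]
  exact hb _ _ hz

theorem integral_doubleInterval_swap {w : Y → ℝ} {H : Y → ℝ → ℝ → ℂ} {r s : ℝ}
    (hw : Integrable w μ) (hH : Continuous fun z : Y × ℝ × ℝ => H z.1 z.2.1 z.2.2)
    (hb : ∀ y s₂ s₁, |s₁| ≤ r → ‖H y s₂ s₁‖ ≤ w y) (hs : |s| ≤ r) :
    ∫ y, (∫ s₂ in (0 : ℝ)..s, ∫ s₁ in (0 : ℝ)..s₂, H y s₂ s₁) ∂μ =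
      ∫ s₂ in (0 : ℝ)..s, ∫ s₁ in (0 : ℝ)..s₂, ∫ y, H y s₂ s₁ ∂μ := by
  have hc : Continuous fun z : Y × ℝ => ∫ s₁ in (0 : ℝ)..z.2, H z.1 z.2 s₁ := by
    refine intervalIntegral.continuous_parametric_intervalIntegral_of_continuous ?_ continuous_snd
    exact hH.comp (f := fun z : (Y × ℝ) × ℝ => (z.1.1, z.1.2, z.2)) (by fun_prop)
  rw [integral_interval_swap (w := fun y => w y * r) (hw.mul_const r) hc]
  · refine intervalIntegral.integral_congr_ae (Filter.Eventually.of_forall fun s₂ hs₂ => ?_)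
    refine integral_interval_swap hw
      (hH.comp (f := fun z : Y × ℝ => (z.1, s₂, z.2)) (by fun_prop)) fun y s₁ hs₁ =>
      hb y s₂ s₁ ((abs_le_abs_of_mem_uIoc hs₁).trans ((abs_le_abs_of_mem_uIoc hs₂).trans hs))
  · intro y s₂ hs₂
    have h2 := (abs_le_abs_of_mem_uIoc hs₂).trans hs
    refine (intervalIntegral.norm_integral_le_of_norm_le_const fun s₁ hs₁ =>
      hb y s₂ s₁ ((abs_le_abs_of_mem_uIoc hs₁).trans h2)).trans ?_
    rw [sub_zero]
    exact mul_le_mul_of_nonneg_left h2 ((norm_nonneg _).trans (hb y s₂ 0 (by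
      simpa using (abs_nonneg _).trans h2)))

end Swap

/-- The integral over the frequencies of one tree of the belt, with top frequency `q` and with the
datum `f` at the leftmost initial vertex. -/
def chainInt (ε : ℝ) (f : E d → ℂ) (s : ℤˣ) (n : ℕ) (q : E d) (t : ℝ) : ℂ :=
  ∫ Y : Rest (beltTree s n).firstLeaf → E d,
    ((beltWeight ε s n (solveSum (beltTree s n).firstLeaf q Y) : ℝ) : ℂ) *
      (f (solveSum (beltTree s n).firstLeaf q Y (beltTree s n).firstLeaf) *
        beltTime s n (solveSum (beltTree s n).firstLeaf q Y) t)

theorem isEmpty_rest_zero (s : ℤˣ) : IsEmpty (Rest (beltTree s 0).firstLeaf) := ⟨fun i => i.2 rfl⟩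

theorem chainInt_zero (ε : ℝ) (f : E d → ℂ) (s : ℤˣ) (q : E d) (t : ℝ) :
    chainInt ε f s 0 q t = f q := by
  have := isEmpty_rest_zero s
  unfold chainInt
  rw [volume_pi, Measure.pi_of_empty, integral_dirac]
  simp [beltWeight, beltTime, solveSum_self]

theorem beltWeight_solveSum (ε : ℝ) (s : ℤˣ) (n : ℕ) (q : E d)
    (Y : Rest (beltTree s n).firstLeaf → E d) :
    beltWeight ε s n (solveSum (beltTree s n).firstLeaf q Y) =
      beltWeight ε s n (solveSum (beltTree s n).firstLeaf 0 Y) :=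
  beltWeight_congr ε s n fun i hi => by rw [solveSum_of_ne _ _ _ hi, solveSum_of_ne _ _ _ hi]

theorem beltWeight_solveSum_linkMap (ε : ℝ) (s : ℤˣ) (n : ℕ) (q : E d)
    (z : (Rest (beltTree s n).firstLeaf → E d) × E d × E d) :
    beltWeight ε s (n + 1) (solveSum (beltTree s (n + 1)).firstLeaf q
      (linkMap (beltTree s n).firstLeaf z)) =
      beltWeight ε s n (solveSum (beltTree s n).firstLeaf 0 z.1) *
        pairGauss ε (z.2.1 + z.2.2) ((ε / 2) • (z.2.1 - z.2.2)) := by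
  rw [← beltWeight_solveSum ε s n (q - (z.2.1 + z.2.2))]
  exact congrArg (beltWeight ε s (n + 1)) (solveSum_linkMap (beltTree s n).firstLeaf q z)

theorem continuous_beltWeight_solveSum (ε : ℝ) (s : ℤˣ) (n : ℕ) :
    Continuous fun z : E d × (Rest (beltTree s n).firstLeaf → E d) =>
      beltWeight ε s n (solveSum (beltTree s n).firstLeaf z.1 z.2) :=
  (continuous_beltWeight ε s n).comp (continuous_solveSum _)

theorem integrable_beltWeight_solveSum {ε : ℝ} (hε : 0 < ε) (s : ℤˣ) (n : ℕ) :
    Integrable fun Y : Rest (beltTree s n).firstLeaf → E d =>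
      beltWeight ε s n (solveSum (beltTree s n).firstLeaf 0 Y) := by
  induction n with
  | zero =>
    have := isEmpty_rest_zero s
    rw [volume_pi, Measure.pi_of_empty]
    exact integrable_const (1 : ℝ)
  | succ n ih =>
    have hc : Continuous fun Y : Rest (beltTree s (n + 1)).firstLeaf → E d =>
        beltWeight ε s (n + 1) (solveSum (beltTree s (n + 1)).firstLeaf 0 Y) :=
      (continuous_beltWeight_solveSum ε s (n + 1)).comp (f := fun Y => (0, Y)) (by fun_prop)
    refine ((measurePreserving_linkMap (d := d) (beltTree s n).firstLeaf).integrable_comp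
      hc.aestronglyMeasurable).1 ?_
    refine (ih.mul_prod (integrable_pairGauss hε)).congr (Filter.Eventually.of_forall fun z => ?_)
    exact (beltWeight_solveSum_linkMap ε s n 0 z).symm

theorem beltTime_solveSum_linkMap (s : ℤˣ) (n : ℕ) (q : E d) (t : ℝ)
    (z : (Rest (beltTree s n).firstLeaf → E d) × E d × E d) :
    beltTime s (n + 1) (solveSum (beltTree s (n + 1)).firstLeaf q
      (linkMap (beltTree s n).firstLeaf z)) t =
      ∫ s₂ in (0 : ℝ)..t, ∫ s₁ in (0 : ℝ)..s₂,
        Complex.exp (-Complex.I * ((linkPhase ((s : ℤ) : ℝ) (q - (z.2.1 + z.2.2)) z.2.1 z.2.2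
          s₂ s₁ : ℝ) : ℂ)) *
        beltTime s n (solveSum (beltTree s n).firstLeaf (q - (z.2.1 + z.2.2)) z.1) s₁ := by
  have h := congrArg (fun ξ => beltTime s (n + 1) ξ t)
    (solveSum_linkMap (beltTree s n).firstLeaf q z)
  refine h.trans ?_
  have h2 : q - (z.2.1 + z.2.2) = (beltTree s n).freq
      (solveSum (beltTree s n).firstLeaf (q - (z.2.1 + z.2.2)) z.1) := by
    rw [freq_eq_sum, sum_solveSum]
  have h3 : beltTime s (n + 1) (Sum.elim (Sum.elim (solveSum (beltTree s n).firstLeaf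
      (q - (z.2.1 + z.2.2)) z.1) fun _ => z.2.1) fun _ => z.2.2) t =
      ∫ s₂ in (0 : ℝ)..t, ∫ s₁ in (0 : ℝ)..s₂,
        Complex.exp (-Complex.I * ((linkPhase ((s : ℤ) : ℝ) ((beltTree s n).freq
          (solveSum (beltTree s n).firstLeaf (q - (z.2.1 + z.2.2)) z.1)) z.2.1 z.2.2
          s₂ s₁ : ℝ) : ℂ)) *
        beltTime s n (solveSum (beltTree s n).firstLeaf (q - (z.2.1 + z.2.2)) z.1) s₁ := rfl
  refine h3.trans ?_
  rw [← h2]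

theorem solveSum_linkMap_firstLeaf (s : ℤˣ) (n : ℕ) (q : E d)
    (z : (Rest (beltTree s n).firstLeaf → E d) × E d × E d) :
    solveSum (beltTree s (n + 1)).firstLeaf q (linkMap (beltTree s n).firstLeaf z)
        (beltTree s (n + 1)).firstLeaf =
      solveSum (beltTree s n).firstLeaf (q - (z.2.1 + z.2.2)) z.1 (beltTree s n).firstLeaf :=
  congrFun (solveSum_linkMap (beltTree s n).firstLeaf q z)
    (Sum.inl (Sum.inl (beltTree s n).firstLeaf))

theorem continuous_chainIntegrand (ε : ℝ) {f : E d → ℂ} (hf : Continuous f) (s : ℤˣ) (n : ℕ) :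
    Continuous fun z : E d × (Rest (beltTree s n).firstLeaf → E d) × ℝ =>
      ((beltWeight ε s n (solveSum (beltTree s n).firstLeaf z.1 z.2.1) : ℝ) : ℂ) *
      (f (solveSum (beltTree s n).firstLeaf z.1 z.2.1 (beltTree s n).firstLeaf) *
        beltTime s n (solveSum (beltTree s n).firstLeaf z.1 z.2.1) z.2.2) := by
  have h0 : Continuous fun z : E d × (Rest (beltTree s n).firstLeaf → E d) × ℝ =>
      solveSum (beltTree s n).firstLeaf z.1 z.2.1 :=
    (continuous_solveSum _).comp
      (f := fun z : E d × (Rest (beltTree s n).firstLeaf → E d) × ℝ => (z.1, z.2.1)) (by fun_prop)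
  have h1 := (continuous_beltTime (d := d) s n).comp (h0.prodMk continuous_snd.snd)
  have h2 := (continuous_beltWeight ε s n).comp h0
  have h3 := (continuous_apply (A := fun _ : (beltTree s n).Leaf => E d)
    (beltTree s n).firstLeaf).comp h0
  exact (Complex.continuous_ofReal.comp h2).mul ((hf.comp h3).mul h1)

/-- Peeling off the top link: by momentum conservation the shorter chain sees the top frequency q -
(ξ₁+ξ₂), and its weight does not depend on that frequency. Its inner frequencies are integrated
first, which requires exchanging them with the two times of the link. -/
theorem chainInt_succ {ε : ℝ} (hε : 0 < ε) {f : E d → ℂ} (hf : Continuous f)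
    (hf1 : ∀ p, ‖f p‖ ≤ 1) (s : ℤˣ) (n : ℕ) (q : E d) (t : ℝ) :
    chainInt ε f s (n + 1) q t =
      ∫ z : E d × E d, ((pairGauss ε (z.1 + z.2) ((ε / 2) • (z.1 - z.2)) : ℝ) : ℂ) *
        ∫ s₂ in (0 : ℝ)..t, ∫ s₁ in (0 : ℝ)..s₂,
          Complex.exp (-Complex.I * ((linkPhase ((s : ℤ) : ℝ) (q - (z.1 + z.2)) z.1 z.2
            s₂ s₁ : ℝ) : ℂ)) * chainInt ε f s n (q - (z.1 + z.2)) s₁ := by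
  obtain ⟨C', hC'⟩ := norm_beltTime_le (d := d) s n |t|
  set F : (Rest (beltTree s (n + 1)).firstLeaf → E d) → ℂ := fun Y =>
    ((beltWeight ε s (n + 1) (solveSum (beltTree s (n + 1)).firstLeaf q Y) : ℝ) : ℂ) *
      (f (solveSum (beltTree s (n + 1)).firstLeaf q Y (beltTree s (n + 1)).firstLeaf) *
        beltTime s (n + 1) (solveSum (beltTree s (n + 1)).firstLeaf q Y) t) with hF
  have hFc : Continuous F := (continuous_chainIntegrand ε hf s (n + 1)).comp
    (f := fun Y : Rest (beltTree s (n + 1)).firstLeaf → E d => (q, Y, t)) (by fun_prop)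
  set F' : ((Rest (beltTree s n).firstLeaf → E d) × E d × E d) → ℂ := fun z =>
    ((beltWeight ε s n (solveSum (beltTree s n).firstLeaf 0 z.1) *
      pairGauss ε (z.2.1 + z.2.2) ((ε / 2) • (z.2.1 - z.2.2)) : ℝ) : ℂ) *
      (f (solveSum (beltTree s n).firstLeaf (q - (z.2.1 + z.2.2)) z.1 (beltTree s n).firstLeaf) *
        ∫ s₂ in (0 : ℝ)..t, ∫ s₁ in (0 : ℝ)..s₂,
          Complex.exp (-Complex.I * ((linkPhase ((s : ℤ) : ℝ) (q - (z.2.1 + z.2.2)) z.2.1 z.2.2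
            s₂ s₁ : ℝ) : ℂ)) *
          beltTime s n (solveSum (beltTree s n).firstLeaf (q - (z.2.1 + z.2.2)) z.1) s₁) with hF'
  have hFz : ∀ z, F (linkMap (beltTree s n).firstLeaf z) = F' z := by
    intro z
    have h3 : ∀ {a a' : ℝ} {b b' : E d} {c c' : ℂ}, a = a' → b = b' → c = c' →
        (a : ℂ) * (f b * c) = (a' : ℂ) * (f b' * c') := by
      rintro _ _ _ _ _ _ rfl rfl rfl; rfl
    exact h3 (beltWeight_solveSum_linkMap ε s n q z)
      (solveSum_linkMap_firstLeaf s n q z) (beltTime_solveSum_linkMap s n q t z)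
  have hFc' : Continuous F' := (hFc.comp (continuous_linkMap (beltTree s n).firstLeaf)).congr hFz
  have h1 : chainInt ε f s (n + 1) q t = ∫ z, F' z :=
    (integral_linkMap (beltTree s n).firstLeaf hFc).trans (integral_congr_ae (Filter.Eventually.of_forall hFz))
  have hint : Integrable F' := by
    refine (((integrable_beltWeight_solveSum hε s n).mul_prod
      (integrable_pairGauss hε)).mul_const (C' * |t| * |t|)).mono' hFc'.aestronglyMeasurable
      (Filter.Eventually.of_forall fun z => ?_)
    rw [hF', norm_mul, norm_mul, Complex.norm_real, Real.norm_of_nonneg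
      (mul_nonneg (beltWeight_nonneg _ _ _ _) (pairGauss_nonneg _ _ _))]
    refine mul_le_mul_of_nonneg_left ?_
      (mul_nonneg (beltWeight_nonneg _ _ _ _) (pairGauss_nonneg _ _ _))
    refine (mul_le_mul (hf1 _) (norm_doubleInterval_le (C := C') le_rfl fun s₂ s₁ hs₁ => ?_)
      (norm_nonneg _) zero_le_one).trans_eq (one_mul _)
    rw [norm_mul, norm_cexp_neg_I_mul, one_mul]
    exact hC' _ _ hs₁
  rw [h1, Measure.volume_eq_prod, integral_prod_symm _ hint]
  refine integral_congr_ae (Filter.Eventually.of_forall fun z => ?_)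
  simp only [hF']
  set q' := q - (z.1 + z.2) with hq'
  set H : (Rest (beltTree s n).firstLeaf → E d) → ℝ → ℝ → ℂ := fun Y s₂ s₁ =>
    Complex.exp (-Complex.I * ((linkPhase ((s : ℤ) : ℝ) q' z.1 z.2 s₂ s₁ : ℝ) : ℂ)) *
      (((beltWeight ε s n (solveSum (beltTree s n).firstLeaf q' Y) : ℝ) : ℂ) * (f (solveSum (beltTree s n).firstLeaf q' Y (beltTree s n).firstLeaf) *
        beltTime s n (solveSum (beltTree s n).firstLeaf q' Y) s₁)) with hH
  have hHc : Continuous fun w : (Rest (beltTree s n).firstLeaf → E d) × ℝ × ℝ => H w.1 w.2.1 w.2.2 := by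
    refine Continuous.mul ?_ ((continuous_chainIntegrand ε hf s n).comp
      (f := fun w : (Rest (beltTree s n).firstLeaf → E d) × ℝ × ℝ => (q', w.1, w.2.2)) (by fun_prop))
    exact Complex.continuous_exp.comp (continuous_const.mul (Complex.continuous_ofReal.comp
      ((continuous_linkPhase _).comp (f := fun w : (Rest (beltTree s n).firstLeaf → E d) × ℝ × ℝ =>
        ((q', z.1, z.2), w.2)) (by fun_prop))))
  have hsw := integral_doubleInterval_swap (μ := volume) (r := |t|) (s := t)
    ((integrable_beltWeight_solveSum hε s n).mul_const C') hHc (fun Y s₂ s₁ hs₁ => by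
      rw [hH, norm_mul, norm_cexp_neg_I_mul, one_mul, norm_mul, norm_mul, Complex.norm_real,
        Real.norm_of_nonneg (beltWeight_nonneg _ _ _ _), beltWeight_solveSum]
      refine mul_le_mul_of_nonneg_left ?_ (beltWeight_nonneg _ _ _ _)
      calc _ ≤ 1 * C' := mul_le_mul (hf1 _) (hC' _ _ hs₁) (norm_nonneg _) zero_le_one
        _ = C' := one_mul _) le_rfl
  have h4 : ∀ s₂ s₁, ∫ Y, H Y s₂ s₁ =
      Complex.exp (-Complex.I * ((linkPhase ((s : ℤ) : ℝ) q' z.1 z.2 s₂ s₁ : ℝ) : ℂ)) *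
        chainInt ε f s n q' s₁ := fun s₂ s₁ => integral_const_mul _ _
  simp only [h4] at hsw
  rw [← hsw, ← integral_const_mul]
  refine integral_congr_ae (Filter.Eventually.of_forall fun Y => ?_)
  simp only [hH]
  simp only [mul_left_comm (Complex.exp _), intervalIntegral.integral_const_mul]
  rw [beltWeight_solveSum ε s n q']
  push_cast
  ring

/-! ### The frequency integral as a chain amplitude -/

/-- The chain parameters in the original variables. -/
def unscaledParam (ε σ : ℝ) (y : E d) : ChainParam d :=
  (Real.sqrt (1 + ε ^ 2) / (2 * ε), σ, 1, Real.sqrt (width ε / 2) * ε, y)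

/-- A modulated Gaussian. -/
def source (c : ℝ) (y p : E d) : ℂ :=
  Complex.exp (-Complex.I * ((inner ℝ y p : ℝ) : ℂ)) * ((Real.exp (-(c ^ 2 * ‖p‖ ^ 2)) : ℝ) : ℂ)

theorem continuous_source (c : ℝ) :
    Continuous fun z : E d × E d => source c z.1 z.2 := by
  unfold source; fun_prop

theorem norm_source (c : ℝ) (y p : E d) : ‖source c y p‖ = Real.exp (-(c ^ 2 * ‖p‖ ^ 2)) := by
  rw [source, norm_mul, norm_cexp_neg_I_mul, one_mul, Complex.norm_real,
    Real.norm_of_nonneg (Real.exp_pos _).le]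

theorem norm_source_le_one (c : ℝ) (y p : E d) : ‖source c y p‖ ≤ 1 := by
  rw [norm_source, Real.exp_le_one_iff]
  have : 0 ≤ c ^ 2 * ‖p‖ ^ 2 := by positivity
  linarith

/-- The constant produced by one link. -/
def linkConst (d : ℕ) (ε : ℝ) : ℝ :=
  wignerConst d * width ε ^ ((d : ℝ) / 2) * (Real.pi / (1 - width ε)) ^ ((d : ℝ) / 2)

/-- Polarization; the signs + + - are those produced by the alternating parities of the belt. -/
theorem omega_add_omega_sub (A B : E d) :
    ITree.omega A + ITree.omega B - ITree.omega (A - B) = inner ℝ A B := by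
  unfold ITree.omega
  rw [norm_sub_sq_real]
  ring

/-- Let p = q - η be the frequency below the link and B = p + ξ₁ the intermediate one. Polarization
at both vertices gives the phase σ B·(s₂q - s₁p), and B = ζ + q - η/2. There is no term quadratic in
ζ. -/
theorem linkPhase_halfSumDiff (σ : ℝ) (q η ζ : E d) (s₂ s₁ : ℝ) :
    linkPhase σ (q - (1 : ℝ) • η) (ζ + (1 / 2 : ℝ) • η) ((1 / 2 : ℝ) • η - ζ) s₂ s₁ =
      σ * inner ℝ (s₂ • q - s₁ • (q - (1 : ℝ) • η)) ζ +
        σ * inner ℝ (s₂ • q - s₁ • (q - (1 : ℝ) • η)) (q - (1 / 2 : ℝ) • η) := by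
  set p := q - (1 : ℝ) • η with hp
  set B := p + (ζ + (1 / 2 : ℝ) • η) with hB
  have h1 : p + (ζ + (1 / 2 : ℝ) • η) + ((1 / 2 : ℝ) • η - ζ) = q := by rw [hp]; module
  have h2 : (1 / 2 : ℝ) • η - ζ = q - B := by rw [hB, hp]; module
  have h3 : ζ + (1 / 2 : ℝ) • η = B - p := by rw [hB]; module
  have h4 : ζ + (q - (1 / 2 : ℝ) • η) = B := by rw [hB, hp]; module
  rw [← mul_add, ← inner_add_right, h4, linkPhase, h1, ← hB, h2, h3, omega_add_omega_sub,
    omega_add_omega_sub, inner_sub_left, real_inner_smul_left, real_inner_smul_left,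
    real_inner_comm B p]
  ring

theorem integral_gaussian_mul_linkPhase {ε : ℝ} (hε : 0 < ε) {σ : ℝ} (hσ : σ ^ 2 = 1)
    (q η : E d) (s₂ s₁ : ℝ) :
    ∫ ζ : E d, ((Real.exp (-((1 - width ε) * ‖ζ‖ ^ 2)) : ℝ) : ℂ) *
      Complex.exp (-Complex.I * ((linkPhase σ (q - (1 : ℝ) • η) (ζ + (1 / 2 : ℝ) • η)
        ((1 / 2 : ℝ) • η - ζ) s₂ s₁ : ℝ) : ℂ)) =
      (((Real.pi / (1 - width ε)) ^ ((d : ℝ) / 2) : ℝ) : ℂ) *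
        linkKernel (Real.sqrt (1 + ε ^ 2) / (2 * ε)) σ 1 q η s₂ s₁ := by
  set u := s₂ • q - s₁ • (q - (1 : ℝ) • η) with hu
  have hβ : 0 < 1 - width ε := by linarith [width_lt_one hε]
  have h1 : ∀ ζ : E d, ((Real.exp (-((1 - width ε) * ‖ζ‖ ^ 2)) : ℝ) : ℂ) *
      Complex.exp (-Complex.I * ((linkPhase σ (q - (1 : ℝ) • η) (ζ + (1 / 2 : ℝ) • η)
        ((1 / 2 : ℝ) • η - ζ) s₂ s₁ : ℝ) : ℂ)) =
      ((Real.exp (-((1 - width ε) * ‖ζ‖ ^ 2)) : ℝ) : ℂ) *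
        Complex.exp (Complex.I * ((inner ℝ (-(σ • u)) ζ : ℝ) : ℂ)) *
        Complex.exp (-Complex.I * ((σ * inner ℝ u (q - (1 / 2 : ℝ) • η) : ℝ) : ℂ)) := by
    intro ζ
    rw [linkPhase_halfSumDiff, ← hu, mul_assoc, ← Complex.exp_add, inner_neg_left,
      real_inner_smul_left]
    congr 2
    push_cast
    ring
  simp_rw [h1]
  rw [integral_mul_const, integral_gaussian_mul_cexp hβ, linkKernel, ← hu, norm_neg, norm_smul,
    mul_pow, Real.norm_eq_abs, sq_abs, hσ, one_mul, div_pow, Real.sq_sqrt (by positivity)]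
  -- This fixes A in `unscaledParam`: since 1 - w = ε²/(1+ε²), one has A² = 1/(4(1-w)).
  have h2 : ‖u‖ ^ 2 / (4 * (1 - width ε)) = (1 + ε ^ 2) / (2 * ε) ^ 2 * ‖u‖ ^ 2 := by
    rw [← width_mul_sq]
    unfold width
    field_simp
    ring
  rw [h2]
  push_cast
  ring

/-- Induction along the chain with ζ integrated out in each link. The modulation of the source
travels upwards: exp(-iy·(q-η)) leaves exp(-iy·q) in front and puts exp(iy·η) into the η-integral.
-/
theorem chainInt_eq {ε : ℝ} (hε : 0 < ε) (y : E d) (s : ℤˣ) (n : ℕ) (q : E d) (t : ℝ) :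
    chainInt ε (source (Real.sqrt (width ε / 2) * ε) y) s n q t =
      ((linkConst d ε ^ n : ℝ) : ℂ) * (Complex.exp (-Complex.I * ((inner ℝ y q : ℝ) : ℂ)) *
        chainAmp (unscaledParam ε ((s : ℤ) : ℝ) y) n q t) := by
  induction n generalizing q t with
  | zero =>
    rw [chainInt_zero, pow_zero, Complex.ofReal_one, one_mul, source, chainAmp]
    rfl
  | succ n ih =>
    set σ : ℝ := ((s : ℤ) : ℝ) with hσ
    have hσ2 : σ ^ 2 = 1 := by
      rcases Int.units_eq_one_or s with rfl | rfl <;> simp [hσ]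
    set θ := unscaledParam ε σ y with hθ
    set f := source (Real.sqrt (width ε / 2) * ε) y with hf
    have hfc : Continuous f := (continuous_source _).comp (f := fun p => (y, p)) (by fun_prop)
    obtain ⟨C, hC⟩ := norm_chainAmp_le (d := d) n |t|
    have hlc : 0 ≤ linkConst d ε := by
      have := wignerConst_pos d
      have := width_pos ε
      have : 0 < 1 - width ε := by linarith [width_lt_one hε]
      unfold linkConst; positivity
    set a : ℝ := wignerConst d * width ε ^ ((d : ℝ) / 2) with ha
    set R : E d → ℝ → ℂ := fun p s₁ => ((linkConst d ε ^ n : ℝ) : ℂ) *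
      (Complex.exp (-Complex.I * ((inner ℝ y p : ℝ) : ℂ)) * chainAmp θ n p s₁) with hR
    have hRc : Continuous fun z : E d × ℝ => R z.1 z.2 :=
      continuous_const.mul (Continuous.mul (by fun_prop) ((continuous_chainAmp n).comp
        (f := fun z : E d × ℝ => (θ, z.1, z.2)) (by fun_prop)))
    have hRb : ∀ p s₁, |s₁| ≤ |t| → ‖R p s₁‖ ≤ linkConst d ε ^ n * C := by
      intro p s₁ hs₁
      rw [hR, norm_mul, norm_mul, norm_cexp_neg_I_mul, one_mul, Complex.norm_real,
        Real.norm_of_nonneg (by positivity)]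
      gcongr
      exact hC _ _ _ hs₁
    set e : E d → E d → E d → ℝ → ℝ → ℂ := fun p ξ₁ ξ₂ s₂ s₁ =>
      Complex.exp (-Complex.I * ((linkPhase σ p ξ₁ ξ₂ s₂ s₁ : ℝ) : ℂ)) with he
    have hec : Continuous fun z : (E d × E d × E d) × ℝ × ℝ =>
        e z.1.1 z.1.2.1 z.1.2.2 z.2.1 z.2.2 :=
      Complex.continuous_exp.comp (continuous_const.mul (Complex.continuous_ofReal.comp
        (continuous_linkPhase σ)))
    have hen : ∀ p ξ₁ ξ₂ s₂ s₁, ‖e p ξ₁ ξ₂ s₂ s₁‖ = 1 := fun _ _ _ _ _ => norm_cexp_neg_I_mul _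
    have hIc : Continuous fun z : E d × E d => ∫ s₂ in (0 : ℝ)..t, ∫ s₁ in (0 : ℝ)..s₂,
        e (q - (z.1 + z.2)) z.1 z.2 s₂ s₁ * R (q - (z.1 + z.2)) s₁ := by
      refine intervalIntegral.continuous_parametric_intervalIntegral_of_continuous ?_
        continuous_const
      refine intervalIntegral.continuous_parametric_intervalIntegral_of_continuous
        (X := (E d × E d) × ℝ) (f := fun z s₁ => e (q - (z.1.1 + z.1.2)) z.1.1 z.1.2 z.2 s₁ *
          R (q - (z.1.1 + z.1.2)) s₁) (s := fun z => z.2) ?_ continuous_snd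
      exact (hec.comp (f := fun z : ((E d × E d) × ℝ) × ℝ =>
        ((q - (z.1.1.1 + z.1.1.2), z.1.1.1, z.1.1.2), z.1.2, z.2)) (by fun_prop)).mul
        (hRc.comp (f := fun z : ((E d × E d) × ℝ) × ℝ => (q - (z.1.1.1 + z.1.1.2), z.2))
          (by fun_prop))
    have hFc : Continuous fun z : E d × E d =>
        ((pairGauss ε (z.1 + z.2) ((ε / 2) • (z.1 - z.2)) : ℝ) : ℂ) *
        ∫ s₂ in (0 : ℝ)..t, ∫ s₁ in (0 : ℝ)..s₂,
          e (q - (z.1 + z.2)) z.1 z.2 s₂ s₁ * R (q - (z.1 + z.2)) s₁ :=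
      (Complex.continuous_ofReal.comp ((continuous_pairGauss ε).comp (f := fun z : E d × E d =>
        (z.1 + z.2, (ε / 2) • (z.1 - z.2))) (by fun_prop))).mul hIc
    have hmp := measurePreserving_halfSumDiff (d := d)
    have hsum : ∀ η ζ : E d, ζ + (1 / 2 : ℝ) • η + ((1 / 2 : ℝ) • η - ζ) = (1 : ℝ) • η := by
      intro η ζ; module
    have h1 : chainInt ε f s (n + 1) q t = ∫ z : E d × E d,
        ((a * Real.exp (-(1 / 4 * ‖z.1‖ ^ 2)) * Real.exp (-((1 - width ε) * ‖z.2‖ ^ 2)) : ℝ) : ℂ) *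
        ∫ s₂ in (0 : ℝ)..t, ∫ s₁ in (0 : ℝ)..s₂,
          e (q - (1 : ℝ) • z.1) (z.2 + (1 / 2 : ℝ) • z.1) ((1 / 2 : ℝ) • z.1 - z.2) s₂ s₁ *
            R (q - (1 : ℝ) • z.1) s₁ := by
      rw [chainInt_succ hε hfc (fun p => norm_source_le_one _ _ _)]
      simp only [ih]
      rw [← hmp.map_eq, integral_map hmp.measurable.aemeasurable hFc.aestronglyMeasurable]
      simp only [pairGauss_halfSumDiff]
      simp only [hsum]
      rw [hmp.map_eq]
    have hint : Integrable fun z : E d × E d =>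
        ((a * Real.exp (-(1 / 4 * ‖z.1‖ ^ 2)) * Real.exp (-((1 - width ε) * ‖z.2‖ ^ 2)) : ℝ) : ℂ) *
        ∫ s₂ in (0 : ℝ)..t, ∫ s₁ in (0 : ℝ)..s₂,
          e (q - (1 : ℝ) • z.1) (z.2 + (1 / 2 : ℝ) • z.1) ((1 / 2 : ℝ) • z.1 - z.2) s₂ s₁ *
            R (q - (1 : ℝ) • z.1) s₁ := by
      have hd : Integrable fun z : E d × E d => a * Real.exp (-(1 / 4 * ‖z.1‖ ^ 2)) *
          Real.exp (-((1 - width ε) * ‖z.2‖ ^ 2)) :=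
        ((integrable_gaussian (by norm_num : (0 : ℝ) < 1 / 4)).const_mul a).mul_prod
          (integrable_gaussian (by linarith [width_lt_one hε]))
      refine (hd.norm.mul_const (linkConst d ε ^ n * C * |t| * |t|)).mono'
        (((hFc.comp (f := fun z : E d × E d => (z.2 + (1 / 2 : ℝ) • z.1, (1 / 2 : ℝ) • z.1 - z.2))
          (by fun_prop)).congr fun z => ?_).aestronglyMeasurable)
        (Filter.Eventually.of_forall fun z => ?_)
      · simp only [Function.comp_apply, pairGauss_halfSumDiff]
        simp only [hsum]
        rfl
      · rw [norm_mul, Complex.norm_real]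
        refine mul_le_mul_of_nonneg_left
          (norm_doubleInterval_le le_rfl fun s₂ s₁ hs₁ => ?_) (norm_nonneg _)
        rw [norm_mul, hen, one_mul]
        exact hRb _ _ hs₁
    rw [h1, Measure.volume_eq_prod, integral_prod _ hint, chainAmp, ← integral_const_mul,
      ← integral_const_mul]
    refine integral_congr_ae (Filter.Eventually.of_forall fun η => ?_)
    simp only
    set β := 1 - width ε with hβ
    -- The ζ-integral is moved inside the time integrals, where it is an explicit Gaussian
    -- transform.
    have hsw := integral_doubleInterval_swap (μ := (volume : Measure (E d))) (r := |t|) (s := t)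
      (w := fun ζ => Real.exp (-(β * ‖ζ‖ ^ 2)) * (linkConst d ε ^ n * C))
      (H := fun ζ s₂ s₁ => ((Real.exp (-(β * ‖ζ‖ ^ 2)) : ℝ) : ℂ) *
          e (q - (1 : ℝ) • η) (ζ + (1 / 2 : ℝ) • η) ((1 / 2 : ℝ) • η - ζ) s₂ s₁ *
            R (q - (1 : ℝ) • η) s₁)
      ((integrable_gaussian (by linarith [width_lt_one hε])).mul_const _)
      ((Continuous.mul (by fun_prop) (hec.comp (f := fun z : E d × ℝ × ℝ =>
        ((q - (1 : ℝ) • η, z.1 + (1 / 2 : ℝ) • η, (1 / 2 : ℝ) • η - z.1), z.2)) (by fun_prop))).mul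
        (hRc.comp (f := fun z : E d × ℝ × ℝ => (q - (1 : ℝ) • η, z.2.2)) (by fun_prop)))
      (fun ζ s₂ s₁ hs₁ => by
        rw [norm_mul, norm_mul, hen, mul_one, Complex.norm_real,
          Real.norm_of_nonneg (Real.exp_pos _).le]
        gcongr
        exact hRb _ _ hs₁) le_rfl
    simp only [integral_mul_const, he, integral_gaussian_mul_linkPhase hε hσ2, hβ] at hsw
    have h2 : ∀ ζ : E d, ((a * Real.exp (-(1 / 4 * ‖η‖ ^ 2)) *
        Real.exp (-(β * ‖ζ‖ ^ 2)) : ℝ) : ℂ) * (∫ s₂ in (0 : ℝ)..t, ∫ s₁ in (0 : ℝ)..s₂,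
          e (q - (1 : ℝ) • η) (ζ + (1 / 2 : ℝ) • η) ((1 / 2 : ℝ) • η - ζ) s₂ s₁ *
            R (q - (1 : ℝ) • η) s₁) =
        ((a * Real.exp (-(1 / 4 * ‖η‖ ^ 2)) : ℝ) : ℂ) *
          ∫ s₂ in (0 : ℝ)..t, ∫ s₁ in (0 : ℝ)..s₂, ((Real.exp (-(β * ‖ζ‖ ^ 2)) : ℝ) : ℂ) *
          e (q - (1 : ℝ) • η) (ζ + (1 / 2 : ℝ) • η) ((1 / 2 : ℝ) • η - ζ) s₂ s₁ *
            R (q - (1 : ℝ) • η) s₁ := by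
      intro ζ
      simp only [mul_assoc, intervalIntegral.integral_const_mul]
      push_cast
      ring
    simp only [h2]
    rw [integral_const_mul]
    simp only [he, hβ]
    rw [hsw]
    have h3 : Complex.exp (-Complex.I * ((inner ℝ y (q - (1 : ℝ) • η) : ℝ) : ℂ)) =
        Complex.exp (-Complex.I * ((inner ℝ y q : ℝ) : ℂ)) *
          Complex.exp (Complex.I * ((inner ℝ y η : ℝ) : ℂ)) := by
      rw [← Complex.exp_add, one_smul, inner_sub_right]
      congr 1
      push_cast
      ring
    simp only [hR, h3]
    have h4 : ∀ s₂ s₁ : ℝ, (((Real.pi / (1 - width ε)) ^ ((d : ℝ) / 2) : ℝ) : ℂ) *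
        linkKernel (Real.sqrt (1 + ε ^ 2) / (2 * ε)) σ 1 q η s₂ s₁ *
        (((linkConst d ε ^ n : ℝ) : ℂ) * (Complex.exp (-Complex.I * ((inner ℝ y q : ℝ) : ℂ)) *
          Complex.exp (Complex.I * ((inner ℝ y η : ℝ) : ℂ)) *
            chainAmp θ n (q - (1 : ℝ) • η) s₁)) =
        ((((Real.pi / (1 - width ε)) ^ ((d : ℝ) / 2) : ℝ) : ℂ) * ((linkConst d ε ^ n : ℝ) : ℂ) *
          Complex.exp (-Complex.I * ((inner ℝ y q : ℝ) : ℂ)) *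
          Complex.exp (Complex.I * ((inner ℝ y η : ℝ) : ℂ))) *
        (linkKernel (Real.sqrt (1 + ε ^ 2) / (2 * ε)) σ 1 q η s₂ s₁ *
          chainAmp θ n (q - (1 : ℝ) • η) s₁) := by
      intros; ring
    simp only [h4, intervalIntegral.integral_const_mul]
    have h5 : linkIntegral θ.1 θ.2.1 θ.2.2.1 (chainAmp θ n) q η t =
        ∫ s₂ in (0 : ℝ)..t, ∫ s₁ in (0 : ℝ)..s₂,
          linkKernel (Real.sqrt (1 + ε ^ 2) / (2 * ε)) σ 1 q η s₂ s₁ *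
          chainAmp θ n (q - (1 : ℝ) • η) s₁ := rfl
    have h6 : θ.2.2.2.2 = y := rfl
    rw [h5, h6, pow_succ (linkConst d ε), linkConst, ← ha]
    push_cast
    ring

/-! ### The value of the belt -/

theorem linkKernel_neg (A μ δ : ℝ) (Q η : E d) (s₂ s₁ : ℝ) :
    linkKernel A (-μ) δ (-Q) (-η) s₂ s₁ = starRingEnd ℂ (linkKernel A μ δ Q η s₂ s₁) := by
  have h1 : s₂ • -Q - s₁ • (-Q - δ • -η) = -(s₂ • Q - s₁ • (Q - δ • η)) := by module
  have h2 : -Q - (δ / 2) • -η = -(Q - (δ / 2) • η) := by module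
  unfold linkKernel
  rw [h1, h2, norm_neg, inner_neg_neg, map_mul, Complex.conj_ofReal, ← Complex.exp_conj, map_mul,
    map_neg, Complex.conj_I, Complex.conj_ofReal]
  congr 2
  push_cast
  ring

/-- Reversing all parities changes the sign of μ. Reflecting Q and the integration variable η leaves
the Gaussians unchanged and conjugates exp(iy·η). -/
theorem chainAmp_neg (A μ δ c : ℝ) (y : E d) (n : ℕ) (Q : E d) (s : ℝ) :
    chainAmp ((A, -μ, δ, c, y) : ChainParam d) n (-Q) s =
      starRingEnd ℂ (chainAmp ((A, μ, δ, c, y) : ChainParam d) n Q s) := by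
  induction n generalizing Q s with
  | zero => simp only [chainAmp, norm_neg, Complex.conj_ofReal]
  | succ n ih =>
    simp only [chainAmp]
    rw [← integral_neg_eq_self, ← integral_conj]
    congr 1
    funext η
    have h : linkIntegral A (-μ) δ (chainAmp ((A, -μ, δ, c, y) : ChainParam d) n) (-Q) (-η) s =
        starRingEnd ℂ
          (linkIntegral A μ δ (chainAmp ((A, μ, δ, c, y) : ChainParam d) n) Q η s) := by
      have h1 : -Q - δ • -η = -(Q - δ • η) := by module
      unfold linkIntegral
      simp only [← intervalIntegral.intervalIntegral_conj, h1, linkKernel_neg, ih, map_mul]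
    rw [h, norm_neg, map_mul, map_mul, Complex.conj_ofReal, ← Complex.exp_conj, map_mul,
      Complex.conj_I, Complex.conj_ofReal, inner_neg_right]
    congr 3
    push_cast
    ring

/-- This is the source of reality and positivity: the two trees carry opposite root frequencies and
opposite parities, so their amplitudes are conjugate, and the modulations exp(iy·q) and exp(-iy·q)
cancel. -/
theorem chainInt_mul_chainInt {ε : ℝ} (hε : 0 < ε) (y : E d) (n : ℕ) (q : E d) (t : ℝ) :
    chainInt ε (source (Real.sqrt (width ε / 2) * ε) y) (-1) n (-q) t *
      chainInt ε (source (Real.sqrt (width ε / 2) * ε) y) 1 n q t =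
      (((linkConst d ε ^ n) ^ 2 * ‖chainAmp (unscaledParam ε 1 y) n q t‖ ^ 2 : ℝ) : ℂ) := by
  rw [chainInt_eq hε, chainInt_eq hε]
  have h1 : chainAmp (unscaledParam ε (((-1 : ℤˣ) : ℤ) : ℝ) y) n (-q) t =
      starRingEnd ℂ (chainAmp (unscaledParam ε 1 y) n q t) := by
    have := chainAmp_neg (Real.sqrt (1 + ε ^ 2) / (2 * ε)) 1 1 (Real.sqrt (width ε / 2) * ε) y n q t
    simpa [unscaledParam] using this
  have h2 : unscaledParam ε (((1 : ℤˣ) : ℤ) : ℝ) y = unscaledParam ε 1 y := by simp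
  rw [h1, h2]
  set U := chainAmp (unscaledParam ε 1 y) n q t
  have h3 : Complex.exp (-Complex.I * ((inner ℝ y (-q) : ℝ) : ℂ)) *
      Complex.exp (-Complex.I * ((inner ℝ y q : ℝ) : ℂ)) = 1 := by
    rw [← Complex.exp_add, inner_neg_right, ← Complex.exp_zero]
    congr 1
    push_cast
    ring
  have h4 : starRingEnd ℂ U * U = ((‖U‖ ^ 2 : ℝ) : ℂ) := by
    rw [Complex.conj_mul']; push_cast; rfl
  rw [Complex.ofReal_mul, ← h4]
  push_cast
  linear_combination ((linkConst d ε : ℂ) ^ n) ^ 2 * (starRingEnd ℂ U * U) * h3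

/-- The weight of the pair joining the two trees, as a superposition of product weights. -/
theorem pairGauss_eq_integral {ε : ℝ} (p p' : E d) :
    ((pairGauss ε (p + p') ((ε / 2) • (p - p')) : ℝ) : ℂ) =
      ((wignerConst d * width ε ^ ((d : ℝ) / 2) * (Real.pi ^ ((d : ℝ) / 2))⁻¹ : ℝ) : ℂ) *
        ∫ x : E d, ((Real.exp (-(1 * ‖x‖ ^ 2)) : ℝ) : ℂ) *
          (source (Real.sqrt (width ε / 2) * ε) (Real.sqrt (width ε) • x) p *
            source (Real.sqrt (width ε / 2) * ε) (Real.sqrt (width ε) • x) p') := by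
  have hw := width_pos ε
  set c := Real.sqrt (width ε / 2) * ε with hc
  -- By the parallelogram law, |p+p'|²/4 + (1-w)|p-p'|²/4 = w|p+p'|²/4 + (1-w)(|p|²+|p'|²)/2. The
  -- last term fixes c; the cross term is produced by the Gaussian integral over x.
  have hc2 : c ^ 2 = (1 - width ε) / 2 := by
    rw [hc, mul_pow, Real.sq_sqrt (by positivity), ← width_mul_sq]; ring
  have h1 : ∀ x : E d, ((Real.exp (-(1 * ‖x‖ ^ 2)) : ℝ) : ℂ) *
      (source c (Real.sqrt (width ε) • x) p * source c (Real.sqrt (width ε) • x) p') =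
      ((Real.exp (-(c ^ 2 * ‖p‖ ^ 2)) * Real.exp (-(c ^ 2 * ‖p'‖ ^ 2)) : ℝ) : ℂ) *
        (((Real.exp (-(1 * ‖x‖ ^ 2)) : ℝ) : ℂ) * Complex.exp (Complex.I *
          ((inner ℝ (-(Real.sqrt (width ε) • (p + p'))) x : ℝ) : ℂ))) := by
    intro x
    have h2 : Complex.exp (Complex.I * ((inner ℝ (-(Real.sqrt (width ε) • (p + p'))) x : ℝ) : ℂ)) =
        Complex.exp (-Complex.I * ((inner ℝ (Real.sqrt (width ε) • x) p : ℝ) : ℂ)) *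
          Complex.exp (-Complex.I * ((inner ℝ (Real.sqrt (width ε) • x) p' : ℝ) : ℂ)) := by
      rw [← Complex.exp_add, inner_neg_left, real_inner_smul_left, real_inner_smul_left,
        real_inner_smul_left, inner_add_left, real_inner_comm p x, real_inner_comm p' x]
      congr 1
      push_cast
      ring
    rw [h2, source, source]
    push_cast
    ring
  simp_rw [h1]
  rw [integral_const_mul, integral_gaussian_mul_cexp one_pos, ← Complex.ofReal_mul,
    ← Complex.ofReal_mul]
  congr 1
  have h3 : Real.exp (-(‖p + p'‖ ^ 2 / 4)) * Real.exp (-(width ε * ‖(ε / 2) • (p - p')‖ ^ 2)) =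
      Real.exp (-(c ^ 2 * ‖p‖ ^ 2)) * Real.exp (-(c ^ 2 * ‖p'‖ ^ 2)) *
        Real.exp (-(‖-(Real.sqrt (width ε) • (p + p'))‖ ^ 2 / (4 * 1))) := by
    rw [← Real.exp_add, ← Real.exp_add, ← Real.exp_add]
    congr 1
    rw [hc2, norm_neg, norm_smul, norm_smul, mul_pow _ ‖p + p'‖, mul_pow _ ‖p - p'‖,
      Real.norm_eq_abs, Real.norm_eq_abs, sq_abs, sq_abs, Real.sq_sqrt hw.le, norm_add_sq_real,
      norm_sub_sq_real]
    linear_combination (-(1 / 4) * (‖p‖ ^ 2 - 2 * inner ℝ p p' + ‖p'‖ ^ 2)) * width_mul_sq ε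
  rw [pairGauss, mul_assoc _ (Real.exp _) (Real.exp _), h3, div_one]
  have h4 : 0 < Real.pi ^ ((d : ℝ) / 2) := by positivity
  field_simp

section Kirchhoff

variable {ι κ : Type} [Fintype ι] [DecidableEq ι] [Fintype κ] [DecidableEq κ]

/-- The total frequency of the right tree is taken as a variable q; the vanishing of the sum then
gives the left tree the total -q, and the two trees interact only through q. -/
theorem integralSumZero_inl (i₀ : ι) (k₀ : κ) {g : (ι ⊕ κ → E d) → ℂ} (hg : Continuous g) :
    integralSumZero (Sum.inl i₀ : ι ⊕ κ) g =
      ∫ z : E d × (Rest i₀ → E d) × (Rest k₀ → E d),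
        g (Sum.elim (solveSum i₀ (-z.1) z.2.1) (solveSum k₀ z.1 z.2.2)) := by
  have h1 : MeasurePreserving (fun z : E d × (Rest i₀ → E d) × (Rest k₀ → E d) =>
      (z.2.1, z.2.2, z.1)) volume volume :=
    (volume_preserving_prodAssoc (α₁ := Rest i₀ → E d) (β₁ := Rest k₀ → E d) (γ₁ := E d)).comp
      (Measure.measurePreserving_swap (μ := (volume : Measure (E d)))
        (ν := (volume : Measure ((Rest i₀ → E d) × (Rest k₀ → E d)))))
  have h2 : MeasurePreserving (fun z : (Rest k₀ → E d) × E d => solveSum k₀ z.2 z.1)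
      volume volume :=
    (measurePreserving_solveSum k₀).comp
      (Measure.measurePreserving_swap (μ := (volume : Measure (Rest k₀ → E d)))
        (ν := (volume : Measure (E d))))
  have h3 : MeasurePreserving (fun z : (Rest i₀ → E d) × (Rest k₀ → E d) × E d =>
      (z.1, solveSum k₀ z.2.2 z.2.1)) volume volume :=
    (MeasurePreserving.id (volume : Measure (Rest i₀ → E d))).prod h2
  have hmp : MeasurePreserving (fun z : E d × (Rest i₀ → E d) × (Rest k₀ → E d) =>
      splitMap i₀ (z.2.1, solveSum k₀ z.1 z.2.2)) volume volume :=
    (measurePreserving_splitMap i₀).comp (h3.comp h1)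
  have hc : Continuous fun y : Rest (Sum.inl i₀ : ι ⊕ κ) → E d => g (solveSumZero (Sum.inl i₀) y) := by
    simp only [solveSumZero_eq]
    exact hg.comp ((continuous_solveSum _).comp (f := fun y => (0, y)) (by fun_prop))
  unfold integralSumZero
  have h := integral_map (μ := volume) hmp.measurable.aemeasurable
    (hc.aestronglyMeasurable (μ := Measure.map _ volume))
  rw [hmp.map_eq] at h
  refine h.trans (integral_congr_ae (Filter.Eventually.of_forall fun z => ?_))
  simp only [solveSumZero_eq, solveSum_splitMap, sum_solveSum, zero_sub]

end Kirchhoff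

/-- The integrand of `chainInt`. -/
def chainIntegrand (ε : ℝ) (f : E d → ℂ) (s : ℤˣ) (n : ℕ) (t : ℝ) (q : E d)
    (Y : Rest (beltTree s n).firstLeaf → E d) : ℂ :=
  ((beltWeight ε s n (solveSum (beltTree s n).firstLeaf q Y) : ℝ) : ℂ) *
    (f (solveSum (beltTree s n).firstLeaf q Y (beltTree s n).firstLeaf) *
      beltTime s n (solveSum (beltTree s n).firstLeaf q Y) t)

/-- The domain of the frequencies of the belt that remain free: the frequency at the root and the
frequencies at all initial vertices but the leftmost ones. -/
abbrev BeltFreq (d n : ℕ) : Type :=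
  E d × (Rest (beltTree (-1) n).firstLeaf → E d) × (Rest (beltTree 1 n).firstLeaf → E d)

theorem value_beltGraph_eq_integral {ε t : ℝ} (hε : 0 < ε) (ht : 0 ≤ t) (lam : ℝ) (n : ℕ) :
    (beltGraph n).value (gaussianProfile d) ε lam t =
      ((((lam * (2 * Real.pi) ^ (-(d : ℝ) / 2)) ^ (2 * n)) ^ 2 *
        ((2 * Real.pi) ^ ((d : ℝ) / 2) * ε ^ d) ^ (2 * n + 1) *
        (wignerConst d * width ε ^ ((d : ℝ) / 2) * (Real.pi ^ ((d : ℝ) / 2))⁻¹) : ℝ) : ℂ) *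
      ∫ z : BeltFreq d n, ∫ x : E d, ((Real.exp (-(1 * ‖x‖ ^ 2)) : ℝ) : ℂ) *
        (chainIntegrand ε (source (Real.sqrt (width ε / 2) * ε) (Real.sqrt (width ε) • x))
            (-1) n t (-z.1) z.2.1 *
          chainIntegrand ε (source (Real.sqrt (width ε / 2) * ε) (Real.sqrt (width ε) • x))
            1 n t z.1 z.2.2) := by
  set g : (BeltLeaf n → E d) → ℂ := fun ξ =>
    ((beltWeight ε (-1) n (fun i => ξ (Sum.inl i)) * beltWeight ε 1 n (fun i => ξ (Sum.inr i)) *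
        pairGauss ε (ξ (Sum.inl (beltTree (-1) n).firstLeaf) +
            ξ (Sum.inr (beltTree 1 n).firstLeaf))
          ((ε / 2) • (ξ (Sum.inl (beltTree (-1) n).firstLeaf) -
            ξ (Sum.inr (beltTree 1 n).firstLeaf))) : ℝ) : ℂ) *
      beltTime (-1) n (fun i => ξ (Sum.inl i)) t * beltTime 1 n (fun i => ξ (Sum.inr i)) t with hg
  have hl : Continuous fun ξ : BeltLeaf n → E d => (fun i => ξ (Sum.inl i)) := by fun_prop
  have hr : Continuous fun ξ : BeltLeaf n → E d => (fun i => ξ (Sum.inr i)) := by fun_prop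
  have hgc : Continuous g := by
    have h1 := (continuous_beltTime (d := d) (-1) n).comp
      (f := fun ξ : BeltLeaf n → E d => (fun i => ξ (Sum.inl i), t)) (by fun_prop)
    have h2 := (continuous_beltTime (d := d) 1 n).comp
      (f := fun ξ : BeltLeaf n → E d => (fun i => ξ (Sum.inr i), t)) (by fun_prop)
    have h3 := (continuous_pairGauss (d := d) ε).comp
      (f := fun ξ : BeltLeaf n → E d => (ξ (Sum.inl (beltTree (-1) n).firstLeaf) +
            ξ (Sum.inr (beltTree 1 n).firstLeaf),
          (ε / 2) • (ξ (Sum.inl (beltTree (-1) n).firstLeaf) -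
            ξ (Sum.inr (beltTree 1 n).firstLeaf)))) (by fun_prop)
    exact ((Complex.continuous_ofReal.comp ((((continuous_beltWeight ε (-1) n).comp hl).mul
      ((continuous_beltWeight ε 1 n).comp hr)).mul h3)).mul h1).mul h2
  have hint : ∀ ξ : BeltLeaf n → E d,
      ∫ τl in {τ : (beltGraph n).left.Node → ℝ | (beltGraph n).left.TimeConstraint τ t},
        ∫ τr in {τ : (beltGraph n).right.Node → ℝ | (beltGraph n).right.TimeConstraint τ t},
          (beltGraph n).pairWeight (gaussianProfile d) ε ξ *
            (beltGraph n).left.phase (fun i => ξ (Sum.inl i)) τl *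
            (beltGraph n).right.phase (fun i => ξ (Sum.inr i)) τr = g ξ := by
    intro ξ
    simp only [integral_const_mul, integral_mul_const]
    rw [pairWeight_beltGraph hε]
    exact congrArg₂ (· * ·) (congrArg₂ (· * ·) rfl (timeAmp_beltTree (-1) n _ ht))
      (timeAmp_beltTree 1 n _ ht)
  unfold PairedGraph.value
  have hval := integralSumZero_inl (beltTree (-1) n).firstLeaf (beltTree 1 n).firstLeaf hgc
  have hcl := coupling_beltTree (d := d) lam (-1) n
  have hcr := coupling_beltTree (d := d) lam 1 n
  have h5 : ∀ {a a' b b' c : ℂ} {f f' : (BeltLeaf n → E d) → ℂ}, a = a' → b = b' → f = f' →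
      a * b * c * integralSumZero (Sum.inl (beltTree (-1) n).firstLeaf : BeltLeaf n) f =
      a' * b' * c * integralSumZero (Sum.inl (beltTree (-1) n).firstLeaf : BeltLeaf n) f' := by
    rintro _ _ _ _ _ _ _ rfl rfl rfl; rfl
  refine (h5 hcl hcr (funext hint)).trans ?_
  rw [hval, ← integral_const_mul, ← integral_const_mul]
  refine integral_congr_ae (Filter.Eventually.of_forall fun z => ?_)
  simp only [hg, Sum.elim_inl, Sum.elim_inr]
  rw [Complex.ofReal_mul (beltWeight _ _ _ _ * _), pairGauss_eq_integral]
  set wl := beltWeight ε (-1) n (solveSum (beltTree (-1) n).firstLeaf (-z.1) z.2.1) with hwl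
  set wr := beltWeight ε 1 n (solveSum (beltTree 1 n).firstLeaf z.1 z.2.2) with hwr
  set Tl := beltTime (-1) n (solveSum (beltTree (-1) n).firstLeaf (-z.1) z.2.1) t with hTl
  set Tr := beltTime 1 n (solveSum (beltTree 1 n).firstLeaf z.1 z.2.2) t with hTr
  have h6 : ∀ x : E d, ((Real.exp (-(1 * ‖x‖ ^ 2)) : ℝ) : ℂ) *
        (chainIntegrand ε (source (Real.sqrt (width ε / 2) * ε) (Real.sqrt (width ε) • x))
            (-1) n t (-z.1) z.2.1 *
          chainIntegrand ε (source (Real.sqrt (width ε / 2) * ε) (Real.sqrt (width ε) • x))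
            1 n t z.1 z.2.2) = ((wl : ℂ) * (wr : ℂ) * Tl * Tr) *
        (((Real.exp (-(1 * ‖x‖ ^ 2)) : ℝ) : ℂ) *
          (source (Real.sqrt (width ε / 2) * ε) (Real.sqrt (width ε) • x)
            (solveSum (beltTree (-1) n).firstLeaf (-z.1) z.2.1 (beltTree (-1) n).firstLeaf) *
          source (Real.sqrt (width ε / 2) * ε) (Real.sqrt (width ε) • x)
            (solveSum (beltTree 1 n).firstLeaf z.1 z.2.2 (beltTree 1 n).firstLeaf))) := by
    intro x
    unfold chainIntegrand
    rw [← hwl, ← hwr, ← hTl, ← hTr]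
    ring
  simp only [h6, integral_const_mul]
  push_cast
  ring

/-- The pair weights inside the trees do not see the root frequency. Its integrability comes from
the source at the leftmost vertex of the right tree, whose frequency is q - ∑ ξ; a shear turns this
into a product. -/
theorem integrable_beltBoundFun {ε c : ℝ} (hε : 0 < ε) (hc : c ≠ 0) (n : ℕ) :
    Integrable fun z : BeltFreq d n =>
      Real.exp (-(c ^ 2 * ‖z.1 - ∑ j, z.2.2 j‖ ^ 2)) *
        (beltWeight ε (-1) n (solveSum (beltTree (-1) n).firstLeaf 0 z.2.1) *
          beltWeight ε 1 n (solveSum (beltTree 1 n).firstLeaf 0 z.2.2)) := by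
  have h1 : MeasurePreserving (fun z : ((Rest (beltTree (-1) n).firstLeaf → E d) ×
      (Rest (beltTree 1 n).firstLeaf → E d)) × E d => (z.1, z.2 - ∑ j, z.1.2 j))
      (volume.prod volume) (volume.prod volume) :=
    (MeasurePreserving.id volume).skew_product
      (g := fun (y : (Rest (beltTree (-1) n).firstLeaf → E d) ×
        (Rest (beltTree 1 n).firstLeaf → E d)) (q : E d) => q - ∑ j, y.2 j)
      (by simp only [Function.uncurry_def]; fun_prop)
      (Filter.Eventually.of_forall fun y => (measurePreserving_sub_right volume _).map_eq)
  have h2 : MeasurePreserving (fun z : BeltFreq d n => (z.1 - ∑ j, z.2.2 j, z.2)) volume volume :=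
    ((Measure.measurePreserving_swap (μ := volume) (ν := volume)).comp h1).comp
      (Measure.measurePreserving_swap (μ := volume) (ν := volume))
  have h3 : Integrable fun z : BeltFreq d n => Real.exp (-(c ^ 2 * ‖z.1‖ ^ 2)) *
      (beltWeight ε (-1) n (solveSum (beltTree (-1) n).firstLeaf 0 z.2.1) *
        beltWeight ε 1 n (solveSum (beltTree 1 n).firstLeaf 0 z.2.2)) :=
    (integrable_gaussian (by positivity)).mul_prod
      ((integrable_beltWeight_solveSum hε (-1) n).mul_prod
        (integrable_beltWeight_solveSum hε 1 n))
  exact (h2.integrable_comp h3.aestronglyMeasurable).2 h3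

/-- With x outermost and q next, the integrand factorizes between the two trees, and
`chainInt_mul_chainInt` gives a square. -/
theorem integral_beltFreq {ε : ℝ} (hε : 0 < ε) (n : ℕ) (t : ℝ) :
    ∫ z : BeltFreq d n, ∫ x : E d, ((Real.exp (-(1 * ‖x‖ ^ 2)) : ℝ) : ℂ) *
        (chainIntegrand ε (source (Real.sqrt (width ε / 2) * ε) (Real.sqrt (width ε) • x))
            (-1) n t (-z.1) z.2.1 *
          chainIntegrand ε (source (Real.sqrt (width ε / 2) * ε) (Real.sqrt (width ε) • x))
            1 n t z.1 z.2.2) =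
      (((linkConst d ε ^ n) ^ 2 * ∫ x : E d, Real.exp (-(1 * ‖x‖ ^ 2)) * ∫ q : E d,
        ‖chainAmp (unscaledParam ε 1 (Real.sqrt (width ε) • x)) n q t‖ ^ 2 : ℝ) : ℂ) := by
  set c := Real.sqrt (width ε / 2) * ε with hc
  have hc0 : c ≠ 0 := by
    have := width_pos ε
    positivity
  set f : E d → E d → ℂ := fun x => source c (Real.sqrt (width ε) • x) with hf
  obtain ⟨C, hC⟩ := norm_beltTime_le (d := d) (-1) n |t|
  obtain ⟨C', hC'⟩ := norm_beltTime_le (d := d) 1 n |t|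
  have hC0 : 0 ≤ C := (norm_nonneg _).trans (hC 0 0 (by simp))
  have hC0' : 0 ≤ C' := (norm_nonneg _).trans (hC' 0 0 (by simp))
  have hFc : Continuous fun w : BeltFreq d n × E d => ((Real.exp (-(1 * ‖w.2‖ ^ 2)) : ℝ) : ℂ) *
      (chainIntegrand ε (f w.2) (-1) n t (-w.1.1) w.1.2.1 *
        chainIntegrand ε (f w.2) 1 n t w.1.1 w.1.2.2) := by
    have hs : ∀ s : ℤˣ, Continuous fun w : E d × E d × (Rest (beltTree s n).firstLeaf → E d) =>
        chainIntegrand ε (f w.1) s n t w.2.1 w.2.2 := by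
      intro s
      have h0 : Continuous fun w : E d × E d × (Rest (beltTree s n).firstLeaf → E d) =>
          solveSum (beltTree s n).firstLeaf w.2.1 w.2.2 :=
        (continuous_solveSum (beltTree s n).firstLeaf).comp continuous_snd
      have h1 := (continuous_beltWeight ε s n).comp h0
      have h2 := (continuous_beltTime (d := d) s n).comp (h0.prodMk (continuous_const (y := t)))
      have h3 := (continuous_apply (A := fun _ : (beltTree s n).Leaf => E d)
        (beltTree s n).firstLeaf).comp h0
      have h4 := (continuous_source (d := d) c).comp
        ((continuous_fst.const_smul (Real.sqrt (width ε))).prodMk h3)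
      exact (Complex.continuous_ofReal.comp h1).mul (h4.mul h2)
    have hL := (hs (-1)).comp (f := fun w : BeltFreq d n × E d => (w.2, -w.1.1, w.1.2.1))
      (by fun_prop)
    have hR := (hs 1).comp (f := fun w : BeltFreq d n × E d => (w.2, w.1.1, w.1.2.2)) (by fun_prop)
    exact Continuous.mul (by fun_prop) (hL.mul hR)
  set D : BeltFreq d n → ℝ := fun z => Real.exp (-(c ^ 2 * ‖z.1 - ∑ j, z.2.2 j‖ ^ 2)) *
        (beltWeight ε (-1) n (solveSum (beltTree (-1) n).firstLeaf 0 z.2.1) *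
          beltWeight ε 1 n (solveSum (beltTree 1 n).firstLeaf 0 z.2.2)) with hD
  have hDi : Integrable D := integrable_beltBoundFun hε hc0 n
  have hb : ∀ (x : E d) (z : BeltFreq d n), ‖chainIntegrand ε (f x) (-1) n t (-z.1) z.2.1 *
        chainIntegrand ε (f x) 1 n t z.1 z.2.2‖ ≤ D z * (C * C') := by
    intro x z
    unfold chainIntegrand
    rw [norm_mul, norm_mul, norm_mul, norm_mul, norm_mul, Complex.norm_real, Complex.norm_real,
      Real.norm_of_nonneg (beltWeight_nonneg _ _ _ _),
      Real.norm_of_nonneg (beltWeight_nonneg _ _ _ _), beltWeight_solveSum ε (-1),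
      beltWeight_solveSum ε 1, hD]
    set wl := beltWeight ε (-1) n (solveSum (beltTree (-1) n).firstLeaf 0 z.2.1)
    set wr := beltWeight ε 1 n (solveSum (beltTree 1 n).firstLeaf 0 z.2.2)
    have hwl : 0 ≤ wl := beltWeight_nonneg _ _ _ _
    have hwr : 0 ≤ wr := beltWeight_nonneg _ _ _ _
    have h1 : ‖f x (solveSum (beltTree (-1) n).firstLeaf (-z.1) z.2.1
      (beltTree (-1) n).firstLeaf)‖ ≤ 1 := norm_source_le_one _ _ _
    have h2 : ‖f x (solveSum (beltTree 1 n).firstLeaf z.1 z.2.2 (beltTree 1 n).firstLeaf)‖ =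
        Real.exp (-(c ^ 2 * ‖z.1 - ∑ j, z.2.2 j‖ ^ 2)) := by
      rw [hf, norm_source, solveSum_self]
    rw [h2]
    calc _ ≤ wl * (1 * C) * (wr * (Real.exp (-(c ^ 2 * ‖z.1 - ∑ j, z.2.2 j‖ ^ 2)) * C')) := by
          gcongr
          · exact hC _ _ le_rfl
          · exact hC' _ _ le_rfl
      _ = _ := by ring
  have hint : Integrable (fun w : BeltFreq d n × E d => ((Real.exp (-(1 * ‖w.2‖ ^ 2)) : ℝ) : ℂ) *
      (chainIntegrand ε (f w.2) (-1) n t (-w.1.1) w.1.2.1 *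
        chainIntegrand ε (f w.2) 1 n t w.1.1 w.1.2.2)) (volume.prod volume) := by
    refine ((hDi.mul_const (C * C')).mul_prod (integrable_gaussian (d := d) one_pos)).mono'
      hFc.aestronglyMeasurable (Filter.Eventually.of_forall fun w => ?_)
    rw [norm_mul, Complex.norm_real, Real.norm_of_nonneg (Real.exp_pos _).le, mul_comm]
    gcongr
    exact hb _ _
  rw [integral_integral_swap hint]
  have hx : ∀ x : E d, ∫ z : BeltFreq d n, ((Real.exp (-(1 * ‖x‖ ^ 2)) : ℝ) : ℂ) *
      (chainIntegrand ε (f x) (-1) n t (-z.1) z.2.1 * chainIntegrand ε (f x) 1 n t z.1 z.2.2) =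
      (((linkConst d ε ^ n) ^ 2 * (Real.exp (-(1 * ‖x‖ ^ 2)) * ∫ q : E d,
        ‖chainAmp (unscaledParam ε 1 (Real.sqrt (width ε) • x)) n q t‖ ^ 2) : ℝ) : ℂ) := by
    intro x
    have hi : Integrable fun z : BeltFreq d n => ((Real.exp (-(1 * ‖x‖ ^ 2)) : ℝ) : ℂ) *
        (chainIntegrand ε (f x) (-1) n t (-z.1) z.2.1 *
          chainIntegrand ε (f x) 1 n t z.1 z.2.2) := by
      refine ((hDi.mul_const (C * C')).const_mul (Real.exp (-(1 * ‖x‖ ^ 2)))).mono'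
        (hFc.comp (f := fun z => (z, x)) (by fun_prop)).aestronglyMeasurable
        (Filter.Eventually.of_forall fun z => ?_)
      rw [norm_mul, Complex.norm_real, Real.norm_of_nonneg (Real.exp_pos _).le]
      gcongr
      exact hb _ _
    rw [Measure.volume_eq_prod, integral_prod _ hi]
    have hq : ∀ q : E d, ∫ y : (Rest (beltTree (-1) n).firstLeaf → E d) ×
        (Rest (beltTree 1 n).firstLeaf → E d), ((Real.exp (-(1 * ‖x‖ ^ 2)) : ℝ) : ℂ) *
        (chainIntegrand ε (f x) (-1) n t (-q) y.1 * chainIntegrand ε (f x) 1 n t q y.2) =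
        (((linkConst d ε ^ n) ^ 2 * Real.exp (-(1 * ‖x‖ ^ 2)) *
          ‖chainAmp (unscaledParam ε 1 (Real.sqrt (width ε) • x)) n q t‖ ^ 2 : ℝ) : ℂ) := by
      intro q
      rw [integral_const_mul, Measure.volume_eq_prod, integral_prod_mul]
      have h := chainInt_mul_chainInt hε (Real.sqrt (width ε) • x) n q t
      refine (congrArg _ h).trans ?_
      push_cast
      ring
    simp only [hq]
    rw [integral_complex_ofReal, integral_const_mul, mul_assoc]
  refine (integral_congr_ae (Filter.Eventually.of_forall hx)).trans ?_
  rw [integral_complex_ofReal, integral_const_mul]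

/-- The substitution q = (ε/t)Q is the one that brings A to order 1. It has Jacobian (ε/t)^d, and t
≤ ε keeps δ = t/ε in the domain of the decay estimate. -/
theorem integral_chainAmp_sq {ε t : ℝ} (hε : 0 < ε) (ht : 0 < t) (htε : t ≤ ε) {n : ℕ}
    (hn : d < 2 * n) :
    ∫ x : E d, Real.exp (-(1 * ‖x‖ ^ 2)) * ∫ q : E d,
        ‖chainAmp (unscaledParam ε 1 (Real.sqrt (width ε) • x)) n q t‖ ^ 2 =
      (ε / t) ^ d * (t ^ (2 * n)) ^ 2 * beltIntegral d n (t / ε, ε ^ 2 / t) := by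
  have hρ : 0 < ε / t := by positivity
  -- The product γδ recovers ε, so (δ,γ) determine all scaled parameters.
  have hγδ : ε ^ 2 / t * (t / ε) = ε := by field_simp
  have hscale : ∀ x Q : E d,
      chainAmp (unscaledParam ε 1 (Real.sqrt (width ε) • x)) n ((ε / t) • Q) t =
      ((t ^ (2 * n) : ℝ) : ℂ) * chainAmp (scaledParam (t / ε) (ε ^ 2 / t) x) n Q 1 := by
    intro x Q
    have h := chainAmp_scaling (Real.sqrt (1 + ε ^ 2) / (2 * ε)) 1 1
      (Real.sqrt (width ε / 2) * ε) (Real.sqrt (width ε) • x) hρ.ne' t n Q 1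
    rw [mul_one] at h
    have hp : scaledParam (t / ε) (ε ^ 2 / t) x =
        (Real.sqrt (1 + ε ^ 2) / (2 * ε) * (t * (ε / t)), 1 * (t * (ε / t) ^ 2), 1 / (ε / t),
          Real.sqrt (width ε / 2) * ε * (ε / t), Real.sqrt (width ε) • x) := by
      rw [scaledParam, hγδ]
      refine Prod.ext ?_ (Prod.ext ?_ (Prod.ext ?_ (Prod.ext ?_ rfl))) <;> simp only <;> field_simp
    rw [hp]
    exact h
  have hsub : ∀ x : E d, ∫ q : E d,
      ‖chainAmp (unscaledParam ε 1 (Real.sqrt (width ε) • x)) n q t‖ ^ 2 =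
      (ε / t) ^ d * (t ^ (2 * n)) ^ 2 *
        ∫ Q : E d, ‖chainAmp (scaledParam (t / ε) (ε ^ 2 / t) x) n Q 1‖ ^ 2 := by
    intro x
    have h := Measure.integral_comp_smul_of_nonneg (volume : Measure (E d))
      (fun q => ‖chainAmp (unscaledParam ε 1 (Real.sqrt (width ε) • x)) n q t‖ ^ 2)
      (ε / t) (hR := hρ.le)
    rw [finrank_euclideanSpace_fin] at h
    simp only [hscale, norm_mul, Complex.norm_real, mul_pow, Real.norm_eq_abs, sq_abs,
      integral_const_mul, smul_eq_mul] at h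
    rw [mul_assoc, h]
    field_simp
  have hδ : |(t / ε, ε ^ 2 / t).1| ≤ 1 := by
    simp only
    rw [abs_of_pos (by positivity), div_le_one hε]
    exact htε
  rw [beltIntegral, Measure.volume_eq_prod, integral_prod _ (integrable_beltIntegrand hn hδ),
    ← integral_const_mul]
  congr 1
  funext x
  simp only [hsub, beltIntegrand, integral_const_mul]
  ring

/-- The combinatorial constant in the value of the belt. -/
def beltConst (d n : ℕ) : ℝ :=
  ((2 * Real.pi) ^ (-(d : ℝ) / 2)) ^ (4 * n) * ((2 * Real.pi) ^ ((d : ℝ) / 2)) ^ (2 * n + 1) *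
    wignerConst d ^ (2 * n + 1) * (Real.pi ^ ((d : ℝ) / 2))⁻¹ * (Real.pi ^ ((d : ℝ) / 2)) ^ (2 * n)

theorem beltConst_pos (d n : ℕ) : 0 < beltConst d n := by
  have := wignerConst_pos d
  unfold beltConst; positivity

/-- Since w/(1-w) = ε⁻², the ζ-integral costs exactly ε^{-d} per link. -/
theorem linkConst_eq {ε : ℝ} (hε : 0 < ε) :
    linkConst d ε = wignerConst d * Real.pi ^ ((d : ℝ) / 2) * (ε ^ d)⁻¹ := by
  have hw := width_pos ε
  have h1 : 0 < 1 - width ε := by linarith [width_lt_one hε]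
  have h2 : width ε ^ ((d : ℝ) / 2) * (Real.pi / (1 - width ε)) ^ ((d : ℝ) / 2) =
      Real.pi ^ ((d : ℝ) / 2) * (ε ^ d)⁻¹ := by
    rw [← Real.mul_rpow hw.le (by positivity)]
    have h3 : width ε * (Real.pi / (1 - width ε)) = Real.pi * (ε ^ 2)⁻¹ := by
      rw [← width_mul_sq]; field_simp
    rw [h3, Real.mul_rpow (by positivity) (by positivity), Real.inv_rpow (by positivity),
      ← Real.rpow_natCast ε 2, ← Real.rpow_mul hε.le, ← Real.rpow_natCast ε d]
    congr 3
    push_cast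
    ring
  rw [linkConst, mul_assoc, h2, mul_assoc]

/-- The exact value of the belt for the Gaussian profile. -/
theorem value_beltGraph {ε t : ℝ} (hε : 0 < ε) (ht : 0 < t) (htε : t ≤ ε) (lam : ℝ) {n : ℕ}
    (hn : d < 2 * n) :
    (beltGraph n).value (gaussianProfile d) ε lam t =
      ((beltConst d n * width ε ^ ((d : ℝ) / 2) * beltIntegral d n (t / ε, ε ^ 2 / t) *
        ((lam * t) ^ (4 * n) * ε ^ (2 * d) * (t ^ d)⁻¹) : ℝ) : ℂ) := by
  rw [value_beltGraph_eq_integral hε ht.le, integral_beltFreq hε, ← Complex.ofReal_mul,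
    integral_chainAmp_sq hε ht htε hn, linkConst_eq hε, beltConst]
  congr 1
  generalize Real.pi ^ ((d : ℝ) / 2) = P
  generalize (2 * Real.pi) ^ ((d : ℝ) / 2) = P₂
  generalize (2 * Real.pi) ^ (-(d : ℝ) / 2) = P₃
  generalize width ε ^ ((d : ℝ) / 2) = w
  have h4 : 4 * n = 2 * n * 2 := by ring
  -- The normalization supplies 2n+1 factors ε^d, of which the 2n links consume all but one; the
  -- Jacobian of the scaling supplies (ε/t)^d.
  have h5 : (ε ^ d) ^ (2 * n + 1) * (((ε ^ d)⁻¹ ^ n) ^ 2 * (ε / t) ^ d) =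
      ε ^ (2 * d) * (t ^ d)⁻¹ := by
    rw [div_pow, mul_comm 2 d, pow_mul, pow_succ, mul_comm 2 n, pow_mul _ n 2]
    have : ε ^ d ≠ 0 := by positivity
    field_simp
    rw [← mul_pow, ← mul_pow, mul_one_div_cancel this, one_pow, one_pow]
  calc _ = (lam ^ (2 * n)) ^ 2 * (t ^ (2 * n)) ^ 2 * (P₃ ^ (2 * n)) ^ 2 * P₂ ^ (2 * n + 1) *
        (wignerConst d * (wignerConst d ^ n) ^ 2) * (P ^ n) ^ 2 * P⁻¹ * w *
        ((ε ^ d) ^ (2 * n + 1) * (((ε ^ d)⁻¹ ^ n) ^ 2 * (ε / t) ^ d)) *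
        beltIntegral d n (t / ε, ε ^ 2 / t) := by
        simp only [mul_pow]; ring
    _ = _ := by
        rw [h5, h4]
        simp only [mul_pow, pow_succ, pow_mul, pow_zero]
        ring

/-! ### Two-sided bounds and growth near the kinetic time -/

/-- The quantities `t / ε` and `ε² / t` are small on the range of times of the proposition. -/
theorem times_of_mem_range {ε κ t r : ℝ} (hε : 0 < ε) (hr : ε ^ κ < r) (hr1 : r ≤ 1)
    (h1 : ε ^ (2 - κ) ≤ t) (h2 : t ≤ ε ^ (1 + κ)) :
    0 < t ∧ t ≤ ε ∧ |t / ε| < r ∧ |ε ^ 2 / t| < r := by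
  have ht : 0 < t := (Real.rpow_pos_of_pos hε _).trans_le h1
  have h3 : t ≤ ε * ε ^ κ := by rwa [Real.rpow_add hε, Real.rpow_one] at h2
  have h4 : ε ^ 2 ≤ t * ε ^ κ := by
    rw [Real.rpow_sub hε, div_le_iff₀ (by positivity)] at h1
    exact_mod_cast h1
  have h5 : t / ε ≤ ε ^ κ := by rw [div_le_iff₀ hε]; linarith
  have h6 : ε ^ 2 / t ≤ ε ^ κ := by rw [div_le_iff₀ ht]; linarith
  refine ⟨ht, ?_, ?_, ?_⟩
  · nlinarith
  · rw [abs_of_pos (by positivity)]; linarith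
  · rw [abs_of_pos (by positivity)]; linarith

theorem half_le_width {ε : ℝ} (hε : 0 < ε) (h : ε ≤ 1) : 1 / 2 ≤ width ε := by
  rw [width]
  gcongr
  nlinarith

/-- The size of the belt for the Gaussian profile. -/
theorem exists_bounds_value_beltGraph {n : ℕ} (hn : d < 2 * n) {κ : ℝ} (hκ : 0 < κ) :
    ∃ C C' ε₀ : ℝ, 0 < C ∧ 0 < C' ∧ 0 < ε₀ ∧ ε₀ ≤ 1 ∧ ∀ ε : ℝ, 0 < ε → ε ≤ ε₀ → ∀ lam : ℝ,
      ∀ t : ℝ, ε ^ (2 - κ) ≤ t → t ≤ ε ^ (1 + κ) → 0 < t ∧ t ≤ ε ∧ ∃ v : ℝ,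
        (beltGraph n).value (gaussianProfile d) ε lam t = (v : ℂ) ∧
        C * (lam * t) ^ (4 * n) * ε ^ (2 * d) * (t ^ d)⁻¹ ≤ v ∧
        v ≤ C' * (lam * t) ^ (4 * n) * ε ^ (2 * d) * (t ^ d)⁻¹ := by
  obtain ⟨C, C', r, hC, hC', hr, hb⟩ := exists_bounds_beltIntegral (d := d) hn
  have hB := beltConst_pos d n
  have hm : 0 < min r 1 := lt_min hr one_pos
  -- For ε ≤ 1 the width lies between 1/2 and 1, whence the power of 1/2 in the lower constant only.
  -- The threshold forces ε^κ ≤ min r 1 / 2.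
  refine ⟨beltConst d n * (1 / 2) ^ ((d : ℝ) / 2) * C, beltConst d n * C',
    min 1 ((min r 1 / 2) ^ (1 / κ)), by positivity, by positivity, by positivity,
    min_le_left _ _, fun ε hε hε₀ lam t h1 h2 => ?_⟩
  have hε1 : ε ≤ 1 := hε₀.trans (min_le_left _ _)
  have hεκ : ε ^ κ < min r 1 := by
    have h := Real.rpow_le_rpow hε.le (hε₀.trans (min_le_right _ _)) hκ.le
    rw [← Real.rpow_mul (by positivity), one_div_mul_cancel hκ.ne', Real.rpow_one] at h
    linarith
  obtain ⟨ht, htε, hδ, hγ⟩ := times_of_mem_range hε hεκ (min_le_right _ _) h1 h2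
  obtain ⟨hl, hu⟩ := hb (t / ε) (ε ^ 2 / t) (hδ.trans_le (min_le_left _ _))
    (hγ.trans_le (min_le_left _ _))
  have hw0 : 0 ≤ width ε ^ ((d : ℝ) / 2) := Real.rpow_nonneg (width_pos ε).le _
  have hX : 0 ≤ (lam * t) ^ (4 * n) * ε ^ (2 * d) * (t ^ d)⁻¹ := by
    have : 0 ≤ (lam * t) ^ (4 * n) := by
      rw [show 4 * n = 2 * (2 * n) by ring, pow_mul]; positivity
    positivity
  refine ⟨ht, htε, _, value_beltGraph hε ht htε lam hn, ?_, ?_⟩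
  · have hw : (1 / 2 : ℝ) ^ ((d : ℝ) / 2) ≤ width ε ^ ((d : ℝ) / 2) :=
      Real.rpow_le_rpow (by norm_num) (half_le_width hε hε1) (by positivity)
    calc _ = beltConst d n * (1 / 2) ^ ((d : ℝ) / 2) * C *
          ((lam * t) ^ (4 * n) * ε ^ (2 * d) * (t ^ d)⁻¹) := by ring
      _ ≤ _ := by
        have := mul_nonneg hB.le hw0
        gcongr
  · have hw : width ε ^ ((d : ℝ) / 2) ≤ 1 :=
      Real.rpow_le_one (width_pos ε).le (width_le_one ε) (by positivity)
    calc _ ≤ beltConst d n * 1 * C' * ((lam * t) ^ (4 * n) * ε ^ (2 * d) * (t ^ d)⁻¹) := by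
          have := hC.le.trans hl
          gcongr
      _ = _ := by ring

/-- Slightly below the kinetic time scale, the belts grow faster than any power of `ε⁻¹`. -/
theorem rpow_neg_le_of_kineticTime {ε κ ν A C lam t : ℝ} {n : ℕ} (hε : 0 < ε) (hε1 : ε ≤ 1)
    (hC : 0 < C) (hεC : ε ≤ C) (hlam : 0 < lam) (ht0 : 0 < t) (htε : t ≤ ε)
    (ht : t = ε ^ ν * kineticTime ε lam) (h1 : ε ^ (2 - κ) ≤ t)
    (hn : A + 2 * d + 1 ≤ 2 * n * (κ - ν)) :
    ε ^ (-A) ≤ C * (lam * t) ^ (4 * n) * ε ^ (2 * d) * (t ^ d)⁻¹ := by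
  -- Only one of the two factors t is replaced by its value, giving λ²t = ε^{ν-2}; the other is kept
  -- for the lower bound ε^{2-κ}.
  have h2 : (lam * t) ^ 2 = ε ^ (ν - 2) * t := by
    rw [Real.rpow_sub hε, Real.rpow_two, mul_pow, sq t]
    nth_rewrite 1 [ht]
    rw [kineticTime]
    field_simp
  have h3 : ε ^ (ν - κ) ≤ (lam * t) ^ 2 := by
    rw [h2]
    calc ε ^ (ν - κ) = ε ^ (ν - 2) * ε ^ (2 - κ) := by rw [← Real.rpow_add hε]; congr 1; ring
      _ ≤ _ := by gcongr
  have h4 : ε ^ (-(A + 2 * d + 1)) ≤ (lam * t) ^ (4 * n) := by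
    calc ε ^ (-(A + 2 * d + 1)) ≤ ε ^ ((ν - κ) * ((2 * n : ℕ) : ℝ)) := by
          refine Real.rpow_le_rpow_of_exponent_ge hε hε1 ?_
          push_cast
          linarith
      _ = (ε ^ (ν - κ)) ^ (2 * n) := by rw [Real.rpow_mul hε.le, Real.rpow_natCast]
      _ ≤ ((lam * t) ^ 2) ^ (2 * n) := by gcongr
      _ = _ := by rw [← pow_mul]; congr 1; ring
  have h5 : 1 ≤ (t ^ d)⁻¹ := (one_le_inv₀ (by positivity)).2
    (pow_le_one₀ ht0.le (htε.trans hε1))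
  -- The extra 1 in the exponent leaves a spare factor ε, which is at most C.
  calc ε ^ (-A) = ε * ε ^ (-(A + 2 * d + 1)) * ε ^ (2 * d) * 1 := by
        nth_rewrite 2 [← Real.rpow_one ε]
        rw [mul_one, ← Real.rpow_natCast ε (2 * d), ← Real.rpow_add hε, ← Real.rpow_add hε]
        congr 1; push_cast; ring
    _ ≤ _ := by gcongr

end Belt

end

/-! ### The proposition -/

theorem proposition1p3 (d : ℕ) (hd : 2 ≤ d) :
    ∃ a : SchwartzMap (Belt.E d × Belt.E d) ℂ, ∀ κ : ℝ, 0 < κ →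
      (∃ nstar : ℕ, ∀ n : ℕ, nstar ≤ n →
        ∃ C C' ε₀ : ℝ, 0 < C ∧ 0 < C' ∧ 0 < ε₀ ∧
          ∀ ε : ℝ, 0 < ε → ε ≤ ε₀ → ∀ lam : ℝ, 0 < lam →
            ∀ t : ℝ, ε ^ (2 - κ) ≤ t → t ≤ ε ^ (1 + κ) →
              ((Belt.beltGraph n).value a ε lam t).im = 0 ∧
              C * (lam * t) ^ (4 * n) * ε ^ (2 * d) * (t ^ d)⁻¹
                ≤ ((Belt.beltGraph n).value a ε lam t).re ∧
              ((Belt.beltGraph n).value a ε lam t).re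
                ≤ C' * (lam * t) ^ (4 * n) * ε ^ (2 * d) * (t ^ d)⁻¹) ∧
      (∀ ν : ℝ, 0 ≤ ν → ν < κ → ∀ A : ℝ, ∃ n₁ : ℕ, ∀ n : ℕ, n₁ ≤ n →
        ∃ ε₀ : ℝ, 0 < ε₀ ∧
          ∀ ε : ℝ, 0 < ε → ε ≤ ε₀ → ∀ lam : ℝ, 0 < lam →
            ∀ t : ℝ, t = ε ^ ν * Belt.kineticTime ε lam →
              ε ^ (2 - κ) ≤ t → t ≤ ε ^ (1 + κ) →
              ENNReal.ofReal (ε ^ (-A))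
                ≤ ∑' G : Belt.PairedGraph (2 * n), ‖G.value a ε lam t‖ₑ) := by
  -- Any n with d < 2n would do; d + 1 is a convenient threshold, independent of κ.
  refine ⟨Belt.gaussianProfile d, fun κ hκ => ⟨⟨d + 1, fun n hn => ?_⟩, fun ν _ hν A => ?_⟩⟩
  · obtain ⟨C, C', ε₀, hC, hC', hε₀, -, h⟩ :=
      Belt.exists_bounds_value_beltGraph (d := d) (n := n) (by omega) hκ
    refine ⟨C, C', ε₀, hC, hC', hε₀, fun ε hε hle lam _ t h1 h2 => ?_⟩
    obtain ⟨-, -, v, hv, hl, hu⟩ := h ε hε hle lam t h1 h2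
    rw [hv, Complex.ofReal_im, Complex.ofReal_re]
    exact ⟨rfl, hl, hu⟩
  · obtain ⟨N, hN⟩ := exists_nat_ge ((A + 2 * d + 1) / (2 * (κ - ν)))
    refine ⟨max N (d + 1), fun n hn => ?_⟩
    obtain ⟨C, C', ε₀, hC, hC', hε₀, hε₁, h⟩ :=
      Belt.exists_bounds_value_beltGraph (d := d) (n := n)
        (by have := (le_max_right _ _).trans hn; omega) hκ
    refine ⟨min ε₀ C, lt_min hε₀ hC, fun ε hε hle lam hlam t ht h1 h2 => ?_⟩
    have hle₀ := hle.trans (min_le_left _ _)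
    obtain ⟨ht0, htε, v, hv, hl, -⟩ := h ε hε hle₀ lam t h1 h2
    have hn' : A + 2 * d + 1 ≤ 2 * n * (κ - ν) := by
      have hNn : (N : ℝ) ≤ n := by exact_mod_cast (le_max_left _ _).trans hn
      have := (div_le_iff₀ (by linarith)).1 (hN.trans hNn)
      linarith
    have hA := Belt.rpow_neg_le_of_kineticTime (d := d) hε (hle₀.trans hε₁) hC
      (hle.trans (min_le_right _ _)) hlam ht0 htε ht h1 hn'
    -- All terms are nonnegative, so the belt alone bounds the sum from below.
    refine le_trans ?_ (ENNReal.le_tsum (Belt.beltGraph n))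
    rw [hv, ← ofReal_norm, Complex.norm_real]
    exact ENNReal.ofReal_le_ofReal ((hA.trans hl).trans (le_abs_self v))
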